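/- Let $\mathbb D$ be the open unit disc. A one-parameter semigroup $(\phi_t)_{t\ge 0}$ consists of holomorphic self-maps of $\mathbb D$ with $\phi_0=\mathrm{id}$, $\phi_{s+t}=\phi_s\circ\phi_t$ and $\phi_t(z)\to z$ as $t\to0^+$; its infinitesimal generator is the holomorphic $G:\mathbb D\to\mathbb C$ with $\frac{d}{dt}\phi_t(z)=G(\phi_t(z))$ for all $z\in\mathbb D$, $t\ge0$. The Denjoy–Wolff point of a holomorphic self-map $\varphi\ne\mathrm{id}$ of $\mathbb D$ is its fixed point in $\mathbb D$ or, if there is none, its boundary regular fixed point $\tau$ with $\varphi'(\tau)\le1$. A point $\sigma\in\partial\mathbb D$ is a boundary regular fixed point (BRFP) of $\varphi$ if $\varphi$ has angular limit $\sigma$ and a finite angular derivative $\varphi'(\sigma)$ at $\sigma$; it is a BRFP of $(\phi_t)$ if it is a BRFP of every $\phi_t$, and the spectral value of $(\phi_t)$ at $\sigma$ is then the angular limit of $G(z)/(\sigma-z)$ as $z\to\sigma$. Let $n\ge1$, let $F=\{\sigma_1,\dots,\sigma_n\}\subset\partial\mathbb D$ consist of $n$ pairwise distinct points, let $\Lambda=(\lambda_1,\dots,\lambda_n)\in(-\infty,0)^n$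 and $\tau\in\overline{\mathbb D}\setminus F$. Denote by $\mathrm{Gen}_\tau(F,\Lambda)$ the class of all infinitesimal generators $G$ of one-parameter semigroups $(\phi_t)$ such that $\tau$ is the Denjoy–Wolff point of every $\phi_t\neq\mathrm{id}$ (so $G\equiv0$ is allowed) and each $\sigma_k$ is a BRFP of $(\phi_t)$ with spectral value $\lambda_k'$ satisfying $\lambda_k\le\lambda_k'\le0$. Put $$p_0(z;F,\Lambda)=\sum_{k=1}^n\alpha_k\frac{\sigma_k+z}{\sigma_k-z},\qquad \alpha_k=\frac{|\tau-\sigma_k|^2}{2|\lambda_k|}.$$ **Theorem.** (1) Every extreme point $G\not\equiv0$ of $\mathrm{Gen}_\tau(F,\Lambda)$ is of the form $$G(z)=\frac{(\tau-z)(1-\overline\tau z)}{ib+\sum_{j=1}^{n-1}a_j\frac{s_j+z}{s_j-z}+p_0(z;F,\Lambda)},\qquad z\in\mathbb D,$$ with some $b\in\mathbb R$, $a_1,\dots,a_{n-1}\ge0$ and $s_1,\dots,s_{n-1}\in\partial\mathbb D$ (points $s_j\in F$ are not excluded). (2) Let $\lambda<0$, $\sigma\in\partial\mathbb D$ and $\tau\in\overline{\mathbb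 D}\setminus\{\sigma\}$. A function $G:\mathbb D\to\mathbb C$ belongs to $\mathrm{Gen}_\tau(\{\sigma\},(\lambda))$ if and only if there is a Borel probability measure $\mu$ on $\partial\mathbb D$ such that $$G(z)=\frac{|\lambda|}{|\sigma-\tau|^2}(\tau-z)(1-\overline\tau z)(1-\overline\sigma z)\int_{\partial\mathbb D}\frac{1-\kappa}{1-\kappa\overline\sigma z}\,d\mu(\kappa)\qquad\text{for all }z\in\mathbb D.$$ -/

import Mathlib

open Filter Topology MeasureTheory
open scoped ComplexConjugate Complex.UnitDisc

/-- The unit circle `∂𝔻`, with its Borel σ-algebra. -/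
abbrev UnitCircle : Type := Metric.sphere (0 : ℂ) 1

/-- A complex-valued function on the open unit disc is holomorphic. -/
def IsHolomorphicOnDisc (f : 𝔻 → ℂ) : Prop :=
  ∃ g : ℂ → ℂ, DifferentiableOn ℂ g (Metric.ball 0 1) ∧ ∀ z : 𝔻, f z = g z

/-- `f` has the angular (non-tangential) limit `l` at the boundary point `σ`: it tends to `l` as
`z → σ` inside every Stolz region `{z : |σ - z| < M (1 - |z|)}`. -/
def HasAngularLimit (f : 𝔻 → ℂ) (σ l : ℂ) : Prop :=
  ∀ M : ℝ, Tendsto f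
    (comap (fun z : 𝔻 => (z : ℂ)) (𝓝 σ) ⊓ 𝓟 {z : 𝔻 | ‖σ - (z : ℂ)‖ < M * (1 - ‖(z : ℂ)‖)}) (𝓝 l)

/-- `σ ∈ ∂𝔻` is a boundary fixed point of the self-map `f`, with finite angular derivative `d`. -/
def HasBoundaryFixedPointDeriv (f : 𝔻 → 𝔻) (σ d : ℂ) : Prop :=
  ‖σ‖ = 1 ∧ HasAngularLimit (fun z => (f z : ℂ)) σ σ ∧
    HasAngularLimit (fun z => ((f z : ℂ) - σ) / ((z : ℂ) - σ)) σ d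

/-- `σ` is a boundary regular fixed point (BRFP) of the self-map `f`. -/
def IsBRFP (f : 𝔻 → 𝔻) (σ : ℂ) : Prop :=
  ∃ d : ℂ, HasBoundaryFixedPointDeriv f σ d

/-- `τ` is the Denjoy-Wolff point of the holomorphic self-map `f ≠ id`: either `τ` is a fixed point
of `f` in `𝔻`, or `f` has no fixed point in `𝔻` and `τ` is a BRFP of `f` with `f'(τ) ≤ 1`. -/
def IsDWPoint (f : 𝔻 → 𝔻) (τ : ℂ) : Prop :=
  (∃ a : 𝔻, (a : ℂ) = τ ∧ f a = a) ∨
    ((∀ a : 𝔻, f a ≠ a) ∧ ∃ d : ℝ, d ≤ 1 ∧ HasBoundaryFixedPointDeriv f τ (d : ℂ))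

/-- `(φ t)`, `t ≥ 0`, is a one-parameter semigroup of holomorphic self-maps of the unit disc
(the values of `φ` at negative times are irrelevant). -/
structure IsOneParameterSemigroup (φ : ℝ → 𝔻 → 𝔻) : Prop where
  holomorphic : ∀ t, 0 ≤ t → IsHolomorphicOnDisc (fun z => (φ t z : ℂ))
  map_zero : ∀ z, φ 0 z = z
  map_add : ∀ s t, 0 ≤ s → 0 ≤ t → ∀ z, φ (s + t) z = φ s (φ t z)
  tendsto_zero : ∀ z, Tendsto (fun t => φ t z) (𝓝[>] 0) (𝓝 z)

/-- `G` is the infinitesimal generator of `(φ t)`: it is holomorphic in `𝔻` and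
`d/dt φ t z = G (φ t z)` for all `t ≥ 0` (one-sided derivative at `t = 0`) and all `z ∈ 𝔻`. -/
def IsInfinitesimalGenerator (φ : ℝ → 𝔻 → 𝔻) (G : 𝔻 → ℂ) : Prop :=
  IsHolomorphicOnDisc G ∧ ∀ z : 𝔻, ∀ t : ℝ, 0 ≤ t →
    HasDerivWithinAt (fun s : ℝ => (φ s z : ℂ)) (G (φ t z)) (Set.Ici 0) t

/-- `τ` is the Denjoy-Wolff point of every element `φ t ≠ id` of the semigroup. For the trivial
semigroup every `τ` has this property, in accordance with the convention that the generator
`G ≡ 0` belongs to `Gen_τ` for every `τ`. -/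
def IsSemigroupDWPoint (φ : ℝ → 𝔻 → 𝔻) (τ : ℂ) : Prop :=
  ∀ t, 0 ≤ t → φ t ≠ id → IsDWPoint (φ t) τ

/-- `σ` is a BRFP of the semigroup `(φ t)` with generator `G`, and `l` is the spectral value of
the semigroup at `σ`, i.e. the angular limit of `G(z)/(σ - z)` at `σ`. -/
def HasSpectralValueAt (φ : ℝ → 𝔻 → 𝔻) (G : 𝔻 → ℂ) (σ : ℂ) (l : ℝ) : Prop :=
  (∀ t, 0 ≤ t → IsBRFP (φ t) σ) ∧ HasAngularLimit (fun z => G z / (σ - (z : ℂ))) σ (l : ℂ)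

/-- The class `Gen_τ(F, Λ)`, with `F = {σ 1, …, σ n}` and `Λ = (Λ 1, …, Λ n)`: all infinitesimal
generators of one-parameter semigroups with Denjoy-Wolff point `τ` (or trivial) having BRFPs
`σ k` with spectral values `l k` such that `Λ k ≤ l k ≤ 0`. -/
def GenClass (τ : ℂ) {n : ℕ} (σ : Fin n → UnitCircle) (Λ : Fin n → ℝ) : Set (𝔻 → ℂ) :=
  {G | ∃ φ : ℝ → 𝔻 → 𝔻, IsOneParameterSemigroup φ ∧ IsInfinitesimalGenerator φ G ∧
    IsSemigroupDWPoint φ τ ∧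
    ∀ k, ∃ l : ℝ, Λ k ≤ l ∧ l ≤ 0 ∧ HasSpectralValueAt φ G (σ k) l}

/-- `p₀(z; F, Λ) = ∑ₖ αₖ (σₖ + z) / (σₖ - z)` with `αₖ = |τ - σₖ|² / (2 |λₖ|)`. -/
noncomputable def pZero (τ : ℂ) {n : ℕ} (σ : Fin n → UnitCircle) (Λ : Fin n → ℝ) (z : ℂ) : ℂ :=
  ∑ k, ((‖τ - (σ k : ℂ)‖ ^ 2 / (2 * |Λ k|) : ℝ) : ℂ) * (((σ k : ℂ) + z) / ((σ k : ℂ) - z))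

/-!
By the Berkson–Porta formula and Herglotz's theorem, the generators with Denjoy–Wolff point `τ` are
`G z = (τ - z) (1 - conj τ z) p z` with `p z = i β + ∫ (κ + z) / (κ - z) dν(κ)` for a finite
positive measure `ν` on the circle. A point `σ ≠ τ` of the circle is a boundary regular fixed point
exactly when `p` vanishes there in the regular sense: `|κ - σ|⁻²` is `ν`-integrable and the formula
for `p` gives `0` at `σ`. The spectral value is then `-2 |τ - σ|² ∫ |κ - σ|⁻² dν(κ)`, so `GenClass`
is cut out by `n` linear equations and `n` linear inequalities in `(β, ν)`.

If `(β, ν)` is extreme and `k ≤ n` of the inequalities are equalities, then `ν` charges fewer than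
`n + k` pairwise disjoint sets: on any `n + k` such sets, a step function whose integrals vanish in
all active constraints, up to a shift of `β`, perturbs `ν` in both directions. Hence `p` is a finite
Herglotz sum, and so is `1 / p`, with as many atoms; each `σₖ` is an atom of `1 / p`, of mass at
least `αₖ` and exactly `αₖ` for the active indices. Splitting off `p₀` leaves at most `n - 1` atoms.

For a single point, absorbing the density `|κ - σ|⁻²` into `ν` gives a measure of bounded mass,
and the missing mass is placed at the point where the kernel of part (2) vanishes.
-/

/-! ### Herglotz integrals -/

/-- The Cayley kernel, regarded either as the Herglotz kernel with pole `a` or, for `a = σ` on the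
unit circle, as the Cayley transform of the disc onto the right half-plane sending `σ` to `∞`.
It is `herglotzRieszKernel 0 z a`, with the arguments in the order used by semigroup theory. -/
noncomputable def cayley (a z : ℂ) : ℂ := (a + z) / (a - z)

/-- The Herglotz integral `iβ + ∫ (κ + z) / (κ - z) dν(κ)` of a measure `ν` on the circle. -/
noncomputable def herglotz (β : ℝ) (ν : Measure UnitCircle) (z : ℂ) : ℂ :=
  Complex.I * β + ∫ κ : UnitCircle, cayley κ z ∂ν

lemma one_sub_norm_sq_pos {z : ℂ} (hz : ‖z‖ < 1) : 0 < 1 - ‖z‖ ^ 2 := by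
  nlinarith [norm_nonneg z]

namespace UnitCircle

variable (κ : UnitCircle)

@[simp] lemma norm_coe : ‖(κ : ℂ)‖ = 1 := mem_sphere_zero_iff_norm.1 κ.2

lemma coe_ne_zero : (κ : ℂ) ≠ 0 := norm_ne_zero_iff.1 (by simp)

lemma conj_mul_coe : conj (κ : ℂ) * κ = 1 := by
  rw [Complex.conj_mul', κ.norm_coe, Complex.ofReal_one, one_pow]

lemma conj_coe : conj (κ : ℂ) = (κ : ℂ)⁻¹ :=
  eq_inv_of_mul_eq_one_left κ.conj_mul_coe

lemma one_sub_norm_le_norm_coe_sub (z : ℂ) : 1 - ‖z‖ ≤ ‖(κ : ℂ) - z‖ := by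
  simpa using norm_sub_norm_le (κ : ℂ) z

lemma coe_sub_ne_zero {z : ℂ} (hz : ‖z‖ < 1) : (κ : ℂ) - z ≠ 0 :=
  norm_pos_iff.1 ((sub_pos.2 hz).trans_le (κ.one_sub_norm_le_norm_coe_sub z))

lemma norm_cayley_le {z : ℂ} (hz : ‖z‖ < 1) : ‖cayley κ z‖ ≤ 2 / (1 - ‖z‖) := by
  have h : ‖(κ : ℂ) + z‖ ≤ 2 := (norm_add_le _ _).trans (by rw [κ.norm_coe]; linarith)
  rw [cayley, norm_div]
  exact div_le_div₀ (by norm_num) h (by linarith) (κ.one_sub_norm_le_norm_coe_sub z)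

end UnitCircle

lemma re_cayley (a z : ℂ) : (cayley a z).re = (‖a‖ ^ 2 - ‖z‖ ^ 2) / ‖a - z‖ ^ 2 := by
  have := congrFun (poissonKernel_eq_re_herglotzRieszKernel (c := 0) (w := z)) a
  simpa [poissonKernel, herglotzRieszKernel, cayley] using this.symm

lemma re_cayley_coe (κ : UnitCircle) (z : ℂ) :
    (cayley κ z).re = (1 - ‖z‖ ^ 2) / ‖(κ : ℂ) - z‖ ^ 2 := by
  rw [re_cayley, κ.norm_coe, one_pow]

lemma re_cayley_coe_pos (κ : UnitCircle) {z : ℂ} (hz : ‖z‖ < 1) : 0 < (cayley κ z).re := by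
  rw [re_cayley_coe]
  exact div_pos (one_sub_norm_sq_pos hz) (pow_pos (norm_pos_iff.2 (κ.coe_sub_ne_zero hz)) 2)

lemma continuousOn_cayley_sphere {z : ℂ} (hz : ‖z‖ < 1) :
    ContinuousOn (fun a => cayley a z) (Metric.sphere 0 1) :=
  ContinuousOn.div (by fun_prop) (by fun_prop) fun a ha => UnitCircle.coe_sub_ne_zero ⟨a, ha⟩ hz

lemma continuous_cayley_coe {z : ℂ} (hz : ‖z‖ < 1) : Continuous fun κ : UnitCircle => cayley κ z :=
  continuousOn_iff_continuous_domRestrict.1 (continuousOn_cayley_sphere hz)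

lemma hasDerivAt_cayley {a z : ℂ} (h : a - z ≠ 0) :
    HasDerivAt (cayley a) (2 * a / (a - z) ^ 2) z := by
  refine (((hasDerivAt_id' z).const_add a).div ((hasDerivAt_id' z).const_sub a) h).congr_deriv ?_
  ring

section Herglotz

variable (β : ℝ) (ν : Measure UnitCircle)

lemma herglotz_eq_I_mul_add (z : ℂ) : herglotz β ν z = Complex.I * β + herglotz 0 ν z := by
  simp [herglotz]

variable [IsFiniteMeasure ν] {z : ℂ}

lemma integrable_cayley (hz : ‖z‖ < 1) : Integrable (fun κ : UnitCircle => cayley κ z) ν :=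
  Integrable.of_bound (continuous_cayley_coe hz).aestronglyMeasurable _
    (Eventually.of_forall fun κ => κ.norm_cayley_le hz)

lemma re_herglotz (hz : ‖z‖ < 1) : (herglotz β ν z).re = ∫ κ : UnitCircle, (cayley κ z).re ∂ν := by
  simpa [herglotz] using (integral_re (integrable_cayley ν hz)).symm

lemma re_herglotz_nonneg (hz : ‖z‖ < 1) : 0 ≤ (herglotz β ν z).re := by
  rw [re_herglotz β ν hz]
  exact integral_nonneg fun κ => (re_cayley_coe_pos κ hz).le

lemma re_herglotz_pos [NeZero ν] (hz : ‖z‖ < 1) : 0 < (herglotz β ν z).re := by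
  have hsupp : Function.support (fun κ : UnitCircle => (cayley κ z).re) = Set.univ :=
    Set.eq_univ_of_forall fun κ => (re_cayley_coe_pos κ hz).ne'
  rw [re_herglotz β ν hz, integral_pos_iff_support_of_nonneg
    (fun κ => (re_cayley_coe_pos κ hz).le) (integrable_cayley ν hz).re, hsupp]
  exact Measure.measure_univ_pos.2 (NeZero.ne ν)

lemma hasDerivAt_herglotz (hz : ‖z‖ < 1) :
    HasDerivAt (herglotz β ν) (∫ κ : UnitCircle, 2 * (κ : ℂ) / ((κ : ℂ) - z) ^ 2 ∂ν) z := by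
  set d := (1 - ‖z‖) / 2 with hd
  have hd0 : 0 < d := by rw [hd]; linarith
  have hball : ∀ x ∈ Metric.ball z d, ‖x‖ < 1 - d := fun x hx => by
    have := norm_le_norm_add_norm_sub' x z
    rw [mem_ball_iff_norm] at hx
    linarith
  have hbound : ∀ (κ : UnitCircle), ∀ x ∈ Metric.ball z d,
      ‖2 * (κ : ℂ) / ((κ : ℂ) - x) ^ 2‖ ≤ 2 / d ^ 2 := fun κ x hx => by
    rw [norm_div, norm_mul, norm_pow, κ.norm_coe, Complex.norm_ofNat, mul_one]
    gcongr
    linarith [κ.one_sub_norm_le_norm_coe_sub x, hball x hx]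
  refine (hasDerivAt_integral_of_dominated_loc_of_deriv_le (bound := fun _ => 2 / d ^ 2)
    (Metric.ball_mem_nhds z hd0) ?_ (integrable_cayley ν hz)
    (Measurable.aestronglyMeasurable (by fun_prop)) (Eventually.of_forall hbound)
    (integrable_const _) (Eventually.of_forall fun κ x hx => ?_)).2.const_add _
  · filter_upwards [Metric.ball_mem_nhds z hd0] with x hx
    exact (continuous_cayley_coe (by linarith [hball x hx])).aestronglyMeasurable
  · exact hasDerivAt_cayley (κ.coe_sub_ne_zero (by linarith [hball x hx]))

lemma differentiableOn_herglotz : DifferentiableOn ℂ (herglotz β ν) (Metric.ball 0 1) := fun _ hw =>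
  (hasDerivAt_herglotz β ν (mem_ball_zero_iff.1 hw)).differentiableAt.differentiableWithinAt

end Herglotz

lemma exists_measure_integral_eq_circleAverage {g : ℂ → ℝ}
    (hg : ContinuousOn g (Metric.sphere 0 1)) (hg0 : ∀ z ∈ Metric.sphere (0 : ℂ) 1, 0 ≤ g z) :
    ∃ ν : FiniteMeasure UnitCircle, ∀ H : ℂ → ℝ, ContinuousOn H (Metric.sphere 0 1) →
      ∫ κ : UnitCircle, H κ ∂(ν : Measure UnitCircle)
        = Real.circleAverage (fun z => H z * g z) 0 1 := by
  have hmem : ∀ θ : ℝ, circleMap 0 1 θ ∈ Metric.sphere (0 : ℂ) 1 := fun θ =>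
    circleMap_mem_sphere 0 zero_le_one θ
  let e : ℝ → UnitCircle := fun θ => ⟨circleMap 0 1 θ, hmem θ⟩
  have he : Continuous e := (continuous_circleMap 0 1).subtype_mk hmem
  let ρ : ℝ → ℝ := fun θ => g (circleMap 0 1 θ) / (2 * Real.pi)
  have hρ : Continuous ρ := (hg.comp_continuous (continuous_circleMap 0 1) hmem).div_const _
  let μ := (volume.restrict (Set.Ioc 0 (2 * Real.pi))).withDensity fun θ => ENNReal.ofReal (ρ θ)
  have : IsFiniteMeasure μ := isFiniteMeasure_withDensity_ofReal
    (hρ.integrableOn_Ioc (a := 0) (b := 2 * Real.pi)).2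
  refine ⟨⟨μ.map e, inferInstance⟩, fun H hH => ?_⟩
  have hHc : Continuous fun κ : UnitCircle => H κ :=
    hH.comp_continuous continuous_subtype_val fun κ => κ.2
  rw [FiniteMeasure.toMeasure_mk,
    integral_map he.measurable.aemeasurable hHc.aestronglyMeasurable,
    integral_withDensity_eq_integral_toReal_smul hρ.measurable.ennreal_ofReal
      (Eventually.of_forall fun _ => ENNReal.ofReal_lt_top), Real.circleAverage_def,
    intervalIntegral.integral_of_le (by positivity), smul_eq_mul, ← integral_const_mul]
  congr 1 with θ
  rw [ENNReal.toReal_ofReal (div_nonneg (hg0 _ (hmem θ)) (by positivity))]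
  simp only [e, smul_eq_mul]
  field_simp

/-- The Poisson integral formula, with the boundary values of `f.re` as a density. -/
lemma exists_measure_integral_re_cayley_eq_re {f : ℂ → ℂ}
    (hf : DiffContOnCl ℂ f (Metric.ball 0 1)) (hre : ∀ z ∈ Metric.sphere (0 : ℂ) 1, 0 ≤ (f z).re) :
    ∃ ν : FiniteMeasure UnitCircle, ∀ w : ℂ, ‖w‖ < 1 →
      ∫ κ : UnitCircle, (cayley κ w).re ∂(ν : Measure UnitCircle) = (f w).re := by
  have hcont : ContinuousOn f (Metric.sphere 0 1) :=
    hf.continuousOn_ball.mono Metric.sphere_subset_closedBall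
  obtain ⟨ν, hν⟩ := exists_measure_integral_eq_circleAverage
    (Complex.continuous_re.comp_continuousOn hcont) hre
  refine ⟨ν, fun w hw => ?_⟩
  have hker := Complex.continuous_re.comp_continuousOn (continuousOn_cayley_sphere hw)
  have hpoisson : Real.circleAverage (fun z => (cayley z w).re • f z) 0 1 = f w := by
    simpa [cayley] using hf.circleAverage_re_herglotzRieszKernel_smul' (mem_ball_zero_iff.2 hw)
  have hint : CircleIntegrable (fun z => (cayley z w).re • f z) 0 1 :=
    (hker.smul hcont).circleIntegrable zero_le_one
  have hcomm := Complex.reCLM.circleAverage_comp_comm hint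
  rw [hpoisson] at hcomm
  rw [hν (fun z => (cayley z w).re) hker]
  simpa [Function.comp_def] using hcomm

lemma exists_measure_integral_re_cayley_eq_re_dilation {f : ℂ → ℂ}
    (hf : DifferentiableOn ℂ f (Metric.ball 0 1)) (hre : ∀ z : ℂ, ‖z‖ < 1 → 0 ≤ (f z).re)
    {r : ℝ} (hr : r ∈ Set.Ico (0 : ℝ) 1) :
    ∃ ν : FiniteMeasure UnitCircle, ∀ w : ℂ, ‖w‖ < 1 →
      ∫ κ : UnitCircle, (cayley κ w).re ∂(ν : Measure UnitCircle) = (f (r * w)).re := by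
  have hmaps : Set.MapsTo (fun z : ℂ => (r : ℂ) * z) (Metric.closedBall 0 1) (Metric.ball 0 1) := by
    intro z hz
    rw [mem_closedBall_zero_iff] at hz
    rw [mem_ball_zero_iff, norm_mul, Complex.norm_real, Real.norm_of_nonneg hr.1]
    nlinarith [hr.1, hr.2]
  refine exists_measure_integral_re_cayley_eq_re (f := fun z => f (r * z)) ?_ fun z hz =>
    hre _ (mem_ball_zero_iff.1 (hmaps (Metric.sphere_subset_closedBall hz)))
  refine DifferentiableOn.diffContOnCl ?_
  rw [closure_ball _ one_ne_zero]
  exact hf.comp (by fun_prop) hmaps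

lemma mass_eq_of_integral_re_cayley {ν : FiniteMeasure UnitCircle} {c : ℝ}
    (h : ∫ κ : UnitCircle, (cayley κ 0).re ∂(ν : Measure UnitCircle) = c) : (ν.mass : ℝ) = c := by
  have hone (κ : UnitCircle) : (cayley κ 0).re = 1 := by
    rw [re_cayley_coe, norm_zero, sub_zero, UnitCircle.norm_coe]
    norm_num
  rw [← h, integral_congr_ae (Eventually.of_forall hone), integral_const, smul_eq_mul, mul_one]
  rfl

lemma tendsto_re_dilation {f : ℂ → ℂ} {w : ℂ} (hf : ContinuousAt f w) :
    Tendsto (fun r : ℝ => (f (r * w)).re) (𝓝[<] 1) (𝓝 (f w).re) := by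
  have hdil : Tendsto (fun r : ℝ => (r : ℂ) * w) (𝓝[<] 1) (𝓝 w) := by
    have : Continuous fun r : ℝ => (r : ℂ) * w := by fun_prop
    simpa using (this.tendsto 1).mono_left nhdsWithin_le_nhds
  exact (Complex.continuous_re.tendsto _).comp (hf.tendsto.comp hdil)

/-- The measures representing the dilations `z ↦ f (r z)` all have mass `(f 0).re`, so they
accumulate weakly-* as `r → 1`. -/
lemma exists_measure_integral_re_cayley_eq_re_of_nonneg {f : ℂ → ℂ}
    (hf : DifferentiableOn ℂ f (Metric.ball 0 1)) (hre : ∀ z : ℂ, ‖z‖ < 1 → 0 ≤ (f z).re) :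
    ∃ ν : FiniteMeasure UnitCircle, ∀ w : ℂ, ‖w‖ < 1 →
      ∫ κ : UnitCircle, (cayley κ w).re ∂(ν : Measure UnitCircle) = (f w).re := by
  choose! u hu using fun r => exists_measure_integral_re_cayley_eq_re_dilation hf hre (r := r)
  have hev : ∀ᶠ r in 𝓝[<] (1 : ℝ), r ∈ Set.Ico (0 : ℝ) 1 := Ico_mem_nhdsLT one_pos
  have hmass : ∀ᶠ r in 𝓝[<] (1 : ℝ),
      u r ∈ {μ : FiniteMeasure UnitCircle | μ.mass = ⟨(f 0).re, hre 0 (by simp)⟩} := by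
    filter_upwards [hev] with r hr
    have h0 := mass_eq_of_integral_re_cayley (hu r hr 0 (by simp))
    rw [mul_zero] at h0
    exact NNReal.coe_injective h0
  obtain ⟨ν, -, hν⟩ := (isCompact_setOfPred_finiteMeasure_eq_of_compactSpace UnitCircle
    _).exists_mapClusterPt (f := 𝓝[<] (1 : ℝ)) (u := u) (le_principal_iff.2 hmass)
  obtain ⟨U, hU, hUν⟩ := mapClusterPt_iff_ultrafilter.1 hν
  refine ⟨ν, fun w hw => ?_⟩
  have hcont : Continuous fun κ : UnitCircle => (cayley κ w).re :=
    Complex.continuous_re.comp (continuous_cayley_coe hw)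
  have hlim := FiniteMeasure.tendsto_iff_forall_integral_tendsto.1 hUν
    (BoundedContinuousFunction.mkOfCompact ⟨_, hcont⟩)
  simp only [BoundedContinuousFunction.mkOfCompact_apply, ContinuousMap.coe_mk] at hlim
  have hfw : ContinuousAt f w :=
    (hf.differentiableAt (Metric.isOpen_ball.mem_nhds (by simpa using hw))).continuousAt
  refine tendsto_nhds_unique (hlim.congr' ?_) ((tendsto_re_dilation hfw).mono_left hU)
  filter_upwards [hU hev] with r hr using hu r hr w hw

theorem exists_herglotz {f : ℂ → ℂ} (hf : DifferentiableOn ℂ f (Metric.ball 0 1))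
    (hre : ∀ z : ℂ, ‖z‖ < 1 → 0 ≤ (f z).re) :
    ∃ (β : ℝ) (ν : Measure UnitCircle), IsFiniteMeasure ν ∧
      ∀ z : ℂ, ‖z‖ < 1 → f z = herglotz β ν z := by
  obtain ⟨ν, hν⟩ := exists_measure_integral_re_cayley_eq_re_of_nonneg hf hre
  have hanalytic : AnalyticOnNhd ℂ (fun z => f z - herglotz 0 ν z) (Metric.ball 0 1) :=
    (hf.sub (differentiableOn_herglotz 0 ν)).analyticOnNhd Metric.isOpen_ball
  obtain ⟨β, hβ⟩ := hanalytic.eq_re_add_const_mul_I_of_re_eq_const (c₀ := 0)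
    (fun z hz => by
      rw [mem_ball_zero_iff] at hz
      rw [Complex.sub_re, re_herglotz 0 _ hz, hν z hz, sub_self])
    Metric.isOpen_ball (Metric.isConnected_ball one_pos)
  refine ⟨β, ν, inferInstance, fun z hz => ?_⟩
  rw [herglotz_eq_I_mul_add, ← sub_eq_iff_eq_add, hβ z (by simpa using hz)]
  simp [mul_comm]

/-! ### Angular limits of Herglotz integrals -/

/-- The filter of non-tangential approach to `σ` inside the Stolz region of aperture `M`; it is the
filter along which `HasAngularLimit` takes its limits. -/
noncomputable def stolzFilter (σ : ℂ) (M : ℝ) : Filter 𝔻 :=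
  comap (fun z : 𝔻 => (z : ℂ)) (𝓝 σ) ⊓ 𝓟 {z : 𝔻 | ‖σ - (z : ℂ)‖ < M * (1 - ‖(z : ℂ)‖)}

instance (σ : ℂ) (M : ℝ) : (stolzFilter σ M).IsCountablyGenerated := by
  unfold stolzFilter
  infer_instance

lemma tendsto_coe_stolzFilter (σ : ℂ) (M : ℝ) :
    Tendsto (fun z : 𝔻 => (z : ℂ)) (stolzFilter σ M) (𝓝 σ) :=
  tendsto_comap.mono_left inf_le_left

lemma eventually_stolzFilter (σ : ℂ) (M : ℝ) :
    ∀ᶠ z : 𝔻 in stolzFilter σ M, ‖σ - (z : ℂ)‖ < M * (1 - ‖(z : ℂ)‖) :=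
  Filter.le_def.1 inf_le_right _ (mem_principal_self _)

lemma one_sub_conj_mul_ne_zero {a z : ℂ} (ha : ‖a‖ ≤ 1) (hz : ‖z‖ < 1) : 1 - conj a * z ≠ 0 := by
  intro h
  have hnorm : ‖a‖ * ‖z‖ = 1 := by
    rw [← RCLike.norm_conj a, ← norm_mul, ← sub_eq_zero.1 h, norm_one]
  nlinarith [norm_nonneg a, norm_nonneg z]

namespace UnitCircle

lemma coe_sub_disc_ne_zero (σ : UnitCircle) (z : 𝔻) : (σ : ℂ) - (z : ℂ) ≠ 0 :=
  σ.coe_sub_ne_zero z.norm_lt_one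

lemma coe_sub_coe_ne_zero {κ σ : UnitCircle} (h : κ ≠ σ) : (κ : ℂ) - σ ≠ 0 :=
  sub_ne_zero.2 fun h' => h (Subtype.ext h')

lemma one_sub_conj_mul (σ : UnitCircle) (z : ℂ) :
    1 - conj (σ : ℂ) * z = conj (σ : ℂ) * (σ - z) := by
  rw [mul_sub, σ.conj_mul_coe]

lemma norm_one_sub_conj_mul (σ : UnitCircle) (z : ℂ) :
    ‖1 - conj (σ : ℂ) * z‖ = ‖(σ : ℂ) - z‖ := by
  rw [σ.one_sub_conj_mul, norm_mul, RCLike.norm_conj, σ.norm_coe, one_mul]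

lemma norm_real_mul {r : ℝ} (hr : 0 ≤ r) (σ : UnitCircle) : ‖(r : ℂ) * σ‖ = r := by
  rw [norm_mul, σ.norm_coe, mul_one, Complex.norm_real, Real.norm_of_nonneg hr]

lemma ofReal_norm_coe_sub_coe_sq (κ σ : UnitCircle) :
    ((‖(κ : ℂ) - σ‖ ^ 2 : ℝ) : ℂ) = -((κ : ℂ) - σ) ^ 2 / (κ * σ) := by
  have hκ := κ.coe_ne_zero
  have hσ := σ.coe_ne_zero
  rw [Complex.ofReal_pow, ← Complex.conj_mul', map_sub, κ.conj_coe, σ.conj_coe]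
  field_simp
  ring

end UnitCircle

lemma norm_div_coe_sub_le (σ κ : UnitCircle) {M : ℝ} {z : 𝔻}
    (hz : ‖(σ : ℂ) - (z : ℂ)‖ < M * (1 - ‖(z : ℂ)‖)) :
    ‖(σ : ℂ) - (z : ℂ)‖ / ‖(κ : ℂ) - (z : ℂ)‖ ≤ M := by
  have hκ := κ.one_sub_norm_le_norm_coe_sub z
  have hz1 : 0 < 1 - ‖(z : ℂ)‖ := sub_pos.2 z.norm_lt_one
  have hM : 0 < M := pos_of_mul_pos_left ((norm_nonneg _).trans_lt hz) hz1.le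
  rw [div_le_iff₀ (hz1.trans_le hκ)]
  exact hz.le.trans (by gcongr)

lemma norm_coe_sub_div_le (σ κ : UnitCircle) {M : ℝ} {z : 𝔻}
    (hz : ‖(σ : ℂ) - (z : ℂ)‖ < M * (1 - ‖(z : ℂ)‖)) :
    ‖(κ : ℂ) - σ‖ / ‖(κ : ℂ) - (z : ℂ)‖ ≤ 1 + M := by
  have hκ : 0 < ‖(κ : ℂ) - z‖ := norm_pos_iff.2 (κ.coe_sub_disc_ne_zero z)
  calc ‖(κ : ℂ) - σ‖ / ‖(κ : ℂ) - z‖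
      ≤ (‖(κ : ℂ) - z‖ + ‖(σ : ℂ) - z‖) / ‖(κ : ℂ) - z‖ := by
        gcongr
        simpa using norm_sub_le ((κ : ℂ) - z) ((σ : ℂ) - z)
    _ = 1 + ‖(σ : ℂ) - z‖ / ‖(κ : ℂ) - z‖ := by rw [add_div, div_self hκ.ne']
    _ ≤ 1 + M := by gcongr; exact norm_div_coe_sub_le σ κ hz

lemma exists_tendsto_stolzFilter (σ : UnitCircle) :
    ∃ e : ℝ → 𝔻, (∀ r ∈ Set.Ioo (0 : ℝ) 1, (e r : ℂ) = r * σ) ∧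
      Tendsto e (𝓝[<] 1) (stolzFilter σ 2) := by
  have hev : ∀ᶠ r in 𝓝[<] (1 : ℝ), r ∈ Set.Ioo (0 : ℝ) 1 := Ioo_mem_nhdsLT one_pos
  have hlt : ∀ r ∈ Set.Ioo (0 : ℝ) 1, ‖(r : ℂ) * σ‖ < 1 := fun r hr => by
    rw [σ.norm_real_mul hr.1.le]
    exact hr.2
  choose! e he using fun (r : ℝ) (hr : r ∈ Set.Ioo (0 : ℝ) 1) =>
    (⟨.mk _ (hlt r hr), Complex.UnitDisc.coe_mk _ _⟩ : ∃ z : 𝔻, (z : ℂ) = r * σ)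
  refine ⟨e, he, tendsto_inf.2 ⟨tendsto_comap_iff.2 ?_, tendsto_principal.2 ?_⟩⟩
  · have hlim : Tendsto (fun r : ℝ => (r : ℂ) * σ) (𝓝[<] 1) (𝓝 σ) := by
      have : Continuous fun r : ℝ => (r : ℂ) * σ := by fun_prop
      simpa using (this.tendsto 1).mono_left nhdsWithin_le_nhds
    refine hlim.congr' ?_
    filter_upwards [hev] with r hr using (he r hr).symm
  · filter_upwards [hev] with r hr
    have hsub : (σ : ℂ) - r * σ = ((1 - r : ℝ) : ℂ) * σ := by push_cast; ring
    rw [he r hr, σ.norm_real_mul hr.1.le, hsub, σ.norm_real_mul (sub_nonneg.2 hr.2.le)]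
    linarith [hr.2]

instance (σ : UnitCircle) : (stolzFilter σ 2).NeBot :=
  have ⟨_, _, he⟩ := exists_tendsto_stolzFilter σ
  he.neBot

lemma HasAngularLimit.unique {f : 𝔻 → ℂ} {σ : UnitCircle} {l l' : ℂ} (h : HasAngularLimit f σ l)
    (h' : HasAngularLimit f σ l') : l = l' :=
  tendsto_nhds_unique (f := f) (l := stolzFilter σ 2) (h 2) (h' 2)

lemma HasAngularLimit.mul {f g : 𝔻 → ℂ} {σ l m : ℂ} (hf : HasAngularLimit f σ l)
    (hg : HasAngularLimit g σ m) : HasAngularLimit (fun z => f z * g z) σ (l * m) :=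
  fun M => (hf M).mul (hg M)

lemma HasAngularLimit.congr {f g : 𝔻 → ℂ} {σ l : ℂ} (hf : HasAngularLimit f σ l)
    (h : ∀ z, f z = g z) : HasAngularLimit g σ l :=
  funext h ▸ hf

lemma hasAngularLimit_of_continuousAt {F : ℂ → ℂ} {σ : ℂ} (hF : ContinuousAt F σ) :
    HasAngularLimit (fun z => F z) σ (F σ) :=
  fun M => hF.tendsto.comp (tendsto_coe_stolzFilter σ M)

lemma hasAngularLimit_one_sub_conj_mul (σ : UnitCircle) :
    HasAngularLimit (fun z => 1 - conj (σ : ℂ) * z) σ 0 := by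
  have : Continuous fun z : ℂ => 1 - conj (σ : ℂ) * z := by fun_prop
  simpa [σ.conj_mul_coe] using hasAngularLimit_of_continuousAt (this.continuousAt (x := (σ : ℂ)))

lemma hasAngularLimit_cayley_mul (κ σ : UnitCircle) :
    HasAngularLimit (fun z => cayley κ z * (1 - conj (σ : ℂ) * z)) σ
      (Set.indicator {σ} (fun _ => (2 : ℂ)) κ) := by
  rcases eq_or_ne κ σ with rfl | hκ
  · have hpole (z : 𝔻) : 1 + conj (κ : ℂ) * z = cayley κ z * (1 - conj (κ : ℂ) * z) := by
      rw [κ.one_sub_conj_mul, cayley, mul_left_comm, div_mul_cancel₀ _ (κ.coe_sub_disc_ne_zero z),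
        mul_add, κ.conj_mul_coe]
    have hcont : Continuous fun z : ℂ => 1 + conj (κ : ℂ) * z := by fun_prop
    have hlim := hasAngularLimit_of_continuousAt (hcont.continuousAt (x := (κ : ℂ)))
    rw [κ.conj_mul_coe, one_add_one_eq_two] at hlim
    simpa using hlim.congr hpole
  · have hlim := (hasAngularLimit_of_continuousAt (hasDerivAt_cayley
      (UnitCircle.coe_sub_coe_ne_zero hκ)).continuousAt).mul (hasAngularLimit_one_sub_conj_mul σ)
    rw [Set.indicator_of_notMem (by simpa using hκ)]
    rwa [mul_zero] at hlim

lemma hasAngularLimit_herglotz_mul (β : ℝ) (ν : Measure UnitCircle) [IsFiniteMeasure ν]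
    (σ : UnitCircle) :
    HasAngularLimit (fun z => herglotz β ν z * (1 - conj (σ : ℂ) * z)) σ
      ((2 * ν.real {σ} : ℝ) : ℂ) := by
  intro M
  have hint : Tendsto (fun z : 𝔻 => ∫ κ : UnitCircle, cayley κ z * (1 - conj (σ : ℂ) * z) ∂ν)
      (stolzFilter σ M) (𝓝 (∫ κ : UnitCircle, Set.indicator {σ} (fun _ => (2 : ℂ)) κ ∂ν)) := by
    refine tendsto_integral_filter_of_dominated_convergence (fun _ => 2 * M)
      (Eventually.of_forall fun z =>
        ((continuous_cayley_coe z.norm_lt_one).mul continuous_const).aestronglyMeasurable) ?_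
      (integrable_const _) (Eventually.of_forall fun κ => hasAngularLimit_cayley_mul κ σ M)
    filter_upwards [eventually_stolzFilter σ M] with z hz
    refine Eventually.of_forall fun κ => ?_
    have hnum : ‖(κ : ℂ) + z‖ ≤ 2 :=
      (norm_add_le _ _).trans (by rw [κ.norm_coe]; linarith [z.norm_lt_one])
    rw [cayley, norm_mul, norm_div, σ.norm_one_sub_conj_mul, div_mul_eq_mul_div, mul_div_assoc]
    exact mul_le_mul hnum (norm_div_coe_sub_le σ κ hz) (by positivity) zero_le_two
  have hatom : ∫ κ : UnitCircle, Set.indicator {σ} (fun _ => (2 : ℂ)) κ ∂ν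
      = ((2 * ν.real {σ} : ℝ) : ℂ) := by
    rw [integral_indicator (measurableSet_singleton σ)]
    simp [mul_comm, measureReal_def]
  rw [hatom] at hint
  have hconst := (hasAngularLimit_one_sub_conj_mul σ M).const_mul (Complex.I * β)
  have hlim := hconst.add hint
  rw [mul_zero, zero_add] at hlim
  refine hlim.congr fun z => ?_
  rw [integral_mul_const, herglotz, add_mul]

/-- From `cayley σ w + 1 = 2 σ / (σ - w)`, the boundary difference quotient of `φ` at `σ` is
`2 / ((1 - conj σ * z) (cayley σ (φ z) + 1))`. -/
lemma hasBoundaryFixedPointDeriv_of_hasAngularLimit_cayley_mul {φ : 𝔻 → 𝔻} {σ : UnitCircle} {c : ℂ}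
    (hc : c ≠ 0)
    (h : HasAngularLimit (fun z => cayley σ (φ z) * (1 - conj (σ : ℂ) * z)) σ (2 * c)) :
    HasBoundaryFixedPointDeriv φ σ c⁻¹ := by
  have hquot : HasAngularLimit (fun z => ((φ z : ℂ) - σ) / ((z : ℂ) - σ)) σ c⁻¹ := by
    intro M
    have hlim := (((h M).add (hasAngularLimit_one_sub_conj_mul σ M)).inv₀
      (by simpa using hc)).const_mul 2
    rw [add_zero, mul_inv, mul_inv_cancel_left₀ two_ne_zero] at hlim
    refine hlim.congr fun z => ?_
    have hz := σ.coe_sub_disc_ne_zero z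
    have hφz := σ.coe_sub_disc_ne_zero (φ z)
    have hσ := σ.coe_ne_zero
    have hsum : cayley σ (φ z) * (1 - conj (σ : ℂ) * z) + (1 - conj (σ : ℂ) * z)
        = 2 * ((σ : ℂ) - z) / ((σ : ℂ) - φ z) := by
      rw [cayley, σ.one_sub_conj_mul, σ.conj_coe]
      field_simp
      ring
    rw [hsum, inv_div, mul_div_assoc', mul_div_mul_left _ _ two_ne_zero, ← neg_div_neg_eq, neg_sub,
      neg_sub]
  refine ⟨σ.norm_coe, fun M => ?_, hquot⟩
  have hlim := ((hquot M).mul ((tendsto_coe_stolzFilter σ M).sub_const (σ : ℂ))).add_const (σ : ℂ)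
  rw [sub_self, mul_zero, zero_add] at hlim
  refine hlim.congr fun z => ?_
  rw [div_mul_cancel₀ _ (neg_sub (σ : ℂ) z ▸ neg_ne_zero.2 (σ.coe_sub_disc_ne_zero z)),
    sub_add_cancel]

/-- The Herglotz integral with data `(β, ν)` vanishes at the point `σ` of the circle and has a
finite angular derivative there. -/
structure IsRegularNullPoint (β : ℝ) (ν : Measure UnitCircle) (σ : UnitCircle) : Prop where
  measure_singleton : ν {σ} = 0
  integrable : Integrable (fun κ : UnitCircle => (‖(κ : ℂ) - σ‖ ^ 2)⁻¹) ν
  eq_zero : herglotz β ν σ = 0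

/-- The angular limit of `herglotz β ν z / (1 - conj σ * z)` at a regular null point `σ`. -/
noncomputable def angularSlope (ν : Measure UnitCircle) (σ : UnitCircle) : ℝ :=
  2 * ∫ κ : UnitCircle, (‖(κ : ℂ) - σ‖ ^ 2)⁻¹ ∂ν

/-- The difference quotient `(cayley κ z - cayley κ σ) / (1 - conj σ * z)`, for `κ ≠ σ`. -/
noncomputable def slopeKernel (σ κ : UnitCircle) (z : ℂ) : ℂ :=
  2 * ((1 - conj (κ : ℂ) * σ) / (1 - conj (κ : ℂ) * z)) * ((‖(κ : ℂ) - σ‖ ^ 2)⁻¹ : ℝ)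

lemma ae_ne_of_measure_singleton {ν : Measure UnitCircle} {σ : UnitCircle} (h : ν {σ} = 0) :
    ∀ᵐ κ ∂ν, κ ≠ σ :=
  compl_mem_ae_iff.2 h

lemma norm_cayley_coe_coe_le (κ σ : UnitCircle) : ‖cayley κ σ‖ ≤ 1 + (‖(κ : ℂ) - σ‖ ^ 2)⁻¹ := by
  have hnum : ‖(κ : ℂ) + σ‖ ≤ 2 :=
    (norm_add_le _ _).trans (by rw [κ.norm_coe, σ.norm_coe]; norm_num)
  rw [cayley, norm_div, ← inv_pow, div_eq_mul_inv]
  have hinv : 0 ≤ ‖(κ : ℂ) - σ‖⁻¹ := by positivity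
  nlinarith [sq_nonneg (‖(κ : ℂ) - σ‖⁻¹ - 1)]

lemma cayley_sub_cayley {κ σ : UnitCircle} (h : κ ≠ σ) {z : ℂ} (hz : ‖z‖ < 1) :
    cayley κ z - cayley κ σ = (1 - conj (σ : ℂ) * z) * slopeKernel σ κ z := by
  have hκz := κ.coe_sub_ne_zero hz
  have hκσ := UnitCircle.coe_sub_coe_ne_zero h
  have hσ := σ.coe_ne_zero
  rw [cayley, cayley, slopeKernel, Complex.ofReal_inv, UnitCircle.ofReal_norm_coe_sub_coe_sq,
    κ.one_sub_conj_mul, κ.one_sub_conj_mul, σ.one_sub_conj_mul, κ.conj_coe, σ.conj_coe]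
  field_simp
  ring

section Slope

variable {β : ℝ} {ν : Measure UnitCircle} {σ : UnitCircle}

lemma hasAngularLimit_slopeKernel {κ : UnitCircle} (h : κ ≠ σ) :
    HasAngularLimit (fun z => slopeKernel σ κ z) σ (2 * ((‖(κ : ℂ) - σ‖ ^ 2)⁻¹ : ℝ)) := by
  have hne : 1 - conj (κ : ℂ) * σ ≠ 0 := by
    rw [← norm_ne_zero_iff, κ.norm_one_sub_conj_mul]
    exact norm_ne_zero_iff.2 (UnitCircle.coe_sub_coe_ne_zero h)
  have hcont : ContinuousAt (slopeKernel σ κ) σ := by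
    unfold slopeKernel
    fun_prop (disch := exact hne)
  simpa [slopeKernel, div_self hne] using hasAngularLimit_of_continuousAt hcont

lemma hasAngularLimit_integral_slopeKernel (h0 : ν {σ} = 0)
    (h : Integrable (fun κ : UnitCircle => (‖(κ : ℂ) - σ‖ ^ 2)⁻¹) ν) :
    HasAngularLimit (fun z => ∫ κ : UnitCircle, slopeKernel σ κ z ∂ν) σ (angularSlope ν σ) := by
  intro M
  have hslope : (angularSlope ν σ : ℂ)
      = ∫ κ : UnitCircle, 2 * (((‖(κ : ℂ) - σ‖ ^ 2)⁻¹ : ℝ) : ℂ) ∂ν := by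
    rw [integral_const_mul, integral_complex_ofReal, angularSlope]
    push_cast
    rfl
  rw [hslope]
  refine tendsto_integral_filter_of_dominated_convergence
    (fun κ => 2 * (1 + M) * (‖(κ : ℂ) - σ‖ ^ 2)⁻¹)
    (Eventually.of_forall fun z => Measurable.aestronglyMeasurable
      (by unfold slopeKernel; fun_prop)) ?_ (h.const_mul _) ?_
  · filter_upwards [eventually_stolzFilter σ M] with z hz
    refine Eventually.of_forall fun κ => ?_
    rw [slopeKernel, norm_mul, norm_mul, norm_div, κ.norm_one_sub_conj_mul,
      κ.norm_one_sub_conj_mul, Complex.norm_real, Real.norm_of_nonneg (by positivity),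
      Complex.norm_ofNat]
    gcongr
    exact norm_coe_sub_div_le σ κ hz
  · filter_upwards [ae_ne_of_measure_singleton h0] with κ hκ
    exact hasAngularLimit_slopeKernel hκ M

variable [IsFiniteMeasure ν]

lemma integrable_cayley_coe_coe (h : Integrable (fun κ : UnitCircle => (‖(κ : ℂ) - σ‖ ^ 2)⁻¹) ν) :
    Integrable (fun κ : UnitCircle => cayley κ σ) ν :=
  ((integrable_const (1 : ℝ)).add h).mono'
    (Measurable.aestronglyMeasurable (by unfold cayley; fun_prop))
    (Eventually.of_forall fun κ => norm_cayley_coe_coe_le κ σ)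

lemma herglotz_sub_herglotz (h0 : ν {σ} = 0)
    (h : Integrable (fun κ : UnitCircle => (‖(κ : ℂ) - σ‖ ^ 2)⁻¹) ν) {z : ℂ} (hz : ‖z‖ < 1) :
    herglotz β ν z - herglotz β ν σ
      = (1 - conj (σ : ℂ) * z) * ∫ κ : UnitCircle, slopeKernel σ κ z ∂ν := by
  rw [herglotz, herglotz, add_sub_add_left_eq_sub, ← integral_sub (integrable_cayley ν hz)
    (integrable_cayley_coe_coe h), ← integral_const_mul]
  refine integral_congr_ae ?_
  filter_upwards [ae_ne_of_measure_singleton h0] with κ hκ using cayley_sub_cayley hκ hz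

namespace IsRegularNullPoint

variable (h : IsRegularNullPoint β ν σ)
include h

lemma herglotz_eq {z : ℂ} (hz : ‖z‖ < 1) :
    herglotz β ν z = (1 - conj (σ : ℂ) * z) * ∫ κ : UnitCircle, slopeKernel σ κ z ∂ν := by
  rw [← herglotz_sub_herglotz h.measure_singleton h.integrable hz, h.eq_zero, sub_zero]

lemma hasAngularLimit :
    HasAngularLimit (fun z => herglotz β ν z / (1 - conj (σ : ℂ) * z)) σ (angularSlope ν σ) :=
  (hasAngularLimit_integral_slopeKernel h.measure_singleton h.integrable).congr fun z => by
    rw [h.herglotz_eq z.norm_lt_one,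
      mul_div_cancel_left₀ _ (one_sub_conj_mul_ne_zero σ.norm_coe.le z.norm_lt_one)]

end IsRegularNullPoint

end Slope

lemma integrable_of_tendsto_of_integral_le {α ι : Type*} [MeasurableSpace α] {μ : Measure α}
    {l : Filter ι} [l.NeBot] [l.IsCountablyGenerated] {g : ι → α → ℝ} {f : α → ℝ} {C : ℝ}
    (hg : ∀ i, Integrable (g i) μ) (hg0 : ∀ i x, 0 ≤ g i x)
    (hlim : ∀ᵐ x ∂μ, Tendsto (fun i => g i x) l (𝓝 (f x)))
    (hC : ∀ᶠ i in l, ∫ x, g i x ∂μ ≤ C) : Integrable f μ := by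
  refine ⟨aestronglyMeasurable_of_tendsto_ae l (fun i => (hg i).aestronglyMeasurable) hlim, ?_⟩
  calc ∫⁻ x, ‖f x‖ₑ ∂μ
      = ∫⁻ x, liminf (fun i => ‖g i x‖ₑ) l ∂μ := lintegral_congr_ae <| by
        filter_upwards [hlim] with x hx using hx.enorm.liminf_eq.symm
    _ ≤ liminf (fun i => ∫⁻ x, ‖g i x‖ₑ ∂μ) l :=
        lintegral_liminf_le' fun i => (hg i).aestronglyMeasurable.enorm
    _ ≤ liminf (fun _ => ENNReal.ofReal C) l := liminf_le_liminf <| by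
        filter_upwards [hC] with i hi
        rw [← ofReal_integral_norm_eq_lintegral_enorm (hg i)]
        simpa only [Real.norm_of_nonneg (hg0 i _)] using ENNReal.ofReal_le_ofReal hi
    _ < ⊤ := by simp

section NullPoint

variable {β : ℝ} {ν : Measure UnitCircle} {σ : UnitCircle} {c : ℂ}
  (h : HasAngularLimit (fun z => herglotz β ν z / (1 - conj (σ : ℂ) * z)) σ c)
include h

lemma hasAngularLimit_herglotz_zero : HasAngularLimit (fun z => herglotz β ν z) σ 0 := by
  have hlim := h.mul (hasAngularLimit_one_sub_conj_mul σ)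
  rw [mul_zero] at hlim
  exact hlim.congr fun z => div_mul_cancel₀ _ (one_sub_conj_mul_ne_zero σ.norm_coe.le z.norm_lt_one)

variable [IsFiniteMeasure ν]

lemma measure_singleton_eq_zero_of_hasAngularLimit : ν {σ} = 0 := by
  have hzero := (hasAngularLimit_herglotz_zero h).mul (hasAngularLimit_one_sub_conj_mul σ)
  have := (hasAngularLimit_herglotz_mul β ν σ).unique hzero
  rw [mul_zero, Complex.ofReal_eq_zero] at this
  exact (measureReal_eq_zero_iff).1 (by linarith)

/-- In a Stolz region `‖κ - z‖⁻²` has `ν`-integral `Re (herglotz β ν z) / (1 - ‖z‖²)`, at most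
`M ‖herglotz β ν z / (1 - conj σ * z)‖`, so Fatou's lemma applies as `z → σ`. -/
lemma integrable_inv_norm_sq_of_hasAngularLimit :
    Integrable (fun κ : UnitCircle => (‖(κ : ℂ) - σ‖ ^ 2)⁻¹) ν := by
  have hint (z : 𝔻) : ∀ κ : UnitCircle,
      (‖(κ : ℂ) - z‖ ^ 2)⁻¹ = (1 - ‖(z : ℂ)‖ ^ 2)⁻¹ * (cayley κ z).re := fun κ => by
    rw [re_cayley_coe, div_eq_mul_inv,
      inv_mul_cancel_left₀ (one_sub_norm_sq_pos z.norm_lt_one).ne']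
  refine integrable_of_tendsto_of_integral_le (l := stolzFilter σ 2)
    (g := fun z (κ : UnitCircle) => (‖(κ : ℂ) - z‖ ^ 2)⁻¹) (C := 2 * (‖c‖ + 1)) (fun z => ?_)
    (fun z κ => by positivity) ?_ ?_
  · simp only [hint z]
    exact (integrable_cayley ν z.norm_lt_one).re.const_mul _
  · filter_upwards [ae_ne_of_measure_singleton (measure_singleton_eq_zero_of_hasAngularLimit h)]
      with κ hκ
    exact (((tendsto_coe_stolzFilter σ 2).const_sub (κ : ℂ)).norm.pow 2).inv₀
      (pow_ne_zero 2 (norm_ne_zero_iff.2 (UnitCircle.coe_sub_coe_ne_zero hκ)))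
  · have hbdd : ∀ᶠ z : 𝔻 in stolzFilter σ 2,
        ‖herglotz β ν z / (1 - conj (σ : ℂ) * z)‖ < ‖c‖ + 1 :=
      (h 2).norm.eventually_lt_const (lt_add_one _)
    filter_upwards [hbdd, eventually_stolzFilter σ 2] with z hz hstolz
    have hz1 : 0 < 1 - ‖(z : ℂ)‖ := sub_pos.2 z.norm_lt_one
    have hσz : 0 < ‖(σ : ℂ) - z‖ := norm_pos_iff.2 (σ.coe_sub_disc_ne_zero z)
    rw [norm_div, σ.norm_one_sub_conj_mul, div_lt_iff₀ hσz] at hz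
    simp only [hint z]
    rw [integral_const_mul, ← re_herglotz β ν z.norm_lt_one, inv_mul_le_iff₀
      (one_sub_norm_sq_pos z.norm_lt_one)]
    calc (herglotz β ν z).re ≤ (‖c‖ + 1) * ‖(σ : ℂ) - z‖ := (Complex.re_le_norm _).trans hz.le
      _ ≤ (‖c‖ + 1) * (2 * (1 - ‖(z : ℂ)‖)) := by gcongr
      _ ≤ (1 - ‖(z : ℂ)‖ ^ 2) * (2 * (‖c‖ + 1)) := by
        nlinarith [mul_nonneg (by positivity : 0 ≤ ‖c‖ + 1)
          (mul_nonneg (norm_nonneg (z : ℂ)) hz1.le)]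

lemma isRegularNullPoint_of_hasAngularLimit : IsRegularNullPoint β ν σ := by
  have h0 := measure_singleton_eq_zero_of_hasAngularLimit h
  have hi := integrable_inv_norm_sq_of_hasAngularLimit h
  have hdiff : HasAngularLimit (fun z => herglotz β ν z - herglotz β ν σ) σ 0 := by
    have hlim := (hasAngularLimit_one_sub_conj_mul σ).mul
      (hasAngularLimit_integral_slopeKernel h0 hi)
    rw [zero_mul] at hlim
    exact hlim.congr fun z => (herglotz_sub_herglotz h0 hi z.norm_lt_one).symm
  have hsub : HasAngularLimit (fun z => herglotz β ν z - herglotz β ν σ) σ (0 - herglotz β ν σ) :=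
    fun M => (hasAngularLimit_herglotz_zero h M).sub_const _
  exact ⟨h0, hi, by simpa using hsub.unique hdiff⟩

end NullPoint

/-! ### Schwarz–Pick, Julia's lemma and the Berkson–Porta formula -/

lemma norm_one_sub_conj_mul_sq_sub (a z : ℂ) :
    ‖1 - conj a * z‖ ^ 2 - ‖z - a‖ ^ 2 = (1 - ‖a‖ ^ 2) * (1 - ‖z‖ ^ 2) := by
  simp only [← Complex.normSq_eq_norm_sq, Complex.normSq_apply, Complex.sub_re, Complex.sub_im,
    Complex.mul_re, Complex.mul_im, Complex.conj_re, Complex.conj_im, Complex.one_re,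
    Complex.one_im]
  ring

/-- The automorphism of the unit disc that maps `a` to `0`, for `‖a‖ < 1`. -/
noncomputable def mobius (a z : ℂ) : ℂ := (z - a) / (1 - conj a * z)

lemma norm_mobius_lt_one {a z : ℂ} (ha : ‖a‖ < 1) (hz : ‖z‖ < 1) : ‖mobius a z‖ < 1 := by
  have hpos : 0 < ‖1 - conj a * z‖ := norm_pos_iff.2 (one_sub_conj_mul_ne_zero ha.le hz)
  rw [mobius, norm_div, div_lt_one hpos]
  refine lt_of_pow_lt_pow_left₀ 2 hpos.le ?_
  linarith [norm_one_sub_conj_mul_sq_sub a z,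
    mul_pos (one_sub_norm_sq_pos ha) (one_sub_norm_sq_pos hz)]

lemma mapsTo_mobius {a : ℂ} (ha : ‖a‖ < 1) :
    Set.MapsTo (mobius a) (Metric.ball 0 1) (Metric.ball 0 1) := fun z hz => by
  simpa using norm_mobius_lt_one ha (by simpa using hz)

lemma differentiableOn_mobius {a : ℂ} (ha : ‖a‖ < 1) :
    DifferentiableOn ℂ (mobius a) (Metric.ball 0 1) := fun _ hz =>
  DifferentiableWithinAt.div (by fun_prop) (by fun_prop)
    (one_sub_conj_mul_ne_zero ha.le (by simpa using hz))

lemma mobius_neg_mobius {a z : ℂ} (ha : ‖a‖ < 1) (hz : ‖z‖ < 1) :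
    mobius (-a) (mobius a z) = z := by
  have hz0 : 1 - conj a * z ≠ 0 := one_sub_conj_mul_ne_zero ha.le hz
  have ha0 : 1 - conj a * a ≠ 0 := one_sub_conj_mul_ne_zero ha.le ha
  have hnum : mobius a z - -a = z * (1 - conj a * a) / (1 - conj a * z) := by
    rw [mobius, eq_div_iff hz0, sub_neg_eq_add, add_mul, div_mul_cancel₀ _ hz0]
    ring
  have hden : 1 - conj (-a) * mobius a z = (1 - conj a * a) / (1 - conj a * z) := by
    rw [mobius, eq_div_iff hz0, map_neg, neg_mul, sub_neg_eq_add, add_mul, mul_assoc,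
      div_mul_cancel₀ _ hz0]
    ring
  rw [mobius, hnum, hden, div_div_div_cancel_right₀ hz0, mul_div_cancel_right₀ _ ha0]

lemma norm_mobius_map_le {g : ℂ → ℂ} (hg : DifferentiableOn ℂ g (Metric.ball 0 1))
    (hmaps : Set.MapsTo g (Metric.ball 0 1) (Metric.ball 0 1)) {a z : ℂ} (ha : ‖a‖ < 1)
    (hz : ‖z‖ < 1) : ‖mobius (g a) (g z)‖ ≤ ‖mobius a z‖ := by
  have ha' : ‖-a‖ < 1 := by rwa [norm_neg]
  have hga : ‖g a‖ < 1 := by simpa using hmaps (mem_ball_zero_iff.2 ha)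
  have hbound := Complex.norm_le_norm_of_mapsTo_ball
    (f := fun w => mobius (g a) (g (mobius (-a) w)))
    ((differentiableOn_mobius hga).comp (hg.comp (differentiableOn_mobius ha') (mapsTo_mobius ha'))
      (hmaps.comp (mapsTo_mobius ha')))
    ((((mapsTo_mobius hga).comp hmaps).comp (mapsTo_mobius ha')).mono_right
      Metric.ball_subset_closedBall)
    (by simp [mobius]) (norm_mobius_lt_one ha hz)
  simpa only [mobius_neg_mobius ha hz] using hbound

theorem schwarz_pick {φ : 𝔻 → 𝔻} (hφ : IsHolomorphicOnDisc fun z => (φ z : ℂ)) (a z : 𝔻) :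
    ‖1 - conj (φ a : ℂ) * φ z‖ ^ 2 * ((1 - ‖(a : ℂ)‖ ^ 2) * (1 - ‖(z : ℂ)‖ ^ 2))
      ≤ ‖1 - conj (a : ℂ) * z‖ ^ 2 * ((1 - ‖(φ a : ℂ)‖ ^ 2) * (1 - ‖(φ z : ℂ)‖ ^ 2)) := by
  obtain ⟨g, hg, hgφ⟩ := hφ
  have hmaps : Set.MapsTo g (Metric.ball 0 1) (Metric.ball 0 1) := fun w hw => by
    have hgw := hgφ (.mk w (by simpa using hw))
    rw [Complex.UnitDisc.coe_mk] at hgw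
    simpa [← hgw] using (φ _).norm_lt_one
  have hmob := norm_mobius_map_le hg hmaps a.norm_lt_one z.norm_lt_one
  rw [← hgφ, ← hgφ, mobius, mobius, norm_div, norm_div,
    div_le_div_iff₀
      (norm_pos_iff.2 (one_sub_conj_mul_ne_zero (φ a).norm_lt_one.le (φ z).norm_lt_one))
      (norm_pos_iff.2 (one_sub_conj_mul_ne_zero a.norm_lt_one.le z.norm_lt_one))] at hmob
  have hsq := pow_le_pow_left₀ (by positivity) hmob 2
  rw [mul_pow, mul_pow] at hsq
  rw [← norm_one_sub_conj_mul_sq_sub, ← norm_one_sub_conj_mul_sq_sub]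
  linarith

section Julia

variable {φ : 𝔻 → 𝔻}

lemma nonneg_of_hasBoundaryFixedPointDeriv {τ : UnitCircle} {d : ℝ}
    (h : HasBoundaryFixedPointDeriv φ τ d) : 0 ≤ d := by
  obtain ⟨e, he, hlim⟩ := exists_tendsto_stolzFilter τ
  have hquot := (Complex.continuous_re.tendsto _).comp ((h.2.2 2).comp hlim)
  rw [Complex.ofReal_re] at hquot
  refine ge_of_tendsto hquot ?_
  filter_upwards [Ioo_mem_nhdsLT one_pos] with r hr
  have hr1 : 0 < 1 - r := sub_pos.2 hr.2
  have hradial : ((φ (e r) : ℂ) - τ) / ((e r : ℂ) - τ)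
      = (1 - conj (τ : ℂ) * φ (e r)) / ((1 - r : ℝ) : ℂ) := by
    have hr0 : ((1 - r : ℝ) : ℂ) ≠ 0 := Complex.ofReal_ne_zero.2 hr1.ne'
    have hτ := τ.coe_ne_zero
    have hsub : (e r : ℂ) - τ = -((1 - r : ℝ) : ℂ) * τ := by rw [he r hr]; push_cast; ring
    rw [hsub, τ.conj_coe]
    field_simp
    ring
  have hre : (conj (τ : ℂ) * φ (e r)).re ≤ 1 := by
    refine (Complex.re_le_norm _).trans ?_
    rw [norm_mul, RCLike.norm_conj, τ.norm_coe, one_mul]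
    exact (φ (e r)).norm_lt_one.le
  simp only [Function.comp_apply]
  rw [hradial, Complex.div_ofReal_re, Complex.sub_re, Complex.one_re]
  exact div_nonneg (sub_nonneg.2 hre) hr1.le

variable (hφ : IsHolomorphicOnDisc fun z => (φ z : ℂ))
include hφ

lemma schwarz_pick_le_norm_coe_sub_div (τ : UnitCircle) (a z : 𝔻) :
    ‖1 - conj (φ a : ℂ) * φ z‖ ^ 2 * ((1 + ‖(a : ℂ)‖) * (1 - ‖(z : ℂ)‖ ^ 2))
      ≤ ‖1 - conj (a : ℂ) * z‖ ^ 2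
        * (2 * (‖(τ : ℂ) - φ a‖ / (1 - ‖(a : ℂ)‖)) * (1 - ‖(φ z : ℂ)‖ ^ 2)) := by
  have ha : 0 < 1 - ‖(a : ℂ)‖ := sub_pos.2 a.norm_lt_one
  have hφz := one_sub_norm_sq_pos (φ z).norm_lt_one
  have hdist : 1 - ‖(φ a : ℂ)‖ ^ 2 ≤ 2 * ‖(τ : ℂ) - φ a‖ := by
    nlinarith [τ.one_sub_norm_le_norm_coe_sub (φ a : ℂ), (φ a).norm_lt_one,
      norm_nonneg (φ a : ℂ)]
  rw [← mul_le_mul_iff_of_pos_right ha]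
  calc _ = ‖1 - conj (φ a : ℂ) * φ z‖ ^ 2 * ((1 - ‖(a : ℂ)‖ ^ 2) * (1 - ‖(z : ℂ)‖ ^ 2)) := by ring
    _ ≤ ‖1 - conj (a : ℂ) * z‖ ^ 2 * ((1 - ‖(φ a : ℂ)‖ ^ 2) * (1 - ‖(φ z : ℂ)‖ ^ 2)) :=
      schwarz_pick hφ a z
    _ ≤ ‖1 - conj (a : ℂ) * z‖ ^ 2 * (2 * ‖(τ : ℂ) - φ a‖ * (1 - ‖(φ z : ℂ)‖ ^ 2)) := by gcongr
    _ = _ := by field_simp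

theorem julia_of_hasBoundaryFixedPointDeriv {τ : UnitCircle} {d : ℂ}
    (h : HasBoundaryFixedPointDeriv φ τ d) (z : 𝔻) :
    ‖1 - conj (τ : ℂ) * φ z‖ ^ 2 * (1 - ‖(z : ℂ)‖ ^ 2)
      ≤ ‖d‖ * (‖1 - conj (τ : ℂ) * z‖ ^ 2 * (1 - ‖(φ z : ℂ)‖ ^ 2)) := by
  obtain ⟨e, he, hlim⟩ := exists_tendsto_stolzFilter τ
  have htendsto : Tendsto (fun r => (e r : ℂ)) (𝓝[<] 1) (𝓝 τ) :=
    (tendsto_coe_stolzFilter τ 2).comp hlim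
  have hconj {u : ℝ → ℂ} (v : ℂ) (hu : Tendsto u (𝓝[<] 1) (𝓝 (τ : ℂ))) :
      Tendsto (fun r => ‖1 - conj (u r) * v‖ ^ 2) (𝓝[<] 1) (𝓝 (‖1 - conj (τ : ℂ) * v‖ ^ 2)) :=
    ((((Complex.continuous_conj.tendsto _).comp hu).mul_const v).const_sub 1).norm.pow 2
  have hquot : Tendsto (fun r => ‖(τ : ℂ) - φ (e r)‖ / (1 - ‖(e r : ℂ)‖)) (𝓝[<] 1) (𝓝 ‖d‖) := by
    refine ((h.2.2 2).comp hlim).norm.congr' ?_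
    filter_upwards [Ioo_mem_nhdsLT one_pos] with r hr
    have hdist : ‖(τ : ℂ) - e r‖ = 1 - r := by
      rw [he r hr, show (τ : ℂ) - r * τ = ((1 - r : ℝ) : ℂ) * τ by push_cast; ring,
        τ.norm_real_mul (sub_nonneg.2 hr.2.le)]
    rw [Function.comp_apply, norm_div, norm_sub_rev, norm_sub_rev (e r : ℂ), hdist, he r hr,
      τ.norm_real_mul hr.1.le]
  have hleft := (hconj (φ z : ℂ) ((h.2.1 2).comp hlim)).mul
    ((htendsto.norm.const_add 1).mul_const (1 - ‖(z : ℂ)‖ ^ 2))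
  have hright := (hconj (z : ℂ) htendsto).mul
    ((hquot.const_mul 2).mul_const (1 - ‖(φ z : ℂ)‖ ^ 2))
  have hle := le_of_tendsto_of_tendsto' hleft hright fun r =>
    schwarz_pick_le_norm_coe_sub_div hφ τ (e r) z
  rw [τ.norm_coe] at hle
  linarith

theorem julia_of_isDWPoint {τ : ℂ} (h : IsDWPoint φ τ) (z : 𝔻) :
    ‖1 - conj τ * φ z‖ ^ 2 * (1 - ‖(z : ℂ)‖ ^ 2)
      ≤ ‖1 - conj τ * z‖ ^ 2 * (1 - ‖(φ z : ℂ)‖ ^ 2) := by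
  rcases h with ⟨a, rfl, ha⟩ | ⟨-, d, hd, h⟩
  · have hpick := schwarz_pick hφ a z
    rw [ha] at hpick
    rw [← mul_le_mul_iff_of_pos_right (one_sub_norm_sq_pos a.norm_lt_one)]
    linarith
  · lift τ to UnitCircle using by simpa using h.1
    refine (julia_of_hasBoundaryFixedPointDeriv hφ h z).trans (mul_le_of_le_one_left ?_ ?_)
    · exact mul_nonneg (sq_nonneg _) (one_sub_norm_sq_pos (φ z).norm_lt_one).le
    · rwa [Complex.norm_real, Real.norm_of_nonneg (nonneg_of_hasBoundaryFixedPointDeriv h)]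

end Julia

/-- The factor of the Berkson–Porta formula determined by the Denjoy–Wolff point `τ`. -/
noncomputable def dwFactor (τ z : ℂ) : ℂ := (τ - z) * (1 - conj τ * z)

lemma differentiable_dwFactor (τ : ℂ) : Differentiable ℂ (dwFactor τ) := by
  unfold dwFactor
  fun_prop

lemma dwFactor_ne_zero {τ z : ℂ} (hτ : ‖τ‖ ≤ 1) (hz : ‖z‖ < 1) (h : z ≠ τ) : dwFactor τ z ≠ 0 :=
  mul_ne_zero (sub_ne_zero.2 h.symm) (one_sub_conj_mul_ne_zero hτ hz)

lemma conj_mul_dwFactor_coe (τ : ℂ) (σ : UnitCircle) :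
    conj (σ : ℂ) * dwFactor τ σ = ((-‖τ - σ‖ ^ 2 : ℝ) : ℂ) := by
  push_cast
  rw [← Complex.conj_mul', map_sub, σ.conj_coe, dwFactor]
  have := σ.coe_ne_zero
  field_simp
  ring

/-- The right-hand side of the Berkson–Porta formula, with its factor of nonnegative real part
given by a Herglotz integral. -/
noncomputable def berksonPorta (τ : ℂ) (β : ℝ) (ν : Measure UnitCircle) (z : 𝔻) : ℂ :=
  dwFactor τ z * herglotz β ν z

lemma hasDerivWithinAt_Ici_nonneg {u : ℝ → ℝ} {u' t : ℝ}
    (h : HasDerivWithinAt u u' (Set.Ici t) t) (hu : ∀ s, t ≤ s → u t ≤ u s) : 0 ≤ u' := by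
  have hslope := (hasDerivWithinAt_iff_tendsto_slope' Set.self_notMem_Ioi).1
    (hasDerivWithinAt_Ioi_iff_Ici.2 h)
  refine ge_of_tendsto hslope ?_
  filter_upwards [self_mem_nhdsWithin] with s (hs : t < s)
  rw [slope_def_field]
  exact div_nonneg (sub_nonneg.2 (hu s hs.le)) (sub_pos.2 hs).le

lemma re_div_nonneg_of_re_mul_conj {a b : ℂ} (h : 0 ≤ (a * conj b).re) : 0 ≤ (a / b).re := by
  rw [div_eq_mul_inv, Complex.inv_def, ← mul_assoc, Complex.re_mul_ofReal]
  exact mul_nonneg h (inv_nonneg.2 (Complex.normSq_nonneg _))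

section BerksonPorta

variable {φ : ℝ → 𝔻 → 𝔻} {G : 𝔻 → ℂ} (hφ : IsOneParameterSemigroup φ)
  (hG : IsInfinitesimalGenerator φ G)
include hφ hG

/-- Julia's inequality is an equality at `t = 0`, so its one-sided derivative at `0` has a sign. -/
lemma re_generator_div_dwFactor_nonneg {τ : ℂ} (hτ : IsSemigroupDWPoint φ τ) (z : 𝔻) :
    0 ≤ (G z / dwFactor τ z).re := by
  have hjulia : ∀ t, 0 ≤ t → ‖1 - conj τ * φ t z‖ ^ 2 * (1 - ‖(z : ℂ)‖ ^ 2)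
      ≤ ‖1 - conj τ * z‖ ^ 2 * (1 - ‖(φ t z : ℂ)‖ ^ 2) := by
    intro t ht
    by_cases hid : φ t = id
    · rw [hid, id]
    · exact julia_of_isDWPoint (hφ.holomorphic t ht) (hτ t ht hid) z
  have hderiv := hG.2 z 0 le_rfl
  have hgap := ((hderiv.norm_sq.const_sub 1).const_mul (‖1 - conj τ * z‖ ^ 2)).sub
    (((hderiv.const_mul (conj τ)).const_sub 1).norm_sq.mul_const (1 - ‖(z : ℂ)‖ ^ 2))
  have hnonneg := hasDerivWithinAt_Ici_nonneg hgap fun s hs => by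
    simp only [Pi.sub_apply, hφ.map_zero]
    linarith [hjulia s hs]
  rw [hφ.map_zero, Complex.inner, Complex.inner] at hnonneg
  refine re_div_nonneg_of_re_mul_conj (le_of_mul_le_mul_left ?_ (two_pos : (0 : ℝ) < 2))
  rw [mul_zero]
  refine hnonneg.trans (le_of_eq ?_)
  simp only [dwFactor, ← Complex.normSq_eq_norm_sq, Complex.normSq_apply, Complex.sub_re,
    Complex.sub_im, Complex.mul_re, Complex.mul_im, Complex.conj_re, Complex.conj_im,
    Complex.one_re, Complex.one_im, Complex.neg_re, Complex.neg_im, map_sub, map_mul, map_one,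
    Complex.conj_conj]
  ring

lemma generator_apply_eq_zero {a : 𝔻} (ha : IsSemigroupDWPoint φ a) : G a = 0 := by
  have hfix : ∀ t ∈ Set.Ici (0 : ℝ), (φ t a : ℂ) = a := by
    intro t ht
    by_cases hid : φ t = id
    · rw [hid, id]
    · rcases ha t ht hid with ⟨b, hba, hb⟩ | ⟨-, _, -, hfixed⟩
      · obtain rfl : b = a := Complex.UnitDisc.coe_injective hba
        rw [hb]
      · exact absurd hfixed.1 a.norm_lt_one.ne
  have hderiv := hG.2 a 0 le_rfl
  rw [hφ.map_zero] at hderiv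
  exact (uniqueDiffWithinAt_Ici 0).eq_deriv _ hderiv
    ((hasDerivWithinAt_const 0 (Set.Ici 0) (a : ℂ)).congr hfix (hfix 0 Set.self_mem_Ici))

end BerksonPorta

lemma exists_eq_dwFactor_mul_of_norm_lt_one {g : ℂ → ℂ} {τ : ℂ} (hτ : ‖τ‖ < 1)
    (hg : DifferentiableOn ℂ g (Metric.ball 0 1)) (hgτ : g τ = 0) :
    ∃ p : ℂ → ℂ, DifferentiableOn ℂ p (Metric.ball 0 1) ∧
      ∀ z : ℂ, ‖z‖ < 1 → g z = dwFactor τ z * p z := by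
  have hne : ∀ z ∈ Metric.ball (0 : ℂ) 1, 1 - conj τ * z ≠ 0 := fun z hz =>
    one_sub_conj_mul_ne_zero hτ.le (mem_ball_zero_iff.1 hz)
  have hnhds : Metric.ball (0 : ℂ) 1 ∈ 𝓝 τ :=
    Metric.isOpen_ball.mem_nhds (mem_ball_zero_iff.2 hτ)
  refine ⟨fun z => -dslope g τ z / (1 - conj τ * z),
    ((Complex.differentiableOn_dslope hnhds).2 hg).neg.div (by fun_prop) hne, fun z hz => ?_⟩
  have hslope : (z - τ) * dslope g τ z = g z := by
    simpa [hgτ] using sub_smul_dslope g τ z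
  rw [← hslope, dwFactor, mul_assoc, mul_div_cancel₀ _ (hne z (mem_ball_zero_iff.2 hz))]
  ring

lemma re_nonneg_of_forall_ne {p : ℂ → ℂ} {τ : ℂ} (hp : DifferentiableOn ℂ p (Metric.ball 0 1))
    (h : ∀ z, ‖z‖ < 1 → z ≠ τ → 0 ≤ (p z).re) {z : ℂ} (hz : ‖z‖ < 1) : 0 ≤ (p z).re := by
  have hnhds : Metric.ball (0 : ℂ) 1 ∈ 𝓝 z :=
    Metric.isOpen_ball.mem_nhds (mem_ball_zero_iff.2 hz)
  rcases eq_or_ne z τ with rfl | hne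
  · have hcont : ContinuousAt (fun w => (p w).re) z :=
      Complex.continuous_re.continuousAt.comp (hp.differentiableAt hnhds).continuousAt
    refine ge_of_tendsto (hcont.tendsto.mono_left (nhdsWithin_le_nhds (s := {z}ᶜ))) ?_
    filter_upwards [self_mem_nhdsWithin, nhdsWithin_le_nhds hnhds] with w hw hwb
    exact h w (mem_ball_zero_iff.1 hwb) hw
  · exact h z hz hne

theorem exists_eq_berksonPorta {φ : ℝ → 𝔻 → 𝔻} {G : 𝔻 → ℂ} {τ : ℂ} (hτ : ‖τ‖ ≤ 1)
    (hφ : IsOneParameterSemigroup φ) (hG : IsInfinitesimalGenerator φ G)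
    (hDW : IsSemigroupDWPoint φ τ) :
    ∃ (β : ℝ) (ν : Measure UnitCircle), IsFiniteMeasure ν ∧ G = berksonPorta τ β ν := by
  obtain ⟨g, hg, hgG⟩ := hG.1
  obtain ⟨p, hp, hgp⟩ : ∃ p : ℂ → ℂ, DifferentiableOn ℂ p (Metric.ball 0 1) ∧
      ∀ z : ℂ, ‖z‖ < 1 → g z = dwFactor τ z * p z := by
    rcases hτ.lt_or_eq with hlt | heq
    · refine exists_eq_dwFactor_mul_of_norm_lt_one hlt hg ?_
      rw [← Complex.UnitDisc.coe_mk τ hlt, ← hgG]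
      exact generator_apply_eq_zero hφ hG hDW
    · have hne : ∀ z : ℂ, ‖z‖ < 1 → dwFactor τ z ≠ 0 := fun z hz =>
        dwFactor_ne_zero hτ hz (by rintro rfl; exact hz.ne heq)
      exact ⟨fun z => g z / dwFactor τ z,
        hg.div (differentiable_dwFactor τ).differentiableOn fun z hz =>
          hne z (mem_ball_zero_iff.1 hz),
        fun z hz => (mul_div_cancel₀ _ (hne z hz)).symm⟩
  have hre : ∀ z, ‖z‖ < 1 → z ≠ τ → 0 ≤ (p z).re := fun z hz hzτ => by
    have hnonneg := re_generator_div_dwFactor_nonneg hφ hG hDW (.mk z hz)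
    rwa [hgG, Complex.UnitDisc.coe_mk, hgp z hz,
      mul_div_cancel_left₀ _ (dwFactor_ne_zero hτ hz hzτ)] at hnonneg
  obtain ⟨β, ν, hν, hpν⟩ := exists_herglotz hp fun z hz => re_nonneg_of_forall_ne hp hre hz
  exact ⟨β, ν, hν, funext fun z => by rw [hgG, hgp z z.norm_lt_one, hpν z z.norm_lt_one]; rfl⟩

section SpectralValue

variable {τ : ℂ} {σ : UnitCircle} {β : ℝ} {ν : Measure UnitCircle}

lemma hasAngularLimit_conj_mul_dwFactor :
    HasAngularLimit (fun z => conj (σ : ℂ) * dwFactor τ z) σ ((-‖τ - σ‖ ^ 2 : ℝ) : ℂ) := by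
  have hcont : Continuous fun z => conj (σ : ℂ) * dwFactor τ z :=
    continuous_const.mul (differentiable_dwFactor τ).continuous
  rw [← conj_mul_dwFactor_coe]
  exact hasAngularLimit_of_continuousAt hcont.continuousAt

lemma berksonPorta_div (z : 𝔻) :
    berksonPorta τ β ν z / ((σ : ℂ) - z)
      = conj (σ : ℂ) * dwFactor τ z * (herglotz β ν z / (1 - conj (σ : ℂ) * z)) := by
  have hz := σ.coe_sub_disc_ne_zero z
  have hσ := σ.coe_ne_zero
  rw [berksonPorta, σ.one_sub_conj_mul, σ.conj_coe]
  field_simp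

lemma hasAngularLimit_herglotz_div (hτ : τ ≠ σ) {l : ℝ}
    (h : HasAngularLimit (fun z => berksonPorta τ β ν z / ((σ : ℂ) - z)) σ l) :
    HasAngularLimit (fun z => herglotz β ν z / (1 - conj (σ : ℂ) * z)) σ
      ((-l / ‖τ - σ‖ ^ 2 : ℝ) : ℂ) := by
  intro M
  have hne : ((-‖τ - σ‖ ^ 2 : ℝ) : ℂ) ≠ 0 := by simpa [sub_eq_zero] using hτ
  have hfactor := hasAngularLimit_conj_mul_dwFactor (τ := τ) (σ := σ) M
  have hlim := ((hfactor.inv₀ hne).mul (h M))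
  rw [← Complex.ofReal_inv, ← Complex.ofReal_mul, inv_neg, neg_mul, ← mul_neg,
    inv_mul_eq_div] at hlim
  refine hlim.congr' ?_
  filter_upwards [hfactor.eventually_ne hne] with z hz
  rw [berksonPorta_div, inv_mul_cancel_left₀ hz]

end SpectralValue

/-- The bound on the slope is the bound `Λ k ≤ l k` on the spectral values: at `σ k` the spectral
value of the semigroup generated by `berksonPorta τ β ν` is `-‖τ - σ k‖ ^ 2` times the slope. -/
theorem exists_isRegularNullPoint_of_mem_genClass {τ : ℂ} (hτ : ‖τ‖ ≤ 1) {n : ℕ}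
    {σ : Fin n → UnitCircle} (hσ : ∀ k, τ ≠ (σ k : ℂ)) {Λ : Fin n → ℝ} {G : 𝔻 → ℂ}
    (hG : G ∈ GenClass τ σ Λ) :
    ∃ (β : ℝ) (ν : Measure UnitCircle), IsFiniteMeasure ν ∧ G = berksonPorta τ β ν ∧
      ∀ k, IsRegularNullPoint β ν (σ k) ∧ angularSlope ν (σ k) ≤ -Λ k / ‖τ - σ k‖ ^ 2 := by
  obtain ⟨φ, hφ, hgen, hDW, hbrfp⟩ := hG
  obtain ⟨β, ν, hν, rfl⟩ := exists_eq_berksonPorta hτ hφ hgen hDW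
  refine ⟨β, ν, hν, rfl, fun k => ?_⟩
  obtain ⟨l, hl, -, -, hlim⟩ := hbrfp k
  have hslope := hasAngularLimit_herglotz_div (hσ k) hlim
  have hnull := isRegularNullPoint_of_hasAngularLimit hslope
  refine ⟨hnull, ?_⟩
  rw [Complex.ofReal_injective (hnull.hasAngularLimit.unique hslope)]
  gcongr

/-! ### The flow of a dissipative holomorphic vector field in the disc -/

/-- `α` is a trajectory in the unit disc of the vector field `G` on the time interval `[0, b]`. -/
def IsTrajectory (G : ℂ → ℂ) (b : ℝ) (α : ℝ → ℂ) : Prop :=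
  ∀ t ∈ Set.Icc 0 b, ‖α t‖ < 1 ∧ HasDerivWithinAt α (G (α t)) (Set.Icc 0 b) t

/-- The infinitesimal form of the non-expansion of the hyperbolic metric by the flow of `G`. -/
def IsDissipative (G : ℂ → ℂ) : Prop :=
  ∀ z : ℂ, ‖z‖ < 1 → (deriv G z).re * (1 - ‖z‖ ^ 2) + 2 * (conj z * G z).re ≤ 0

/-- The length of `G z` in the hyperbolic metric of the unit disc, normalised to have density
`1 / (1 - ‖z‖ ^ 2)`. -/
noncomputable def hyperbolicSpeed (G : ℂ → ℂ) (z : ℂ) : ℝ := ‖G z‖ / (1 - ‖z‖ ^ 2)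

lemma hyperbolicSpeed_nonneg (G : ℂ → ℂ) {z : ℂ} (hz : ‖z‖ < 1) : 0 ≤ hyperbolicSpeed G z :=
  div_nonneg (norm_nonneg _) (one_sub_norm_sq_pos hz).le

lemma hasDerivAt_one_sub_norm_sq {α : ℝ → ℂ} {v : ℂ} {t : ℝ} (h : HasDerivAt α v t) :
    HasDerivAt (fun s => 1 - ‖α s‖ ^ 2) (-(2 * (conj (α t) * v).re)) t := by
  simpa only [Complex.inner, mul_comm v] using h.norm_sq.const_sub 1

lemma hasDerivAt_of_norm_lt_one {G : ℂ → ℂ} (hG : DifferentiableOn ℂ G (Metric.ball 0 1)) {z : ℂ}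
    (hz : ‖z‖ < 1) : HasDerivAt G (deriv G z) z :=
  (hG.differentiableAt (Metric.isOpen_ball.mem_nhds (mem_ball_zero_iff.2 hz))).hasDerivAt

lemma hasDerivAt_hyperbolicSpeed_sq {G : ℂ → ℂ} (hG : DifferentiableOn ℂ G (Metric.ball 0 1))
    {α : ℝ → ℂ} {t : ℝ} (ht : ‖α t‖ < 1) (hα : HasDerivAt α (G (α t)) t) :
    HasDerivAt (fun s => hyperbolicSpeed G (α s) ^ 2)
      (2 * ‖G (α t)‖ ^ 2 / (1 - ‖α t‖ ^ 2) ^ 3 *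
        ((deriv G (α t)).re * (1 - ‖α t‖ ^ 2) + 2 * (conj (α t) * G (α t)).re)) t := by
  have hpos := one_sub_norm_sq_pos ht
  have hvel : HasDerivAt (fun s => G (α s)) (G (α t) • deriv G (α t)) t :=
    HasDerivAt.scomp t (hasDerivAt_of_norm_lt_one hG ht) hα
  have hinner : inner ℝ (G (α t)) (G (α t) • deriv G (α t))
      = ‖G (α t)‖ ^ 2 * (deriv G (α t)).re := by
    rw [Complex.inner, smul_eq_mul, mul_right_comm, Complex.mul_conj', ← Complex.ofReal_pow,
      Complex.re_ofReal_mul]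
  simp only [hyperbolicSpeed, div_pow]
  refine (hvel.norm_sq.div ((hasDerivAt_one_sub_norm_sq hα).pow 2)
    (pow_ne_zero 2 hpos.ne')).congr_deriv ?_
  simp only [Pi.pow_apply, hinner]
  field_simp
  ring

namespace IsTrajectory

variable {G : ℂ → ℂ} {b : ℝ} {α : ℝ → ℂ} (hα : IsTrajectory G b α)
include hα

lemma continuousOn : ContinuousOn α (Set.Icc 0 b) := fun t ht => (hα t ht).2.continuousWithinAt

lemma hasDerivAt {t : ℝ} (ht : t ∈ Set.Ioo 0 b) : HasDerivAt α (G (α t)) t :=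
  (hα t (Set.Ioo_subset_Icc_self ht)).2.hasDerivAt (Icc_mem_nhds ht.1 ht.2)

lemma hasDerivWithinAt_Ici {t : ℝ} (ht : t ∈ Set.Ico 0 b) :
    HasDerivWithinAt α (G (α t)) (Set.Ici t) t :=
  (hα t (Set.Ico_subset_Icc_self ht)).2.mono_of_mem_nhdsWithin <| by
    filter_upwards [Ico_mem_nhdsGE ht.2] with s hs
    exact ⟨ht.1.trans hs.1, hs.2.le⟩

lemma mono {c : ℝ} (hc : c ≤ b) : IsTrajectory G c α := fun t ht =>
  ⟨(hα t ⟨ht.1, ht.2.trans hc⟩).1,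
    (hα t ⟨ht.1, ht.2.trans hc⟩).2.mono (Set.Icc_subset_Icc_right hc)⟩

lemma exists_radius : ∃ r : ℝ, 0 < r ∧ r < 1 ∧ ∀ t ∈ Set.Icc 0 b, ‖α t‖ ≤ r := by
  obtain hempty | hne := (Set.Icc (0 : ℝ) b).eq_empty_or_nonempty
  · exact ⟨1 / 2, by norm_num, by norm_num, by simp [hempty]⟩
  · obtain ⟨t, ht, hmax⟩ := isCompact_Icc.exists_isMaxOn hne hα.continuousOn.norm
    have hlt := (hα t ht).1
    refine ⟨(1 + ‖α t‖) / 2, by positivity, by linarith, fun s hs => ?_⟩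
    linarith [isMaxOn_iff.1 hmax s hs]

section Dissipative

variable (hG : DifferentiableOn ℂ G (Metric.ball 0 1)) (hD : IsDissipative G)
include hG hD

theorem antitoneOn_hyperbolicSpeed_sq :
    AntitoneOn (fun t => hyperbolicSpeed G (α t) ^ 2) (Set.Icc 0 b) := by
  have hcont : ContinuousOn (fun t => hyperbolicSpeed G (α t) ^ 2) (Set.Icc 0 b) := by
    have hGα : ContinuousOn (fun t => G (α t)) (Set.Icc 0 b) :=
      hG.continuousOn.comp hα.continuousOn fun t ht => mem_ball_zero_iff.2 (hα t ht).1
    exact (hGα.norm.div (continuousOn_const.sub (hα.continuousOn.norm.pow 2)) fun t ht =>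
      (one_sub_norm_sq_pos (hα t ht).1).ne').pow 2
  refine antitoneOn_of_hasDerivWithinAt_nonpos (convex_Icc 0 b) hcont
    (fun t ht => (hasDerivAt_hyperbolicSpeed_sq hG (hα t (interior_subset ht)).1
      (hα.hasDerivAt (interior_Icc.subset ht))).hasDerivWithinAt) fun t ht => ?_
  have hpos := one_sub_norm_sq_pos (hα t (interior_subset ht)).1
  exact mul_nonpos_of_nonneg_of_nonpos (by positivity) (hD _ (hα t (interior_subset ht)).1)

theorem hyperbolicSpeed_le {t : ℝ} (ht : t ∈ Set.Icc 0 b) :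
    hyperbolicSpeed G (α t) ≤ hyperbolicSpeed G (α 0) := by
  have h0 : (0 : ℝ) ∈ Set.Icc 0 b := ⟨le_rfl, ht.1.trans ht.2⟩
  exact (pow_le_pow_iff_left₀ (hyperbolicSpeed_nonneg G (hα t ht).1)
    (hyperbolicSpeed_nonneg G (hα 0 h0).1) two_ne_zero).1
    (hα.antitoneOn_hyperbolicSpeed_sq hG hD h0 ht ht.1)

/-- Since its hyperbolic speed is nonincreasing, `α` cannot reach the unit circle in finite time. -/
theorem mul_exp_le_one_sub_norm_sq {t : ℝ} (ht : t ∈ Set.Icc 0 b) :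
    (1 - ‖α 0‖ ^ 2) * Real.exp (-(2 * hyperbolicSpeed G (α 0) * t)) ≤ 1 - ‖α t‖ ^ 2 := by
  set K := hyperbolicSpeed G (α 0)
  have hmono : MonotoneOn (fun s => (1 - ‖α s‖ ^ 2) * Real.exp (2 * K * s)) (Set.Icc 0 b) := by
    refine monotoneOn_of_hasDerivWithinAt_nonneg (convex_Icc 0 b)
      ((continuousOn_const.sub (hα.continuousOn.norm.pow 2)).mul (by fun_prop))
      (fun s hs => ((hasDerivAt_one_sub_norm_sq (hα.hasDerivAt (interior_Icc.subset hs))).mul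
        ((hasDerivAt_id s).const_mul (2 * K)).exp).hasDerivWithinAt) fun s hs => ?_
    have hs' := interior_subset hs
    have hspeed : ‖G (α s)‖ ≤ K * (1 - ‖α s‖ ^ 2) :=
      (div_le_iff₀ (one_sub_norm_sq_pos (hα s hs').1)).1 (hα.hyperbolicSpeed_le hG hD hs')
    have hradial : (conj (α s) * G (α s)).re ≤ K * (1 - ‖α s‖ ^ 2) := by
      refine (Complex.re_le_norm _).trans (le_trans ?_ hspeed)
      rw [norm_mul, RCLike.norm_conj]
      exact mul_le_of_le_one_left (norm_nonneg _) (hα s hs').1.le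
    have hprod := mul_nonneg (sub_nonneg.2 hradial) (Real.exp_pos (2 * K * s)).le
    simp only [id, mul_one]
    linarith
  have hle := hmono ⟨le_rfl, ht.1.trans ht.2⟩ ht ht.1
  simp only [mul_zero, Real.exp_zero, mul_one] at hle
  rwa [Real.exp_neg, ← div_eq_mul_inv, div_le_iff₀ (Real.exp_pos _)]

end Dissipative

end IsTrajectory

lemma exists_lipschitz_cutoff {G : ℂ → ℂ} (hG : DifferentiableOn ℂ G (Metric.ball 0 1)) {r : ℝ}
    (hr0 : 0 < r) (hr : r < 1) :
    ∃ (v : ℂ → ℂ) (K L : NNReal), LipschitzWith K v ∧ (∀ z, ‖v z‖ ≤ L) ∧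
      ∀ z, ‖z‖ ≤ r → v z = G z := by
  let χ : ContDiffBump (0 : ℂ) := ⟨r, (r + 1) / 2, hr0, by linarith⟩
  have hsmooth : ContDiff ℝ 1 fun z => (χ z : ℝ) • G z := by
    refine contDiff_iff_contDiffAt.2 fun z => ?_
    by_cases hz : ‖z‖ < 1
    · have hGz : ContDiffAt ℂ 1 G z :=
        (hG.analyticAt (Metric.isOpen_ball.mem_nhds (mem_ball_zero_iff.2 hz))).contDiffAt
      exact χ.contDiffAt.smul (hGz.restrict_scalars ℝ)
    · refine (contDiffAt_const (c := (0 : ℂ))).congr_of_eventuallyEq ?_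
      have hz' : (r + 1) / 2 < ‖z‖ := by linarith [not_lt.1 hz]
      filter_upwards [continuous_norm.continuousAt.eventually_const_lt hz'] with w hw
      rw [χ.zero_of_le_dist (by rw [dist_zero_right]; exact hw.le), zero_smul]
  have hsupp : HasCompactSupport fun z => (χ z : ℝ) • G z := χ.hasCompactSupport.smul_right
  obtain ⟨K, hK⟩ := ContDiff.lipschitzWith_of_hasCompactSupport hsupp hsmooth one_ne_zero
  obtain ⟨L, hL⟩ := hsupp.exists_bound_of_continuous hsmooth.continuous
  refine ⟨_, K, L.toNNReal, hK, fun z => (hL z).trans (Real.le_coe_toNNReal L), fun z hz => ?_⟩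
  rw [χ.one_of_mem_closedBall (by simpa using hz), one_smul]

lemma lt_of_continuousOn_of_forall_le {f : ℝ → ℝ} {a b r : ℝ} (hf : ContinuousOn f (Set.Icc a b))
    (ha : f a < r) (h : ∀ t ∈ Set.Icc a b, (∀ s ∈ Set.Icc a t, f s ≤ r) → f t < r) :
    ∀ t ∈ Set.Icc a b, f t < r := by
  by_contra! hex
  have hcompact : IsCompact (Set.Icc a b ∩ f ⁻¹' Set.Ici r) := isCompact_Icc.of_isClosed_subset
    (hf.preimage_isClosed_of_isClosed isClosed_Icc isClosed_Ici) Set.inter_subset_left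
  obtain ⟨t, ⟨htI, htr⟩, hleast⟩ := hcompact.exists_isLeast hex
  have hne : a ≠ t := by rintro rfl; exact ha.not_ge htr
  have hbelow : ∀ s ∈ Set.Ico a t, f s ≤ r := fun s hs => by
    by_contra! hlt
    exact hs.2.not_ge (hleast ⟨⟨hs.1, hs.2.le.trans htI.2⟩, hlt.le⟩)
  refine (h t htI fun s hs => ?_).not_ge htr
  rw [← closure_Ico hne] at hs
  refine le_on_closure hbelow (hf.mono ?_) continuousOn_const hs
  rw [closure_Ico hne]
  exact Set.Icc_subset_Icc_right htI.2

lemma exists_radius_one_sub_sq_lt {ρ u : ℝ} (hρ : ρ < 1) (hu : 0 < u) :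
    ∃ r : ℝ, ρ < r ∧ r < 1 ∧ 1 - r ^ 2 < u := by
  have hlim : Tendsto (fun r : ℝ => 1 - r ^ 2) (𝓝[<] 1) (𝓝 (1 - 1 ^ 2)) :=
    (Continuous.tendsto (by fun_prop) 1).mono_left nhdsWithin_le_nhds
  rw [one_pow, sub_self] at hlim
  obtain ⟨r, hru, hρr, hr1⟩ := ((hlim.eventually_lt_const hu).and (Ioo_mem_nhdsLT hρ)).exists
  exact ⟨r, hρr, hr1, hru⟩

section Flow

variable {G : ℂ → ℂ} (hG : DifferentiableOn ℂ G (Metric.ball 0 1))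
include hG

theorem IsTrajectory.eqOn {b : ℝ} {α γ : ℝ → ℂ} (hα : IsTrajectory G b α) (hγ : IsTrajectory G b γ)
    (h0 : α 0 = γ 0) : Set.EqOn α γ (Set.Icc 0 b) := by
  obtain ⟨r, hr0, hr1, hr⟩ := hα.exists_radius
  obtain ⟨s, -, hs1, hs⟩ := hγ.exists_radius
  obtain ⟨v, K, -, hv, -, hvG⟩ := exists_lipschitz_cutoff hG (lt_max_of_lt_left hr0)
    (max_lt hr1 hs1)
  refine ODE_solution_unique_of_mem_Icc_right (v := fun _ => v) (s := fun _ => Set.univ) (K := K)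
    (fun t _ => hv.lipschitzOnWith) hα.continuousOn ?_ (fun _ _ => trivial) hγ.continuousOn ?_
    (fun _ _ => trivial) h0
  · intro t ht
    rw [hvG _ ((hr t (Set.Ico_subset_Icc_self ht)).trans (le_max_left _ _))]
    exact hα.hasDerivWithinAt_Ici ht
  · intro t ht
    rw [hvG _ ((hs t (Set.Ico_subset_Icc_self ht)).trans (le_max_right _ _))]
    exact hγ.hasDerivWithinAt_Ici ht

variable (hD : IsDissipative G)
include hD

theorem exists_isTrajectory {z : ℂ} (hz : ‖z‖ < 1) {T : ℝ} (hT : 0 ≤ T) :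
    ∃ α : ℝ → ℂ, α 0 = z ∧ IsTrajectory G T α := by
  have hz2 := one_sub_norm_sq_pos hz
  have hK0 := hyperbolicSpeed_nonneg G hz
  set K := hyperbolicSpeed G z with hK
  obtain ⟨r, hzr, hr1, hru⟩ := exists_radius_one_sub_sq_lt hz
    (u := (1 - ‖z‖ ^ 2) * Real.exp (-(2 * K * T))) (by positivity)
  have hr0 : 0 < r := (norm_nonneg z).trans_lt hzr
  obtain ⟨v, Kv, L, hv, hL, hvG⟩ := exists_lipschitz_cutoff hG hr0 hr1
  have hPL : IsPicardLindelof (fun _ => v) (⟨0, le_rfl, hT⟩ : Set.Icc 0 T) z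
      (L * ⟨T, hT⟩) 0 L Kv :=
    IsPicardLindelof.of_time_independent (fun x _ => hL x) hv.lipschitzOnWith (by simp [hT]; rfl)
  obtain ⟨α, hα0 : α 0 = z, hα⟩ := hPL.exists_eq_forall_mem_Icc_hasDerivWithinAt₀
  have htraj : ∀ b ≤ T, (∀ t ∈ Set.Icc 0 b, ‖α t‖ ≤ r) → IsTrajectory G b α := by
    intro b hb hbound t ht
    have hderiv := (hα t ⟨ht.1, ht.2.trans hb⟩).mono (Set.Icc_subset_Icc_right hb)
    rw [hvG _ (hbound t ht)] at hderiv
    exact ⟨(hbound t ht).trans_lt hr1, hderiv⟩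
  refine ⟨α, hα0, htraj T le_rfl fun t ht => (lt_of_continuousOn_of_forall_le (f := fun t => ‖α t‖)
    (fun t ht => (hα t ht).continuousWithinAt.norm) (by rwa [hα0]) ?_ t ht).le⟩
  intro b hb hbound
  have hexp := (htraj b hb.2 hbound).mul_exp_le_one_sub_norm_sq hG hD ⟨hb.1, le_rfl⟩
  rw [hα0, ← hK] at hexp
  have hmono : (1 - ‖z‖ ^ 2) * Real.exp (-(2 * K * T))
      ≤ (1 - ‖z‖ ^ 2) * Real.exp (-(2 * K * b)) := by
    gcongr
    exact hb.2
  exact lt_of_pow_lt_pow_left₀ 2 hr0.le (by linarith)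

theorem exists_global_trajectory (z : 𝔻) :
    ∃ α : ℝ → 𝔻, α 0 = z ∧ ∀ t, 0 ≤ t →
      HasDerivWithinAt (fun s => (α s : ℂ)) (G (α t)) (Set.Ici 0) t := by
  choose α h0 hα using fun n : ℕ => exists_isTrajectory hG hD z.norm_lt_one (T := n) n.cast_nonneg
  have hcons (n m : ℕ) (t : ℝ) (hnm : n ≤ m) (ht : 0 ≤ t) (htn : t ≤ n) : α m t = α n t :=
    ((hα m).mono (Nat.cast_le.2 hnm)).eqOn hG (hα n) ((h0 m).trans (h0 n).symm) ⟨ht, htn⟩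
  have hnorm (t : ℝ) : ‖α ⌈t⌉₊ (max t 0)‖ < 1 :=
    (hα _ _ ⟨le_max_right _ _, max_le (Nat.le_ceil t) (Nat.cast_nonneg _)⟩).1
  have heq (m : ℕ) (t : ℝ) (ht : 0 ≤ t) (htm : t ≤ m) : α ⌈t⌉₊ (max t 0) = α m t := by
    rw [max_eq_left ht]
    exact (hcons _ m t (Nat.ceil_le.2 htm) ht (Nat.le_ceil t)).symm
  refine ⟨fun t => .mk _ (hnorm t), ?_, fun t ht => ?_⟩
  · apply Complex.UnitDisc.coe_injective
    simp [h0]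
  · simp only [Complex.UnitDisc.coe_mk]
    obtain ⟨m, hm⟩ := exists_nat_gt t
    have hderiv := (hα m t ⟨ht, hm.le⟩).2
    rw [← heq m t ht hm.le] at hderiv
    refine (hderiv.congr_of_mem (fun s hs => heq m s hs.1 hs.2) ⟨ht, hm.le⟩).mono_of_mem_nhdsWithin
      ?_
    filter_upwards [self_mem_nhdsWithin, nhdsWithin_le_nhds (Iio_mem_nhds hm)] with s hs hsm
    exact ⟨hs, hsm.le⟩

end Flow

/-! ### Holomorphic dependence on the initial point -/

lemma exists_continuous_slope {G : ℂ → ℂ} (hG : DifferentiableOn ℂ G (Metric.ball 0 1)) {r : ℝ}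
    (hr0 : 0 < r) (hr : r < 1) :
    ∃ (q : ℂ → ℂ → ℂ) (M : ℝ), Continuous (fun p : ℂ × ℂ => q p.1 p.2) ∧ (∀ a b, ‖q a b‖ ≤ M) ∧
      ∀ a b, ‖a‖ ≤ r → ‖b‖ ≤ r → G b - G a = q a b * (b - a) := by
  obtain ⟨v, K, M, hv, hM, hvG⟩ := exists_lipschitz_cutoff (hG.deriv Metric.isOpen_ball) hr0 hr
  refine ⟨fun a b => ∫ u in (0 : ℝ)..1, v (a + u • (b - a)), M, ?_, fun a b => ?_,
    fun a b ha hb => ?_⟩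
  · refine intervalIntegral.continuous_parametric_intervalIntegral_of_continuous' ?_ 0 1
    exact hv.continuous.comp (by fun_prop)
  · simpa using intervalIntegral.norm_integral_le_of_norm_le_const (a := 0) (b := 1)
      (f := fun u : ℝ => v (a + u • (b - a))) (C := M) fun u _ => hM _
  · have hmem : ∀ u ∈ Set.Icc (0 : ℝ) 1, ‖a + u • (b - a)‖ ≤ r := fun u hu => by
      simpa using (convex_closedBall (0 : ℂ) r).add_smul_sub_mem (by simpa using ha)
        (by simpa using hb) hu
    have hFTC := intervalIntegral.integral_unitInterval_deriv_eq_sub (f := G) (f' := v) (z₀ := a)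
      (z₁ := b - a) (hv.continuous.comp (by fun_prop)).continuousOn fun u hu => by
        rw [hvG _ (hmem u hu)]
        exact hasDerivAt_of_norm_lt_one hG ((hmem u hu).trans_lt hr)
    rw [add_sub_cancel, smul_eq_mul] at hFTC
    rw [← hFTC, mul_comm]

lemma eq_mul_exp_integral {c d : ℝ → ℂ} {T : ℝ} (hc : Continuous c)
    (hd : ContinuousOn d (Set.Icc 0 T))
    (hderiv : ∀ t ∈ Set.Ico 0 T, HasDerivWithinAt d (c t * d t) (Set.Ici t) t) :
    ∀ t ∈ Set.Icc 0 T, d t = d 0 * Complex.exp (∫ s in (0 : ℝ)..t, c s) := by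
  have hint (t : ℝ) : HasDerivAt (fun t => ∫ s in (0 : ℝ)..t, c s) (c t) t :=
    (hc.integral_hasStrictDerivAt 0 t).hasDerivAt
  have hconst := constant_of_has_deriv_right_zero
    (f := fun t => d t * Complex.exp (-∫ s in (0 : ℝ)..t, c s)) (a := 0) (b := T)
    (hd.mul fun t _ => (hint t).neg.cexp.continuousAt.continuousWithinAt)
    fun t ht => ((hderiv t ht).mul (hint t).neg.cexp.hasDerivWithinAt).congr_deriv (by ring)
  intro t ht
  have heq := hconst t ht
  simp only [intervalIntegral.integral_same, neg_zero, Complex.exp_zero, mul_one] at heq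
  rw [← heq, mul_assoc, ← Complex.exp_add, neg_add_cancel, Complex.exp_zero, mul_one]

lemma IsTrajectory.continuous_comp_projIcc {G : ℂ → ℂ} {α : ℝ → ℂ} {T : ℝ}
    (hα : IsTrajectory G T α) (hT : 0 ≤ T) :
    Continuous fun s => α (Set.projIcc 0 T hT s) :=
  hα.continuousOn.comp_continuous (continuous_subtype_val.comp continuous_projIcc)
    fun s => (Set.projIcc 0 T hT s).2

section HolomorphicFlow

variable {G : ℂ → ℂ} (hG : DifferentiableOn ℂ G (Metric.ball 0 1)) {T : ℝ}
include hG

/-- The difference of two trajectories satisfies a linear equation, whose coefficient is the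
difference quotient of `G` along them. -/
lemma exists_sub_eq_mul_exp_integral {r : ℝ} (hr0 : 0 < r) (hr : r < 1) :
    ∃ (q : ℂ → ℂ → ℂ) (M : ℝ), Continuous (fun p : ℂ × ℂ => q p.1 p.2) ∧ (∀ a b, ‖q a b‖ ≤ M) ∧
      ∀ α γ : ℝ → ℂ, IsTrajectory G T α → IsTrajectory G T γ →
        (∀ t ∈ Set.Icc 0 T, ‖α t‖ ≤ r ∧ ‖γ t‖ ≤ r) → ∀ hT : 0 ≤ T, ∀ t ∈ Set.Icc 0 T,
          γ t - α t = (γ 0 - α 0) * Complex.exp (∫ s in (0 : ℝ)..t,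
            q (α (Set.projIcc 0 T hT s)) (γ (Set.projIcc 0 T hT s))) := by
  obtain ⟨q, M, hq, hM, hqG⟩ := exists_continuous_slope hG hr0 hr
  refine ⟨q, M, hq, hM, fun α γ hα hγ hbound hT => ?_⟩
  refine eq_mul_exp_integral
    (hq.comp ((hα.continuous_comp_projIcc hT).prodMk (hγ.continuous_comp_projIcc hT)))
    (hγ.continuousOn.sub hα.continuousOn) fun t ht =>
    ((hγ.hasDerivWithinAt_Ici ht).sub (hα.hasDerivWithinAt_Ici ht)).congr_deriv ?_
  have ht' := Set.Ico_subset_Icc_self ht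
  rw [Set.projIcc_of_mem hT ht']
  exact hqG _ _ (hbound t ht').1 (hbound t ht').2

variable (hD : IsDissipative G) {Φ : ℂ → ℝ → ℂ}
  (hΦ : ∀ w : ℂ, ‖w‖ < 1 → Φ w 0 = w ∧ IsTrajectory G T (Φ w)) {z : ℂ} (hz : ‖z‖ < 1)
include hD hΦ hz

lemma exists_uniform_radius :
    ∃ r : ℝ, 0 < r ∧ r < 1 ∧ ∀ᶠ w in 𝓝 z, ‖w‖ < 1 ∧ ∀ t ∈ Set.Icc 0 T, ‖Φ w t‖ ≤ r := by
  set m : ℂ → ℝ := fun w => (1 - ‖w‖ ^ 2) * Real.exp (-(2 * hyperbolicSpeed G w * T)) with hm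
  have hmz : 0 < m z := mul_pos (one_sub_norm_sq_pos hz) (Real.exp_pos _)
  have hcont : ContinuousAt m z := by
    have hsq : ContinuousAt (fun w : ℂ => 1 - ‖w‖ ^ 2) z := by fun_prop
    have hspeed : ContinuousAt (hyperbolicSpeed G) z :=
      (hasDerivAt_of_norm_lt_one hG hz).continuousAt.norm.div hsq (one_sub_norm_sq_pos hz).ne'
    exact hsq.mul ((hspeed.const_mul 2).mul_const T).neg.rexp
  obtain ⟨r, hr0, hr1, hru⟩ := exists_radius_one_sub_sq_lt zero_lt_one hmz
  refine ⟨r, hr0, hr1, ?_⟩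
  filter_upwards [hcont.eventually_const_lt hru,
    continuous_norm.continuousAt.eventually_lt_const hz] with w hmw hw
  refine ⟨hw, fun t ht => ?_⟩
  obtain ⟨hw0, htraj⟩ := hΦ w hw
  have hexp := htraj.mul_exp_le_one_sub_norm_sq hG hD ht
  rw [hw0] at hexp
  have hmono : m w ≤ (1 - ‖w‖ ^ 2) * Real.exp (-(2 * hyperbolicSpeed G w * t)) := by
    have hspeed := hyperbolicSpeed_nonneg G hw
    have hsq := one_sub_norm_sq_pos hw
    simp only [hm]
    gcongr
    exact ht.2
  exact (lt_of_pow_lt_pow_left₀ 2 hr0.le (by linarith)).le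

lemma eventually_flow_sub_eq (hT : 0 ≤ T) :
    ∃ (q : ℂ → ℂ → ℂ) (M : ℝ), Continuous (fun p : ℂ × ℂ => q p.1 p.2) ∧ (∀ a b, ‖q a b‖ ≤ M) ∧
      ∀ᶠ w in 𝓝 z, ‖w‖ < 1 ∧ ∀ t ∈ Set.Icc 0 T,
        Φ w t - Φ z t = (w - z) * Complex.exp (∫ s in (0 : ℝ)..t,
          q (Φ z (Set.projIcc 0 T hT s)) (Φ w (Set.projIcc 0 T hT s))) := by
  obtain ⟨r, hr0, hr1, hr⟩ := exists_uniform_radius hG hD hΦ hz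
  obtain ⟨q, M, hq, hM, hsub⟩ := exists_sub_eq_mul_exp_integral (T := T) hG hr0 hr1
  refine ⟨q, M, hq, hM, hr.mono fun w hw => ⟨hw.1, fun t ht => ?_⟩⟩
  rw [hsub _ _ (hΦ z hz).2 (hΦ w hw.1).2 (fun t ht => ⟨hr.self_of_nhds.2 t ht, hw.2 t ht⟩) hT t
    ht, (hΦ w hw.1).1, (hΦ z hz).1]

lemma tendsto_flow {t : ℝ} (ht : t ∈ Set.Icc 0 T) :
    Tendsto (fun w => Φ w t) (𝓝 z) (𝓝 (Φ z t)) := by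
  obtain ⟨q, M, -, hM, hflow⟩ := eventually_flow_sub_eq hG hD hΦ hz (ht.1.trans ht.2)
  rw [tendsto_iff_norm_sub_tendsto_zero]
  have hlim : Tendsto (fun w => ‖w - z‖ * Real.exp (M * |t - 0|)) (𝓝 z) (𝓝 0) := by
    simpa using (continuous_norm.comp (continuous_sub_right z)).tendsto z |>.mul_const
      (Real.exp (M * |t - 0|))
  refine squeeze_zero' (Eventually.of_forall fun w => norm_nonneg _) ?_ hlim
  filter_upwards [hflow] with w hw
  rw [hw.2 t ht, norm_mul]
  gcongr
  exact (Complex.norm_exp_le_exp_norm _).trans (Real.exp_le_exp.2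
    (intervalIntegral.norm_integral_le_of_norm_le_const fun s _ => hM _ _))

theorem exists_hasDerivAt_flow (hT : 0 ≤ T) : ∃ v, HasDerivAt (fun w => Φ w T) v z := by
  obtain ⟨q, M, hq, hM, hflow⟩ := eventually_flow_sub_eq hG hD hΦ hz hT
  set I : ℂ → ℂ := fun w => ∫ s in (0 : ℝ)..T,
    q (Φ z (Set.projIcc 0 T hT s)) (Φ w (Set.projIcc 0 T hT s))
  have hIlim : Tendsto I (𝓝 z) (𝓝 (I z)) := by
    refine intervalIntegral.tendsto_integral_filter_of_dominated_convergence (fun _ => M)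
      (hflow.mono fun w hw => (hq.comp (((hΦ z hz).2.continuous_comp_projIcc hT).prodMk
        ((hΦ w hw.1).2.continuous_comp_projIcc hT))).aestronglyMeasurable)
      (Eventually.of_forall fun w => Eventually.of_forall fun s _ => hM _ _)
      intervalIntegrable_const (Eventually.of_forall fun s _ => ?_)
    exact (hq.tendsto (_, _)).comp
      (tendsto_const_nhds.prodMk_nhds (tendsto_flow hG hD hΦ hz (Set.projIcc 0 T hT s).2))
  refine ⟨Complex.exp (I z), hasDerivAt_iff_tendsto_slope.2 ?_⟩
  refine Tendsto.congr' ?_ (hIlim.cexp.mono_left nhdsWithin_le_nhds)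
  filter_upwards [self_mem_nhdsWithin, nhdsWithin_le_nhds hflow] with w hw hwflow
  rw [slope_def_field, hwflow.2 T ⟨hT, le_rfl⟩, mul_div_cancel_left₀ _ (sub_ne_zero.2 hw)]

end HolomorphicFlow

lemma isTrajectory_of_forall {G : ℂ → ℂ} {α : ℝ → 𝔻}
    (h : ∀ t, 0 ≤ t → HasDerivWithinAt (fun s => (α s : ℂ)) (G (α t)) (Set.Ici 0) t) (b : ℝ) :
    IsTrajectory G b fun s => (α s : ℂ) := fun t ht =>
  ⟨(α t).norm_lt_one, (h t ht.1).mono Set.Icc_subset_Ici_self⟩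

theorem exists_semigroup {G : ℂ → ℂ} (hG : DifferentiableOn ℂ G (Metric.ball 0 1))
    (hD : IsDissipative G) :
    ∃ φ : ℝ → 𝔻 → 𝔻, IsOneParameterSemigroup φ ∧
      IsInfinitesimalGenerator φ (fun z => G z) := by
  choose α hzero hα using exists_global_trajectory hG hD
  refine ⟨fun t z => α z t, ⟨fun t ht => ?_, hzero, fun s t hs ht z => ?_, fun z => ?_⟩,
    ⟨G, hG, fun _ => rfl⟩, hα⟩
  · classical
    set Φ : ℂ → ℝ → ℂ := fun w s => if h : ‖w‖ < 1 then (α (.mk w h) s : ℂ) else 0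
    have hΦ (w) (h : ‖w‖ < 1) : Φ w = fun s => (α (.mk w h) s : ℂ) := funext fun s => dif_pos h
    refine ⟨fun w => Φ w t, fun w hw => ?_, fun z => ?_⟩
    · obtain ⟨v, hv⟩ := exists_hasDerivAt_flow (Φ := Φ) hG hD (fun w hw => by
        rw [hΦ w hw]
        exact ⟨by simp [hzero], isTrajectory_of_forall (hα _) t⟩) (mem_ball_zero_iff.1 hw) ht
      exact hv.differentiableAt.differentiableWithinAt
    · simp only [hΦ z z.norm_lt_one, Complex.UnitDisc.mk_coe]
  · have hshift : IsTrajectory G s (fun r => (α z (r + t) : ℂ)) := fun r hr =>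
      ⟨(α z _).norm_lt_one, by
        simpa [Function.comp_def] using (hα z (r + t) (add_nonneg hr.1 ht)).scomp r
          ((hasDerivAt_id r).add_const t).hasDerivWithinAt (s := Set.Icc 0 s)
          fun x hx => add_nonneg hx.1 ht⟩
    exact Complex.UnitDisc.coe_injective
      (hshift.eqOn hG (isTrajectory_of_forall (hα (α z t)) s) (by simp [hzero]) ⟨hs, le_rfl⟩)
  · have hcont := (hα z 0 le_rfl).continuousWithinAt.tendsto
    rw [hzero] at hcont
    exact Complex.UnitDisc.isEmbedding_coe.tendsto_nhds_iff.2
      (hcont.mono_left (nhdsWithin_mono _ Set.Ioi_subset_Ici_self))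

/-! ### Sufficiency of the Berkson–Porta representation -/

lemma norm_deriv_herglotz_mul_le (β : ℝ) (ν : Measure UnitCircle) [IsFiniteMeasure ν] {z : ℂ}
    (hz : ‖z‖ < 1) : ‖deriv (herglotz β ν) z‖ * (1 - ‖z‖ ^ 2) ≤ 2 * (herglotz β ν z).re := by
  have hpos := one_sub_norm_sq_pos hz
  have hkernel (κ : UnitCircle) :
      ‖2 * (κ : ℂ) / ((κ : ℂ) - z) ^ 2‖ * (1 - ‖z‖ ^ 2) = 2 * (cayley κ z).re := by
    rw [norm_div, norm_mul, norm_pow, κ.norm_coe, Complex.norm_ofNat, re_cayley_coe]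
    ring
  rw [(hasDerivAt_herglotz β ν hz).deriv, re_herglotz β ν hz]
  calc _ ≤ (∫ κ : UnitCircle, ‖2 * (κ : ℂ) / ((κ : ℂ) - z) ^ 2‖ ∂ν) * (1 - ‖z‖ ^ 2) := by
        gcongr
        exact norm_integral_le_integral_norm _
    _ = _ := by
        rw [← integral_mul_const, ← integral_const_mul]
        exact integral_congr_ae (Eventually.of_forall hkernel)

lemma hasDerivAt_dwFactor (τ z : ℂ) :
    HasDerivAt (dwFactor τ) (-(1 - conj τ * z) - (τ - z) * conj τ) z :=
  (((hasDerivAt_id' z).const_sub τ).mul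
    (((hasDerivAt_id' z).const_mul (conj τ)).const_sub 1)).congr_deriv (by ring)

lemma deriv_dwFactor_mul_add (τ z : ℂ) :
    deriv (dwFactor τ) z * ((1 - ‖z‖ ^ 2 : ℝ) : ℂ) + 2 * conj z * dwFactor τ z
      = ((-(‖τ - z‖ ^ 2 + ‖1 - conj τ * z‖ ^ 2) : ℝ) : ℂ) := by
  rw [(hasDerivAt_dwFactor τ z).deriv, dwFactor]
  push_cast
  rw [← Complex.conj_mul', ← Complex.conj_mul', ← Complex.conj_mul']
  simp only [map_sub, map_mul, map_one, Complex.conj_conj]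
  ring

theorem isDissipative_dwFactor_mul_herglotz (τ : ℂ) (β : ℝ) (ν : Measure UnitCircle)
    [IsFiniteMeasure ν] : IsDissipative fun z => dwFactor τ z * herglotz β ν z := by
  intro z hz
  set h := herglotz β ν z
  set h' := deriv (herglotz β ν) z
  set S : ℝ := ‖τ - z‖ ^ 2 + ‖1 - conj τ * z‖ ^ 2 with hS
  have hpos := one_sub_norm_sq_pos hz
  have hderiv : deriv (fun z => dwFactor τ z * herglotz β ν z) z
      = deriv (dwFactor τ) z * h + dwFactor τ z * h' :=
    deriv_fun_mul (hasDerivAt_dwFactor τ z).differentiableAt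
      (hasDerivAt_herglotz β ν hz).differentiableAt
  have hsplit : (deriv (dwFactor τ) z * h + dwFactor τ z * h').re * (1 - ‖z‖ ^ 2)
      + 2 * (conj z * (dwFactor τ z * h)).re
      = -S * h.re + (dwFactor τ z * h').re * (1 - ‖z‖ ^ 2) := by
    rw [← Complex.re_ofReal_mul (-S), ← deriv_dwFactor_mul_add]
    simp only [Complex.add_re, Complex.add_im, Complex.mul_re, Complex.mul_im, Complex.ofReal_re,
      Complex.ofReal_im, Complex.re_ofNat, Complex.im_ofNat]
    ring
  have hfactor : 2 * ‖dwFactor τ z‖ ≤ S := by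
    rw [dwFactor, norm_mul, hS, ← mul_assoc]
    exact two_mul_le_add_sq _ _
  have hbound : (dwFactor τ z * h').re * (1 - ‖z‖ ^ 2) ≤ S * h.re :=
    calc (dwFactor τ z * h').re * (1 - ‖z‖ ^ 2)
        ≤ ‖dwFactor τ z‖ * (‖h'‖ * (1 - ‖z‖ ^ 2)) := by
          rw [← mul_assoc, ← norm_mul]
          gcongr
          exact Complex.re_le_norm _
      _ ≤ ‖dwFactor τ z‖ * (2 * h.re) := by
          gcongr ?_ * ?_
          exact norm_deriv_herglotz_mul_le β ν hz
      _ = 2 * ‖dwFactor τ z‖ * h.re := by ring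
      _ ≤ S * h.re := mul_le_mul_of_nonneg_right hfactor (re_herglotz_nonneg β ν hz)
  rw [hderiv, hsplit]
  linarith

lemma mul_exp_le_of_mul_le_deriv {u u' : ℝ → ℝ} {l : ℝ}
    (hu : ∀ s, 0 ≤ s → HasDerivWithinAt u (u' s) (Set.Ici 0) s)
    (hl : ∀ s, 0 ≤ s → l * u s ≤ u' s) {t : ℝ} (ht : 0 ≤ t) : u 0 * Real.exp (l * t) ≤ u t := by
  have hgronwall := le_gronwallBound_of_liminf_deriv_right_le (f := fun s => -u s)
    (f' := fun s => -u' s) (δ := -u 0) (K := l) (ε := 0) (a := 0) (b := t)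
    (fun s hs => ((hu s hs.1).continuousWithinAt.mono Set.Icc_subset_Ici_self).neg)
    (fun s hs r hr => ((hu s hs.1).mono (Set.Ici_subset_Ici.2 hs.1)).neg.liminf_right_slope_le hr)
    le_rfl (fun s hs => by linarith [hl s hs.1]) t ⟨ht, le_rfl⟩
  rw [gronwallBound_ε0, sub_zero] at hgronwall
  linarith

section Semigroup

variable {φ : ℝ → 𝔻 → 𝔻} {G : 𝔻 → ℂ}

lemma hasDerivWithinAt_re_mul_cayley (hG : IsInfinitesimalGenerator φ G) (σ : UnitCircle) (c : ℂ)
    (z : 𝔻) {t : ℝ} (ht : 0 ≤ t) :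
    HasDerivWithinAt (fun s => (c * cayley σ (φ s z)).re)
      (c * (2 * σ * G (φ t z) / ((σ : ℂ) - φ t z) ^ 2)).re (Set.Ici 0) t := by
  have hderiv := (hasDerivAt_cayley (σ.coe_sub_disc_ne_zero (φ t z))).scomp_hasDerivWithinAt t
    (hG.2 z t ht)
  refine (Complex.reCLM.hasFDerivAt.comp_hasDerivWithinAt t (hderiv.const_mul c)).congr_deriv ?_
  simp only [Complex.reCLM_apply, smul_eq_mul]
  congr 2
  ring

variable (hφ : IsOneParameterSemigroup φ) (hG : IsInfinitesimalGenerator φ G)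
include hφ hG

lemma semigroup_apply_eq_self {a : 𝔻} (ha : G a = 0) {t : ℝ} (ht : 0 ≤ t) : φ t a = a := by
  obtain ⟨⟨g, hg, hGg⟩, hderiv⟩ := hG
  have hconst : IsTrajectory g t fun _ => (a : ℂ) := fun s _ =>
    ⟨a.norm_lt_one, by rw [← hGg, ha]; exact hasDerivWithinAt_const _ _ _⟩
  have htraj := isTrajectory_of_forall (G := g) (α := fun s => φ s a)
    (fun s hs => (hGg (φ s a)) ▸ hderiv a s hs) t
  exact Complex.UnitDisc.coe_injective
    (htraj.eqOn hg hconst (by simp [hφ.map_zero]) ⟨ht, le_rfl⟩)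

section BoundaryFixedPoint

variable (σ : UnitCircle) {l t : ℝ}
  (hl : ∀ z : 𝔻, l * (cayley σ z).re ≤ (2 * σ * G z / ((σ : ℂ) - z) ^ 2).re) (ht : 0 ≤ t)
include hl ht

lemma exp_mul_re_cayley_le (z : 𝔻) :
    Real.exp (l * t) * (cayley σ z).re ≤ (cayley σ (φ t z)).re := by
  have hgrowth := mul_exp_le_of_mul_le_deriv
    (fun s hs => by simpa using hasDerivWithinAt_re_mul_cayley hG σ 1 z hs)
    (fun s _ => hl (φ s z)) ht
  rwa [hφ.map_zero, mul_comm] at hgrowth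

/-- The function `cayley σ (φ t z) - exp (l * t) * cayley σ z` has nonnegative real part, so it is
a Herglotz integral, whose mass at `σ` only decreases the angular derivative. -/
theorem exists_hasBoundaryFixedPointDeriv :
    ∃ m : ℝ, 0 ≤ m ∧ HasBoundaryFixedPointDeriv (φ t) σ (((Real.exp (l * t) + m)⁻¹ : ℝ) : ℂ) := by
  obtain ⟨g, hg, hφg⟩ := hφ.holomorphic t ht
  beta_reduce at hφg
  have hgball : ∀ w ∈ Metric.ball (0 : ℂ) 1, ‖g w‖ < 1 := fun w hw => by
    rw [← Complex.UnitDisc.coe_mk w (mem_ball_zero_iff.1 hw), ← hφg]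
    exact (φ t _).norm_lt_one
  have hcayley {w : ℂ} (hw : ‖w‖ < 1) : DifferentiableAt ℂ (cayley σ) w :=
    (hasDerivAt_cayley (σ.coe_sub_ne_zero hw)).differentiableAt
  obtain ⟨β, ν, hν, hF⟩ := exists_herglotz
    (f := fun w => cayley σ (g w) - Real.exp (l * t) * cayley σ w)
    (fun w hw => ((hcayley (hgball w hw)).comp_differentiableWithinAt w (hg w hw)).sub
      ((hcayley (mem_ball_zero_iff.1 hw)).const_mul _).differentiableWithinAt)
    (fun w hw => by
      have hexp := exp_mul_re_cayley_le hφ hG σ hl ht (.mk w hw)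
      rw [hφg] at hexp
      rwa [Complex.sub_re, Complex.re_ofReal_mul, sub_nonneg])
  refine ⟨ν.real {σ}, measureReal_nonneg, ?_⟩
  rw [Complex.ofReal_inv]
  refine hasBoundaryFixedPointDeriv_of_hasAngularLimit_cayley_mul
    (Complex.ofReal_ne_zero.2 (by positivity)) fun M => ?_
  have hlim := ((hasAngularLimit_cayley_mul σ σ M).const_mul ((Real.exp (l * t) : ℝ) : ℂ)).add
    (hasAngularLimit_herglotz_mul β ν σ M)
  rw [Set.indicator_of_mem (Set.mem_singleton σ)] at hlim
  refine (hlim.congr fun z => ?_).trans_eq ?_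
  · rw [← hF z z.norm_lt_one, hφg]
    ring
  · push_cast
    ring_nf

end BoundaryFixedPoint

end Semigroup

section DenjoyWolff

variable {β : ℝ} {ν : Measure UnitCircle}

lemma two_mul_berksonPorta_div (τ : UnitCircle) (z : 𝔻) :
    2 * (τ : ℂ) * berksonPorta τ β ν z / ((τ : ℂ) - z) ^ 2 = 2 * herglotz β ν z := by
  have hz := τ.coe_sub_disc_ne_zero z
  have hτ := τ.coe_ne_zero
  rw [berksonPorta, dwFactor, τ.one_sub_conj_mul, τ.conj_coe]
  field_simp

variable [IsFiniteMeasure ν] {φ : ℝ → 𝔻 → 𝔻}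

lemma exists_forall_re_mul_herglotz_pos (h : ¬(β = 0 ∧ ν = 0)) :
    ∃ c : ℂ, ∀ z : ℂ, ‖z‖ < 1 → 0 < (c * herglotz β ν z).re := by
  by_cases hν : ν = 0
  · have hβ : β ≠ 0 := fun hβ => h ⟨hβ, hν⟩
    refine ⟨-(Complex.I * β), fun z _ => ?_⟩
    simpa [herglotz, hν] using mul_self_pos.2 hβ
  · have : NeZero ν := ⟨hν⟩
    exact ⟨1, fun z hz => by simpa using re_herglotz_pos β ν hz⟩

/-- For `τ` on the circle the Cayley transform at `τ` of a trajectory moves with velocity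
`2 * herglotz β ν`, which stays in an open half-plane, so no trajectory is closed. -/
lemma semigroup_apply_ne_self {τ : UnitCircle} (hφ : IsOneParameterSemigroup φ)
    (hG : IsInfinitesimalGenerator φ (berksonPorta τ β ν)) (h : ¬(β = 0 ∧ ν = 0)) {t : ℝ}
    (ht : 0 < t) (a : 𝔻) : φ t a ≠ a := by
  intro ha
  obtain ⟨c, hc⟩ := exists_forall_re_mul_herglotz_pos h
  have hderiv (s : ℝ) (hs : 0 ≤ s) := hasDerivWithinAt_re_mul_cayley hG τ c a hs
  obtain ⟨s, -, hs⟩ := exists_hasDerivAt_eq_zero ht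
    (fun s hs => (hderiv s hs.1).continuousWithinAt.mono Set.Icc_subset_Ici_self)
    (by simp only [ha, hφ.map_zero])
    (fun s hs => (hderiv s hs.1.le).hasDerivAt (Ici_mem_nhds hs.1))
  rw [two_mul_berksonPorta_div, mul_left_comm, Complex.mul_re, Complex.re_ofNat,
    Complex.im_ofNat, zero_mul, sub_zero] at hs
  linarith [hc (φ s a) (φ s a).norm_lt_one]

theorem isSemigroupDWPoint_of_berksonPorta {τ : ℂ} (hτ : ‖τ‖ ≤ 1)
    (hφ : IsOneParameterSemigroup φ) (hG : IsInfinitesimalGenerator φ (berksonPorta τ β ν)) :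
    IsSemigroupDWPoint φ τ := by
  intro t ht hid
  rcases hτ.lt_or_eq with hlt | heq
  · exact Or.inl ⟨.mk τ hlt, rfl,
      semigroup_apply_eq_self hφ hG (by simp [berksonPorta, dwFactor]) ht⟩
  lift τ to UnitCircle using mem_sphere_zero_iff_norm.2 heq
  have htpos : 0 < t := ht.lt_of_ne fun h => hid (funext fun z => by rw [← h, hφ.map_zero, id])
  refine Or.inr ⟨semigroup_apply_ne_self hφ hG (fun h => hid (funext fun z => ?_)) htpos, ?_⟩
  · exact semigroup_apply_eq_self hφ hG (by simp [berksonPorta, herglotz, h.1, h.2]) ht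
  · obtain ⟨m, hm, hderiv⟩ := exists_hasBoundaryFixedPointDeriv hφ hG τ (l := 0) (fun z => by
      rw [two_mul_berksonPorta_div, zero_mul, Complex.mul_re, Complex.re_ofNat,
        Complex.im_ofNat, zero_mul, sub_zero]
      exact mul_nonneg zero_le_two (re_herglotz_nonneg β ν z.norm_lt_one)) ht
    refine ⟨_, ?_, hderiv⟩
    rw [zero_mul, Real.exp_zero]
    exact inv_le_one_of_one_le₀ (by linarith)

end DenjoyWolff

lemma two_mul_dwFactor_div_mul_add (τ : ℂ) (κ σ : UnitCircle) {z : ℂ} (hz : ‖z‖ < 1) :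
    2 * dwFactor τ z / ((σ : ℂ) - z) * ((1 - conj (κ : ℂ) * σ) / (1 - conj (κ : ℂ) * z))
        + (‖τ - σ‖ ^ 2 : ℝ) * cayley σ z
      = (conj (σ : ℂ) * τ - σ * conj τ - (τ * conj (κ : ℂ) - conj τ * κ))
        + (‖τ - κ‖ ^ 2 : ℝ) * cayley κ z := by
  have hκz := κ.coe_sub_ne_zero hz
  have hσz := σ.coe_sub_ne_zero hz
  have hκ := κ.coe_ne_zero
  have hσ := σ.coe_ne_zero
  push_cast
  rw [← Complex.conj_mul', ← Complex.conj_mul', map_sub, map_sub, dwFactor, cayley, cayley,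
    κ.one_sub_conj_mul, κ.one_sub_conj_mul, κ.conj_coe, σ.conj_coe]
  generalize conj τ = τ'
  field_simp
  ring

lemma re_two_mul_dwFactor_div_mul_slopeKernel_add_nonneg (τ : ℂ) (κ σ : UnitCircle) {z : ℂ}
    (hz : ‖z‖ < 1) :
    0 ≤ (2 * dwFactor τ z / ((σ : ℂ) - z) * slopeKernel σ κ z
      + ((‖τ - σ‖ ^ 2 * (2 * (‖(κ : ℂ) - σ‖ ^ 2)⁻¹) : ℝ) : ℂ) * cayley σ z).re := by
  have himag : (conj (σ : ℂ) * τ - σ * conj τ - (τ * conj (κ : ℂ) - conj τ * κ)).re = 0 := by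
    simp only [Complex.sub_re, Complex.mul_re, Complex.conj_re, Complex.conj_im]
    ring
  have hfactor : 2 * dwFactor τ z / ((σ : ℂ) - z) * slopeKernel σ κ z
      + ((‖τ - σ‖ ^ 2 * (2 * (‖(κ : ℂ) - σ‖ ^ 2)⁻¹) : ℝ) : ℂ) * cayley σ z
      = ((2 * (‖(κ : ℂ) - σ‖ ^ 2)⁻¹ : ℝ) : ℂ) *
        ((conj (σ : ℂ) * τ - σ * conj τ - (τ * conj (κ : ℂ) - conj τ * κ))
          + (‖τ - κ‖ ^ 2 : ℝ) * cayley κ z) := by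
    rw [← two_mul_dwFactor_div_mul_add τ κ σ hz, slopeKernel]
    push_cast
    ring
  rw [hfactor, Complex.re_ofReal_mul, Complex.add_re, Complex.re_ofReal_mul, himag, zero_add]
  have := (re_cayley_coe_pos κ hz).le
  positivity

lemma integrable_slopeKernel {ν : Measure UnitCircle} {σ : UnitCircle}
    (h : Integrable (fun κ : UnitCircle => (‖(κ : ℂ) - σ‖ ^ 2)⁻¹) ν) {z : ℂ} (hz : ‖z‖ < 1) :
    Integrable (fun κ : UnitCircle => slopeKernel σ κ z) ν := by
  have hcont : Continuous fun κ : UnitCircle =>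
      2 * ((1 - conj (κ : ℂ) * σ) / (1 - conj (κ : ℂ) * z)) :=
    continuous_const.mul (Continuous.div (by fun_prop) (by fun_prop)
      fun κ => one_sub_conj_mul_ne_zero κ.norm_coe.le hz)
  obtain ⟨C, hC⟩ := isCompact_univ.exists_bound_of_continuousOn hcont.continuousOn
  exact h.ofReal.bdd_mul hcont.aestronglyMeasurable (Eventually.of_forall fun κ => hC κ trivial)

lemma IsRegularNullPoint.neg_mul_re_cayley_le {β : ℝ} {ν : Measure UnitCircle} [IsFiniteMeasure ν]
    {σ : UnitCircle} (h : IsRegularNullPoint β ν σ) (τ : ℂ) (z : 𝔻) :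
    -(‖τ - σ‖ ^ 2 * angularSlope ν σ) * (cayley σ z).re
      ≤ (2 * σ * berksonPorta τ β ν z / ((σ : ℂ) - z) ^ 2).re := by
  have hslope := integrable_slopeKernel h.integrable z.norm_lt_one
  set A := 2 * dwFactor τ z / ((σ : ℂ) - z) with hA
  have hvel : 2 * σ * berksonPorta τ β ν z / ((σ : ℂ) - z) ^ 2
      = ∫ κ, A * slopeKernel σ κ z ∂ν := by
    have hz := σ.coe_sub_disc_ne_zero z
    have hσ := σ.coe_ne_zero
    rw [integral_const_mul, berksonPorta, h.herglotz_eq z.norm_lt_one, σ.one_sub_conj_mul,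
      σ.conj_coe, hA]
    field_simp
  have hre : (∫ κ, A * slopeKernel σ κ z ∂ν).re = ∫ κ, (A * slopeKernel σ κ z).re ∂ν :=
    (integral_re (hslope.const_mul A)).symm
  have hrei : Integrable (fun κ => (A * slopeKernel σ κ z).re) ν := (hslope.const_mul A).re
  have hmass : ‖τ - σ‖ ^ 2 * angularSlope ν σ * (cayley σ z).re
      = ∫ κ : UnitCircle, ‖τ - σ‖ ^ 2 * (2 * (‖(κ : ℂ) - σ‖ ^ 2)⁻¹) * (cayley σ z).re ∂ν := by
    rw [integral_mul_const, integral_const_mul, integral_const_mul, angularSlope]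
  rw [neg_mul, neg_le_iff_add_nonneg, hvel, hre, hmass, ← integral_add hrei
    (((h.integrable.const_mul _).const_mul _).mul_const _)]
  refine integral_nonneg fun κ => ?_
  have hκ := re_two_mul_dwFactor_div_mul_slopeKernel_add_nonneg τ κ σ z.norm_lt_one
  rwa [Complex.add_re, Complex.re_ofReal_mul] at hκ

theorem berksonPorta_mem_genClass {τ : ℂ} (hτ : ‖τ‖ ≤ 1) {n : ℕ} {σ : Fin n → UnitCircle}
    {Λ : Fin n → ℝ} (hσ : ∀ k, τ ≠ σ k) {β : ℝ} {ν : Measure UnitCircle} [IsFiniteMeasure ν]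
    (h : ∀ k, IsRegularNullPoint β ν (σ k) ∧ angularSlope ν (σ k) ≤ -Λ k / ‖τ - σ k‖ ^ 2) :
    berksonPorta τ β ν ∈ GenClass τ σ Λ := by
  obtain ⟨φ, hφ, hG⟩ := exists_semigroup
    ((differentiable_dwFactor τ).differentiableOn.mul (differentiableOn_herglotz β ν))
    (isDissipative_dwFactor_mul_herglotz τ β ν)
  refine ⟨φ, hφ, hG, isSemigroupDWPoint_of_berksonPorta hτ hφ hG, fun k => ?_⟩
  obtain ⟨hnull, hle⟩ := h k
  refine ⟨-‖τ - σ k‖ ^ 2 * angularSlope ν (σ k), ?_, ?_, fun t ht => ?_, ?_⟩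
  · have hpos : 0 < ‖τ - σ k‖ ^ 2 := pow_pos (norm_pos_iff.2 (sub_ne_zero.2 (hσ k))) 2
    rw [le_div_iff₀ hpos] at hle
    linarith
  · have hslope : 0 ≤ angularSlope ν (σ k) :=
      mul_nonneg zero_le_two (integral_nonneg fun κ => by positivity)
    rw [neg_mul, neg_nonpos]
    positivity
  · obtain ⟨m, -, hderiv⟩ := exists_hasBoundaryFixedPointDeriv hφ hG (σ k)
      (fun z => hnull.neg_mul_re_cayley_le τ z) ht
    exact ⟨_, hderiv⟩
  · rw [Complex.ofReal_mul]
    exact (hasAngularLimit_conj_mul_dwFactor.mul hnull.hasAngularLimit).congr fun z =>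
      (berksonPorta_div z).symm

theorem mem_genClass_iff {τ : ℂ} (hτ : ‖τ‖ ≤ 1) {n : ℕ} {σ : Fin n → UnitCircle} {Λ : Fin n → ℝ}
    (hσ : ∀ k, τ ≠ σ k) {G : 𝔻 → ℂ} :
    G ∈ GenClass τ σ Λ ↔ ∃ (β : ℝ) (ν : Measure UnitCircle), IsFiniteMeasure ν ∧
      G = berksonPorta τ β ν ∧
      ∀ k, IsRegularNullPoint β ν (σ k) ∧ angularSlope ν (σ k) ≤ -Λ k / ‖τ - σ k‖ ^ 2 := by
  refine ⟨exists_isRegularNullPoint_of_mem_genClass hτ hσ, ?_⟩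
  rintro ⟨β, ν, hν, rfl, h⟩
  exact berksonPorta_mem_genClass hτ hσ h

/-! ### The representation for a single boundary point -/

lemma integral_withDensity_ofReal {X E : Type*} [MeasurableSpace X] [NormedAddCommGroup E]
    [NormedSpace ℝ E] {ν : Measure X} {ρ : X → ℝ} (hρ : Measurable ρ) (h0 : ∀ x, 0 ≤ ρ x)
    (f : X → E) :
    ∫ x, f x ∂(ν.withDensity fun x => ENNReal.ofReal (ρ x)) = ∫ x, ρ x • f x ∂ν := by
  rw [integral_withDensity_eq_integral_toReal_smul hρ.ennreal_ofReal
    (Eventually.of_forall fun _ => ENNReal.ofReal_lt_top)]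
  simp only [ENNReal.toReal_ofReal (h0 _)]

lemma integrable_withDensity_ofReal_iff {X E : Type*} [MeasurableSpace X] [NormedAddCommGroup E]
    [NormedSpace ℝ E] {ν : Measure X} {ρ : X → ℝ} (hρ : Measurable ρ) (h0 : ∀ x, 0 ≤ ρ x)
    {f : X → E} :
    Integrable f (ν.withDensity fun x => ENNReal.ofReal (ρ x)) ↔
      Integrable (fun x => ρ x • f x) ν := by
  rw [integrable_withDensity_iff_integrable_smul' hρ.ennreal_ofReal
    (Eventually.of_forall fun _ => ENNReal.ofReal_lt_top)]
  simp only [ENNReal.toReal_ofReal (h0 _)]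

/-- The missing mass is placed at a zero of the integrands. -/
lemma exists_isProbabilityMeasure_integral_eq {X : Type*} (E : Type*) [MeasurableSpace X]
    [MeasurableSingletonClass X] [NormedAddCommGroup E] [NormedSpace ℝ E] [CompleteSpace E]
    {μ : Measure X} (h : μ Set.univ ≤ 1) (a : X) :
    ∃ μ' : Measure X, IsProbabilityMeasure μ' ∧
      ∀ f : X → E, f a = 0 → ∫ x, f x ∂μ' = ∫ x, f x ∂μ := by
  have hdirac (f : X → E) : Integrable f ((1 - μ Set.univ) • Measure.dirac a) :=
    (integrable_dirac enorm_lt_top).smul_measure (ENNReal.sub_ne_top ENNReal.one_ne_top)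
  refine ⟨μ + (1 - μ Set.univ) • Measure.dirac a, ⟨?_⟩, fun f hf => ?_⟩
  · rw [Measure.add_apply, Measure.smul_apply, Measure.dirac_apply_of_mem (Set.mem_univ a),
      smul_eq_mul, mul_one, add_tsub_cancel_of_le h]
  · by_cases hint : Integrable f μ
    · rw [integral_add_measure hint (hdirac f), integral_smul_measure, integral_dirac, hf,
        smul_zero, add_zero]
    · rw [integral_undef hint, integral_undef fun h' => hint h'.left_of_add_measure]

section SinglePoint

variable (σ : UnitCircle)

/-- The reflection `κ ↦ σ κ̄` of the circle, which exchanges the kernels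
`(1 - κ̄ σ) / (1 - κ̄ z)` and `(1 - κ) / (1 - κ σ̄ z)`. -/
noncomputable def circleReflection : UnitCircle ≃ᵐ UnitCircle :=
  .ofInvolutive (fun κ => ⟨σ * conj (κ : ℂ), by simp⟩)
    (fun κ => Subtype.ext (by simp [σ.conj_coe, mul_inv_cancel_left₀ σ.coe_ne_zero]))
    (by fun_prop)

lemma integral_map_circleReflection (μ : Measure UnitCircle) (z : ℂ) :
    ∫ κ : UnitCircle, (1 - conj (κ : ℂ) * σ) / (1 - conj (κ : ℂ) * z) ∂μ.map (circleReflection σ)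
      = ∫ κ : UnitCircle, (1 - (κ : ℂ)) / (1 - (κ : ℂ) * conj (σ : ℂ) * z) ∂μ := by
  have hconj (κ : UnitCircle) : conj (circleReflection σ κ : ℂ) = κ * conj (σ : ℂ) := by
    change conj (σ * conj (κ : ℂ)) = _
    rw [map_mul, Complex.conj_conj, mul_comm]
  rw [integral_map_equiv]
  simp only [hconj, mul_assoc, σ.conj_mul_coe, mul_one]

lemma exists_integral_slopeKernel_eq {ν : Measure UnitCircle}
    (hint : Integrable (fun κ : UnitCircle => (‖(κ : ℂ) - σ‖ ^ 2)⁻¹) ν) {c : ℝ} (hc : 0 < c)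
    (hle : angularSlope ν σ ≤ c) :
    ∃ μ : Measure UnitCircle, IsProbabilityMeasure μ ∧ ∀ z : ℂ,
      ∫ κ, slopeKernel σ κ z ∂ν
        = c * ∫ κ : UnitCircle, (1 - conj (κ : ℂ) * σ) / (1 - conj (κ : ℂ) * z) ∂μ := by
  set ρ : UnitCircle → ℝ := fun κ => 2 / c * (‖(κ : ℂ) - σ‖ ^ 2)⁻¹ with hρ
  have hρ0 (κ : UnitCircle) : 0 ≤ ρ κ := by positivity
  have hmass : (ν.withDensity fun κ => ENNReal.ofReal (ρ κ)) Set.univ ≤ 1 := by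
    rw [withDensity_apply _ MeasurableSet.univ, Measure.restrict_univ,
      ← ofReal_integral_eq_lintegral_ofReal (hint.const_mul _) (Eventually.of_forall hρ0),
      ENNReal.ofReal_le_one, integral_const_mul, div_mul_eq_mul_div]
    exact div_le_one_of_le₀ hle hc.le
  obtain ⟨μ, hμ, hμint⟩ := exists_isProbabilityMeasure_integral_eq ℂ hmass σ
  refine ⟨μ, hμ, fun z => ?_⟩
  rw [hμint _ (by rw [σ.conj_mul_coe, sub_self, zero_div]),
    integral_withDensity_ofReal (by fun_prop) hρ0, ← integral_const_mul]
  congr 1 with κ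
  rw [slopeKernel, Complex.real_smul, hρ]
  push_cast
  field_simp [Complex.ofReal_ne_zero.2 (ne_of_gt hc)]

/-- The measure `(c / 2) ‖κ - σ‖² dμ(κ)`, whose density cancels the factor `2 ‖κ - σ‖⁻²` of
`slopeKernel` up to the constant `c`. -/
noncomputable def chordMeasure (c : ℝ) (μ : Measure UnitCircle) : Measure UnitCircle :=
  μ.withDensity fun κ => ENNReal.ofReal (c / 2 * ‖(κ : ℂ) - σ‖ ^ 2)

variable {c : ℝ}

lemma chordMeasure_singleton (μ : Measure UnitCircle) : chordMeasure σ c μ {σ} = 0 := by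
  simp [chordMeasure, withDensity_apply]

section Nonneg

variable (hc : 0 ≤ c) (μ : Measure UnitCircle)
include hc

lemma integral_chordMeasure {E : Type*} [NormedAddCommGroup E] [NormedSpace ℝ E]
    (f : UnitCircle → E) :
    ∫ κ, f κ ∂chordMeasure σ c μ = ∫ κ : UnitCircle, (c / 2 * ‖(κ : ℂ) - σ‖ ^ 2) • f κ ∂μ :=
  integral_withDensity_ofReal (by fun_prop) (fun _ => by positivity) f

lemma integral_slopeKernel_chordMeasure (z : ℂ) :
    ∫ κ, slopeKernel σ κ z ∂chordMeasure σ c μ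
      = c * ∫ κ : UnitCircle, (1 - conj (κ : ℂ) * σ) / (1 - conj (κ : ℂ) * z) ∂μ := by
  rw [integral_chordMeasure σ hc, ← integral_const_mul]
  congr 1 with κ
  rcases eq_or_ne κ σ with rfl | hκ
  · simp [κ.conj_mul_coe]
  · have hne : ((‖(κ : ℂ) - σ‖ : ℝ) : ℂ) ≠ 0 :=
      Complex.ofReal_ne_zero.2 (norm_ne_zero_iff.2 (UnitCircle.coe_sub_coe_ne_zero hκ))
    rw [slopeKernel, Complex.real_smul]
    push_cast
    field_simp

lemma chord_density_mul_inv_le (κ : UnitCircle) :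
    (c / 2 * ‖(κ : ℂ) - σ‖ ^ 2) • (‖(κ : ℂ) - σ‖ ^ 2)⁻¹ ≤ c / 2 := by
  rw [smul_eq_mul, mul_assoc]
  exact mul_le_of_le_one_right (by positivity) mul_inv_le_one

lemma integrable_chord_density_mul_inv [IsFiniteMeasure μ] :
    Integrable (fun κ : UnitCircle =>
      (c / 2 * ‖(κ : ℂ) - σ‖ ^ 2) • (‖(κ : ℂ) - σ‖ ^ 2)⁻¹) μ :=
  .of_bound (Measurable.aestronglyMeasurable (by fun_prop)) (c / 2) (Eventually.of_forall
    fun κ => by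
      rw [Real.norm_of_nonneg (smul_nonneg (by positivity) (by positivity))]
      exact chord_density_mul_inv_le σ hc κ)

lemma integrable_chordMeasure [IsFiniteMeasure μ] :
    Integrable (fun κ : UnitCircle => (‖(κ : ℂ) - σ‖ ^ 2)⁻¹) (chordMeasure σ c μ) :=
  (integrable_withDensity_ofReal_iff (by fun_prop) fun _ => by positivity).2
    (integrable_chord_density_mul_inv σ hc μ)

lemma angularSlope_chordMeasure_le [IsProbabilityMeasure μ] :
    angularSlope (chordMeasure σ c μ) σ ≤ c := by
  have h := integral_mono (integrable_chord_density_mul_inv σ hc μ) (integrable_const (c / 2))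
    (chord_density_mul_inv_le σ hc)
  rw [integral_const, probReal_univ, one_smul] at h
  rw [angularSlope, integral_chordMeasure σ hc]
  linarith

end Nonneg

instance (μ : Measure UnitCircle) [IsFiniteMeasure μ] : IsFiniteMeasure (chordMeasure σ c μ) :=
  isFiniteMeasure_withDensity_ofReal (Continuous.integrable_of_hasCompactSupport (by fun_prop)
    (HasCompactSupport.of_compactSpace _)).2

lemma re_cayley_coe_coe (κ : UnitCircle) : (cayley κ σ).re = 0 := by
  rw [re_cayley, κ.norm_coe, σ.norm_coe, sub_self, zero_div]

lemma exists_isRegularNullPoint {ν : Measure UnitCircle} [IsFiniteMeasure ν] (h0 : ν {σ} = 0)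
    (hint : Integrable (fun κ : UnitCircle => (‖(κ : ℂ) - σ‖ ^ 2)⁻¹) ν) :
    ∃ β : ℝ, IsRegularNullPoint β ν σ := by
  have hre : (∫ κ : UnitCircle, cayley κ σ ∂ν).re = 0 := by
    have h := integral_re (integrable_cayley_coe_coe hint)
    simp only [RCLike.re_to_complex, re_cayley_coe_coe, integral_zero] at h
    exact h.symm
  refine ⟨-(∫ κ : UnitCircle, cayley κ σ ∂ν).im, h0, hint, ?_⟩
  apply Complex.ext <;> simp [herglotz, hre]

theorem mem_genClass_single_iff {τ : ℂ} (hτ : ‖τ‖ ≤ 1) (hσ : τ ≠ σ) {l : ℝ} (hl : l < 0)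
    {G : 𝔻 → ℂ} :
    G ∈ GenClass τ (fun _ : Fin 1 => σ) (fun _ : Fin 1 => l) ↔
      ∃ μ : Measure UnitCircle, IsProbabilityMeasure μ ∧
        ∀ z : 𝔻, G z = ((|l| / ‖(σ : ℂ) - τ‖ ^ 2 : ℝ) : ℂ) * (τ - (z : ℂ)) *
          (1 - conj τ * (z : ℂ)) * (1 - conj (σ : ℂ) * (z : ℂ)) *
            ∫ κ : UnitCircle, (1 - (κ : ℂ)) / (1 - (κ : ℂ) * conj (σ : ℂ) * (z : ℂ)) ∂μ := by
  have hc : 0 < |l| / ‖(σ : ℂ) - τ‖ ^ 2 :=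
    div_pos (abs_pos.2 hl.ne) (pow_pos (norm_pos_iff.2 (sub_ne_zero.2 hσ.symm)) 2)
  rw [mem_genClass_iff hτ fun _ => hσ, ← abs_of_neg hl, norm_sub_rev τ]
  constructor
  · rintro ⟨β, ν, hν, rfl, h⟩
    obtain ⟨hnull, hle⟩ := h 0
    obtain ⟨μ, hμ, hkernel⟩ := exists_integral_slopeKernel_eq σ hnull.integrable hc hle
    refine ⟨μ.map (circleReflection σ).symm,
      Measure.isProbabilityMeasure_map (circleReflection σ).symm.measurable.aemeasurable,
      fun z => ?_⟩
    rw [← integral_map_circleReflection, MeasurableEquiv.map_map_symm, berksonPorta, dwFactor,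
      hnull.herglotz_eq z.norm_lt_one, hkernel]
    ring
  · rintro ⟨μ, hμ, hG⟩
    set μ' := μ.map (circleReflection σ)
    have hμ' : IsProbabilityMeasure μ' :=
      Measure.isProbabilityMeasure_map (circleReflection σ).measurable.aemeasurable
    obtain ⟨β, hnull⟩ := exists_isRegularNullPoint σ (chordMeasure_singleton σ μ')
      (integrable_chordMeasure σ hc.le μ')
    refine ⟨β, _, inferInstance, funext fun z => ?_, fun _ =>
      ⟨hnull, angularSlope_chordMeasure_le σ hc.le μ'⟩⟩
    rw [hG, ← integral_map_circleReflection, berksonPorta, dwFactor,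
      hnull.herglotz_eq z.norm_lt_one, integral_slopeKernel_chordMeasure σ hc.le]
    ring

end SinglePoint

/-! ### Uniqueness of the Herglotz measure -/

namespace UnitCircle

lemma coe_pow_mul_conj_pow (κ : UnitCircle) {l m : ℕ} (h : l ≤ m) :
    (κ : ℂ) ^ m * conj (κ : ℂ) ^ l = (κ : ℂ) ^ (m - l) := by
  rw [← Nat.sub_add_cancel h, pow_add, mul_assoc, ← mul_pow, mul_comm (κ : ℂ) (conj _),
    κ.conj_mul_coe, one_pow, mul_one, Nat.add_sub_cancel]

lemma integrable_of_continuous {E : Type*} [NormedAddCommGroup E] {f : UnitCircle → E}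
    (hf : Continuous f) (ν : Measure UnitCircle) [IsFiniteMeasure ν] : Integrable f ν :=
  hf.integrable_of_hasCompactSupport (HasCompactSupport.of_compactSpace _)

section Moments

variable {ν ν' : Measure UnitCircle}
  (h : ∀ m : ℕ, ∫ κ : UnitCircle, conj (κ : ℂ) ^ m ∂ν = ∫ κ : UnitCircle, conj (κ : ℂ) ^ m ∂ν')
include h

lemma integral_coe_pow_mul_conj_pow_eq (m l : ℕ) :
    ∫ κ : UnitCircle, (κ : ℂ) ^ m * conj (κ : ℂ) ^ l ∂ν
      = ∫ κ : UnitCircle, (κ : ℂ) ^ m * conj (κ : ℂ) ^ l ∂ν' := by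
  rcases le_total l m with hlm | hml
  · have hconj := congrArg conj (h (m - l))
    rw [← integral_conj, ← integral_conj] at hconj
    simpa only [coe_pow_mul_conj_pow _ hlm, map_pow, Complex.conj_conj] using hconj
  · have hmul (κ : UnitCircle) : (κ : ℂ) ^ m * conj (κ : ℂ) ^ l = conj (κ : ℂ) ^ (l - m) := by
      simpa only [map_mul, map_pow, Complex.conj_conj, mul_comm]
        using congrArg conj (coe_pow_mul_conj_pow κ hml)
    simp only [hmul, h]

/-- Trigonometric polynomials form a subalgebra of `C(∂𝔻)` which separates points. -/
theorem measure_ext_of_moments [IsFiniteMeasure ν] [IsFiniteMeasure ν'] : ν = ν' := by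
  let f : BoundedContinuousFunction UnitCircle ℂ :=
    .mkOfCompact ⟨fun κ => (κ : ℂ), continuous_subtype_val⟩
  refine ext_of_forall_mem_subalgebra_integral_eq_of_polish (𝕜 := ℂ)
    (A := StarAlgebra.adjoin ℂ {f}) (fun x y hxy => ?_) fun g hg => ?_
  · exact ⟨_, ⟨_, ⟨f, StarAlgebra.self_mem_adjoin_singleton ℂ f, rfl⟩, rfl⟩,
      fun h => hxy (Subtype.ext h)⟩
  have hspan : g ∈ Submodule.span ℂ (Submonoid.closure ({f, star f} : Set _) : Set _) := by
    rw [Set.insert_eq, ← Set.star_singleton, ← Algebra.adjoin_eq_span,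
      ← StarAlgebra.adjoin_toSubalgebra]
    exact hg
  clear hg
  induction hspan using Submodule.span_induction with
  | mem g hg =>
    obtain ⟨m, l, rfl⟩ := (Submonoid.mem_closure_pair _ _ _).1 hg
    exact integral_coe_pow_mul_conj_pow_eq h m l
  | zero => simp
  | add u v _ _ hu hv =>
    simp only [BoundedContinuousFunction.coe_add, Pi.add_apply]
    rw [integral_add (integrable_of_continuous u.continuous ν)
      (integrable_of_continuous v.continuous ν), integral_add
      (integrable_of_continuous u.continuous ν') (integrable_of_continuous v.continuous ν'),
      hu, hv]
  | smul a u _ hu =>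
    simp only [BoundedContinuousFunction.coe_smul]
    rw [integral_smul, integral_smul, hu]

end Moments

end UnitCircle

lemma hasSum_integral_inv_one_sub_conj_mul (ν : Measure UnitCircle) [IsFiniteMeasure ν] {z : ℂ}
    (hz : ‖z‖ < 1) :
    HasSum (fun m => z ^ m * ∫ κ : UnitCircle, conj (κ : ℂ) ^ m ∂ν)
      (∫ κ : UnitCircle, (1 - conj (κ : ℂ) * z)⁻¹ ∂ν) := by
  have hnorm (κ : UnitCircle) : ‖conj (κ : ℂ) * z‖ = ‖z‖ := by
    rw [norm_mul, RCLike.norm_conj, κ.norm_coe, one_mul]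
  have hsum : Summable fun m : ℕ => ∫ κ : UnitCircle, ‖(conj (κ : ℂ) * z) ^ m‖ ∂ν := by
    simp only [norm_pow, hnorm, integral_const, smul_eq_mul]
    exact (summable_geometric_of_lt_one (norm_nonneg z) hz).mul_left _
  have h := hasSum_integral_of_summable_integral_norm
    (fun m => UnitCircle.integrable_of_continuous (by fun_prop) ν) hsum
  simp only [tsum_geometric_of_norm_lt_one ((hnorm _).trans_lt hz)] at h
  simpa only [← integral_const_mul, ← mul_pow, mul_comm z] using h

theorem integral_conj_pow_eq_of_eventuallyEq {ν ν' : Measure UnitCircle} [IsFiniteMeasure ν]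
    [IsFiniteMeasure ν']
    (h : (fun z : ℂ => ∫ κ : UnitCircle, (1 - conj (κ : ℂ) * z)⁻¹ ∂ν) =ᶠ[𝓝 0]
      fun z : ℂ => ∫ κ : UnitCircle, (1 - conj (κ : ℂ) * z)⁻¹ ∂ν') (m : ℕ) :
    ∫ κ : UnitCircle, conj (κ : ℂ) ^ m ∂ν = ∫ κ : UnitCircle, conj (κ : ℂ) ^ m ∂ν' := by
  let p (μ : Measure UnitCircle) : FormalMultilinearSeries ℂ ℂ ℂ := fun m =>
    ContinuousMultilinearMap.mkPiRing ℂ (Fin m) (∫ κ : UnitCircle, conj (κ : ℂ) ^ m ∂μ)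
  have hseries (μ : Measure UnitCircle) [IsFiniteMeasure μ] :
      HasFPowerSeriesAt (fun z : ℂ => ∫ κ : UnitCircle, (1 - conj (κ : ℂ) * z)⁻¹ ∂μ) (p μ) 0 := by
    rw [hasFPowerSeriesAt_iff]
    filter_upwards [Metric.ball_mem_nhds (0 : ℂ) one_pos] with z hz
    simpa [p, FormalMultilinearSeries.coeff] using
      hasSum_integral_inv_one_sub_conj_mul μ (mem_ball_zero_iff.1 hz)
  simpa [p, FormalMultilinearSeries.coeff] using congrArg (fun q => q.coeff m)
    ((hseries ν).eq_formalMultilinearSeries_of_eventually (hseries ν') h)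

lemma herglotz_eq_sub_add_integral (β : ℝ) (ν : Measure UnitCircle) [IsFiniteMeasure ν] {z : ℂ}
    (hz : ‖z‖ < 1) :
    herglotz β ν z = Complex.I * β - ν.real Set.univ +
      2 * ∫ κ : UnitCircle, (1 - conj (κ : ℂ) * z)⁻¹ ∂ν := by
  have hint : Integrable (fun κ : UnitCircle => (1 - conj (κ : ℂ) * z)⁻¹) ν :=
    UnitCircle.integrable_of_continuous
      (Continuous.inv₀ (by fun_prop) fun κ => one_sub_conj_mul_ne_zero κ.norm_coe.le hz) ν
  have hcayley (κ : UnitCircle) : cayley κ z = 2 * (1 - conj (κ : ℂ) * z)⁻¹ - 1 := by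
    have hκz := κ.coe_sub_ne_zero hz
    rw [cayley, κ.one_sub_conj_mul, κ.conj_coe]
    field_simp
    ring
  simp only [herglotz, hcayley]
  rw [integral_sub (hint.const_mul 2) (integrable_const 1), integral_const_mul]
  simp only [integral_const, Complex.real_smul, mul_one]
  ring

/-- A punctured neighbourhood suffices, by continuity; this allows division by `dwFactor`. -/
theorem measure_eq_of_herglotz_eventuallyEq {β β' : ℝ} {ν ν' : Measure UnitCircle}
    [IsFiniteMeasure ν] [IsFiniteMeasure ν']
    (h : herglotz β ν =ᶠ[𝓝[≠] 0] herglotz β' ν') : ν = ν' := by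
  have hcont (b : ℝ) (μ : Measure UnitCircle) [IsFiniteMeasure μ] : ContinuousAt (herglotz b μ) 0 :=
    (hasDerivAt_herglotz b μ (by simp)).continuousAt
  have hnhds := ((hcont β ν).eventuallyEq_nhds_iff_eventuallyEq_nhdsNE (hcont β' ν')).1 h
  have hzero := hnhds.self_of_nhds
  simp only [herglotz, cayley, add_zero, sub_zero, div_self (UnitCircle.coe_ne_zero _),
    integral_const, Complex.real_smul, mul_one] at hzero
  obtain ⟨hmass, hβ⟩ := Complex.ext_iff.1 hzero
  simp only [Complex.add_re, Complex.mul_re, Complex.I_re, Complex.ofReal_re, zero_mul,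
    Complex.I_im, Complex.ofReal_im, mul_zero, sub_self, zero_add, Complex.add_im, Complex.mul_im,
    one_mul, add_zero] at hmass hβ
  refine UnitCircle.measure_ext_of_moments (integral_conj_pow_eq_of_eventuallyEq ?_)
  filter_upwards [hnhds, Metric.ball_mem_nhds (0 : ℂ) one_pos] with z hz hz1
  rw [mem_ball_zero_iff] at hz1
  rw [herglotz_eq_sub_add_integral β ν hz1, herglotz_eq_sub_add_integral β' ν' hz1, hβ] at hz
  rw [hmass] at hz
  linear_combination hz / 2

/-! ### Extreme points have finitely supported Herglotz measures -/

lemma card_ne_of_subset_support {X : Type*} [TopologicalSpace X] [T2Space X] [MeasurableSpace X]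
    [OpensMeasurableSpace X] {ν : Measure X} {m : ℕ}
    (h : ∀ A : Fin m → Set X, (∀ j, MeasurableSet (A j)) → Pairwise (Function.onFun Disjoint A) →
      ∃ j, ν (A j) = 0) {T : Finset X} (hT : (T : Set X) ⊆ ν.support) : T.card ≠ m := by
  rintro rfl
  obtain ⟨U, hU, hd⟩ := T.finite_toSet.t2_separation
  let e := T.equivFin.symm
  obtain ⟨j, hj⟩ := h (fun j => U (e j)) (fun j => (hU _).2.measurableSet) fun i j hij =>
    hd (e i).2 (e j).2 fun heq => hij (e.injective (Subtype.ext heq))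
  exact ((Measure.mem_support_iff_forall _).1 (hT (e j).2) _ ((hU _).2.mem_nhds (hU _).1)).ne' hj

lemma measure_singleton_ne_zero_of_finite_support {X : Type*} [TopologicalSpace X] [T1Space X]
    [HereditarilyLindelofSpace X] [MeasurableSpace X] {ν : Measure X} (hfin : ν.support.Finite)
    {x : X} (hx : x ∈ ν.support) : ν {x} ≠ 0 := by
  intro h0
  have hopen : IsOpen (ν.support \ {x})ᶜ := (hfin.subset Set.sdiff_subset).isClosed.isOpen_compl
  have hpos := (Measure.mem_support_iff_forall _).1 hx _ (hopen.mem_nhds (by simp))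
  refine hpos.ne' (measure_mono_null (t := {x} ∪ ν.supportᶜ) (fun y hy => ?_)
    (measure_union_null h0 Measure.measure_compl_support))
  by_cases hyx : y = x
  · exact Or.inl hyx
  · exact Or.inr fun hy' => hy ⟨hy', hyx⟩

lemma exists_finset_of_disjoint_null {X : Type*} [TopologicalSpace X] [T2Space X]
    [HereditarilyLindelofSpace X] [MeasurableSpace X] [OpensMeasurableSpace X] (ν : Measure X)
    {m : ℕ} (h : ∀ A : Fin m → Set X, (∀ j, MeasurableSet (A j)) →
      Pairwise (Function.onFun Disjoint A) → ∃ j, ν (A j) = 0) :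
    ∃ S : Finset X, S.card < m ∧ ν (S : Set X)ᶜ = 0 ∧ ∀ x ∈ S, ν {x} ≠ 0 := by
  have hfin : ν.support.Finite := by
    by_contra hinf
    obtain ⟨T, hT, hcard⟩ := Set.Infinite.exists_subset_card_eq hinf m
    exact card_ne_of_subset_support h hT hcard
  refine ⟨hfin.toFinset, ?_, by simp, fun x hx =>
    measure_singleton_ne_zero_of_finite_support hfin (hfin.mem_toFinset.1 hx)⟩
  by_contra! hle
  obtain ⟨T, hT, hcard⟩ := Finset.exists_subset_card_eq hle
  exact card_ne_of_subset_support h (fun x hx => hfin.mem_toFinset.1 (hT hx)) hcard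

/-- The measure `(1 + ε h) ν`; perturbing the Herglotz measure of a generator in the two directions
`±ε` tests whether the generator is an extreme point. -/
noncomputable def perturbedMeasure {X : Type*} [MeasurableSpace X] (ν : Measure X) (h : X → ℝ)
    (ε : ℝ) : Measure X :=
  ν.withDensity fun x => ENNReal.ofReal (1 + ε * h x)

section PerturbedMeasure

variable {X E : Type*} [MeasurableSpace X] [NormedAddCommGroup E] [NormedSpace ℝ E]
  {ν : Measure X} {h : X → ℝ} {C ε : ℝ} {f : X → E}

lemma integrable_smul_of_abs_le (hm : Measurable h) (hC : ∀ x, |h x| ≤ C) (hf : Integrable f ν) :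
    Integrable (fun x => h x • f x) ν :=
  hf.bdd_smul C hm.aestronglyMeasurable (Eventually.of_forall hC)

lemma isFiniteMeasure_perturbedMeasure [IsFiniteMeasure ν] (hm : Measurable h)
    (hC : ∀ x, |h x| ≤ C) (ε : ℝ) : IsFiniteMeasure (perturbedMeasure ν h ε) := by
  have hint := integrable_smul_of_abs_le hm hC (integrable_const (μ := ν) (1 : ℝ))
  simp only [smul_eq_mul, mul_one] at hint
  exact isFiniteMeasure_withDensity_ofReal ((integrable_const 1).add (hint.const_mul ε)).2

lemma integrable_perturbedMeasure (hm : Measurable h) (hC : ∀ x, |h x| ≤ C)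
    (hε : ∀ x, 0 ≤ 1 + ε * h x) (hf : Integrable f ν) :
    Integrable f (perturbedMeasure ν h ε) := by
  rw [perturbedMeasure, integrable_withDensity_ofReal_iff (by fun_prop) hε]
  simp only [add_smul, one_smul, mul_smul]
  exact hf.add ((integrable_smul_of_abs_le hm hC hf).smul ε)

lemma integral_perturbedMeasure (hm : Measurable h) (hC : ∀ x, |h x| ≤ C)
    (hε : ∀ x, 0 ≤ 1 + ε * h x) (hf : Integrable f ν) :
    ∫ x, f x ∂(perturbedMeasure ν h ε) = ∫ x, f x ∂ν + ε • ∫ x, h x • f x ∂ν := by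
  rw [perturbedMeasure, integral_withDensity_ofReal (by fun_prop) hε, ← integral_smul]
  simp only [add_smul, one_smul, mul_smul]
  exact integral_add hf ((integrable_smul_of_abs_le hm hC hf).smul ε)

lemma ae_eq_zero_of_perturbedMeasure_eq [IsFiniteMeasure ν] (hm : Measurable h) (hε : ε ≠ 0)
    (heq : perturbedMeasure ν h ε = ν) : h =ᵐ[ν] 0 := by
  have hmass : ∫⁻ x, ENNReal.ofReal (1 + ε * h x) ∂ν ≠ ⊤ := by
    rw [← setLIntegral_univ, ← withDensity_apply _ MeasurableSet.univ, ← perturbedMeasure, heq]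
    exact measure_ne_top ν _
  have hdensity := heq.trans withDensity_one.symm
  rw [perturbedMeasure,
    withDensity_eq_iff (by fun_prop) measurable_one.aemeasurable hmass] at hdensity
  filter_upwards [hdensity] with x hx
  rw [Pi.one_apply, ENNReal.ofReal_eq_one, add_eq_left] at hx
  exact (mul_eq_zero.1 hx).resolve_left hε

end PerturbedMeasure

lemma eventually_forall_nonneg_one_add_mul {X : Type*} {h : X → ℝ} {C : ℝ}
    (hC : ∀ x, |h x| ≤ C) : ∀ᶠ ε in 𝓝 (0 : ℝ), ∀ x, 0 ≤ 1 + ε * h x := by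
  have hlim : Tendsto (fun ε : ℝ => |ε| * C) (𝓝 0) (𝓝 0) :=
    Continuous.tendsto' (by fun_prop) _ _ (by simp)
  filter_upwards [hlim.eventually_lt_const one_pos] with ε hε x
  have hle : |ε * h x| ≤ |ε| * C := by
    rw [abs_mul]
    exact mul_le_mul_of_nonneg_left (hC x) (abs_nonneg _)
  linarith [neg_abs_le (ε * h x)]

lemma eventually_add_mul_le {s d c : ℝ} (hs : s ≤ c) (hd : s = c → d = 0) :
    ∀ᶠ ε in 𝓝 (0 : ℝ), s + ε * d ≤ c := by
  rcases hs.eq_or_lt with heq | hlt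
  · exact Eventually.of_forall fun ε => by rw [hd heq, mul_zero, add_zero, heq]
  · have hlim : Tendsto (fun ε : ℝ => s + ε * d) (𝓝 0) (𝓝 s) :=
      Continuous.tendsto' (by fun_prop) _ _ (by simp)
    exact (hlim.eventually_lt_const hlt).mono fun _ => le_of_lt

section Perturbation

variable {β b C ε : ℝ} {ν : Measure UnitCircle} {h : UnitCircle → ℝ} (hm : Measurable h)
  (hC : ∀ κ, |h κ| ≤ C)
include hm hC

lemma herglotz_perturbedMeasure (hε : ∀ κ, 0 ≤ 1 + ε * h κ) {z : ℂ}
    (hi : Integrable (fun κ : UnitCircle => cayley κ z) ν) :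
    herglotz (β + ε * b) (perturbedMeasure ν h ε) z = herglotz β ν z +
      ε * (Complex.I * b + ∫ κ : UnitCircle, h κ • cayley κ z ∂ν) := by
  rw [herglotz, herglotz, integral_perturbedMeasure hm hC hε hi, Complex.real_smul]
  push_cast
  ring

variable [IsFiniteMeasure ν]

lemma berksonPorta_perturbedMeasure (hε : ∀ κ, 0 ≤ 1 + ε * h κ) (τ : ℂ) (z : 𝔻) :
    berksonPorta τ (β + ε * b) (perturbedMeasure ν h ε) z = berksonPorta τ β ν z +
      ε * (dwFactor τ z * (Complex.I * b + ∫ κ : UnitCircle, h κ • cayley κ z ∂ν)) := by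
  rw [berksonPorta, berksonPorta,
    herglotz_perturbedMeasure hm hC hε (integrable_cayley ν z.norm_lt_one)]
  ring

lemma IsRegularNullPoint.perturbedMeasure {σ : UnitCircle} (hnull : IsRegularNullPoint β ν σ)
    (hε : ∀ κ, 0 ≤ 1 + ε * h κ)
    (hb : Complex.I * b + ∫ κ : UnitCircle, h κ • cayley κ σ ∂ν = 0) :
    IsRegularNullPoint (β + ε * b) (perturbedMeasure ν h ε) σ where
  measure_singleton := withDensity_absolutelyContinuous _ _ hnull.measure_singleton
  integrable := integrable_perturbedMeasure hm hC hε hnull.integrable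
  eq_zero := by
    rw [herglotz_perturbedMeasure hm hC hε (integrable_cayley_coe_coe hnull.integrable),
      hnull.eq_zero, hb, mul_zero, add_zero]

lemma eventually_berksonPorta_perturbedMeasure_mem_genClass {τ : ℂ} (hτ : ‖τ‖ ≤ 1) {n : ℕ}
    {σ : Fin n → UnitCircle} {Λ : Fin n → ℝ} (hσ : ∀ k, τ ≠ σ k)
    (hnull : ∀ k, IsRegularNullPoint β ν (σ k) ∧ angularSlope ν (σ k) ≤ -Λ k / ‖τ - σ k‖ ^ 2)
    (hb : ∀ k, Complex.I * b + ∫ κ : UnitCircle, h κ • cayley κ (σ k) ∂ν = 0)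
    (hslope : ∀ k, angularSlope ν (σ k) = -Λ k / ‖τ - σ k‖ ^ 2 →
      ∫ κ : UnitCircle, h κ • (‖(κ : ℂ) - σ k‖ ^ 2)⁻¹ ∂ν = 0) :
    ∀ᶠ ε in 𝓝 (0 : ℝ),
      berksonPorta τ (β + ε * b) (perturbedMeasure ν h ε) ∈ GenClass τ σ Λ := by
  have hle : ∀ᶠ ε in 𝓝 (0 : ℝ), ∀ k, angularSlope ν (σ k) +
      ε * (2 * ∫ κ : UnitCircle, h κ • (‖(κ : ℂ) - σ k‖ ^ 2)⁻¹ ∂ν) ≤ -Λ k / ‖τ - σ k‖ ^ 2 :=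
    eventually_all.2 fun k =>
      eventually_add_mul_le (hnull k).2 fun heq => by rw [hslope k heq, mul_zero]
  filter_upwards [eventually_forall_nonneg_one_add_mul hC, hle] with ε hε hle
  have := isFiniteMeasure_perturbedMeasure (ν := ν) hm hC ε
  refine berksonPorta_mem_genClass hτ hσ fun k =>
    ⟨(hnull k).1.perturbedMeasure hm hC hε (hb k), ?_⟩
  rw [angularSlope, integral_perturbedMeasure hm hC hε (hnull k).1.integrable, mul_add,
    smul_eq_mul, mul_left_comm]
  exact hle k

end Perturbation

lemma measure_eq_of_berksonPorta_eq {τ : ℂ} (hτ : ‖τ‖ ≤ 1) {β β' : ℝ} {ν ν' : Measure UnitCircle}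
    [IsFiniteMeasure ν] [IsFiniteMeasure ν'] (h : berksonPorta τ β ν = berksonPorta τ β' ν') :
    ν = ν' := by
  refine measure_eq_of_herglotz_eventuallyEq (β := β) (β' := β') ?_
  have hne : ∀ᶠ z in 𝓝[≠] (0 : ℂ), z ≠ τ := by
    rcases eq_or_ne τ 0 with rfl | h0
    · exact self_mem_nhdsWithin
    · exact nhdsWithin_le_nhds (eventually_ne_nhds h0.symm)
  filter_upwards [hne, nhdsWithin_le_nhds (Metric.ball_mem_nhds 0 one_pos)] with z hzτ hz
  rw [mem_ball_zero_iff] at hz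
  exact mul_left_cancel₀ (dwFactor_ne_zero hτ hz hzτ) (congrFun h (.mk z hz))

theorem ae_eq_zero_of_mem_extremePoints {τ : ℂ} (hτ : ‖τ‖ ≤ 1) {n : ℕ} {σ : Fin n → UnitCircle}
    {Λ : Fin n → ℝ} (hσ : ∀ k, τ ≠ σ k) {β b C : ℝ} {ν : Measure UnitCircle} [IsFiniteMeasure ν]
    (hext : berksonPorta τ β ν ∈ (GenClass τ σ Λ).extremePoints ℝ)
    (hnull : ∀ k, IsRegularNullPoint β ν (σ k) ∧ angularSlope ν (σ k) ≤ -Λ k / ‖τ - σ k‖ ^ 2)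
    {h : UnitCircle → ℝ} (hm : Measurable h) (hC : ∀ κ, |h κ| ≤ C)
    (hb : ∀ k, Complex.I * b + ∫ κ : UnitCircle, h κ • cayley κ (σ k) ∂ν = 0)
    (hslope : ∀ k, angularSlope ν (σ k) = -Λ k / ‖τ - σ k‖ ^ 2 →
      ∫ κ : UnitCircle, h κ • (‖(κ : ℂ) - σ k‖ ^ 2)⁻¹ ∂ν = 0) :
    h =ᵐ[ν] 0 := by
  have hgood := (eventually_forall_nonneg_one_add_mul hC).and
    (eventually_berksonPorta_perturbedMeasure_mem_genClass hm hC hτ hσ hnull hb hslope)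
  have hneg : Tendsto (fun ε : ℝ => -ε) (𝓝 0) (𝓝 0) :=
    Continuous.tendsto' continuous_neg _ _ neg_zero
  obtain ⟨ε, ⟨⟨hε, hmem⟩, hε', hmem'⟩, hpos⟩ := (((hgood.and (hneg.eventually hgood)).filter_mono
    (nhdsWithin_le_nhds (s := Set.Ioi 0))).and self_mem_nhdsWithin).exists
  have hmid : berksonPorta τ β ν ∈ openSegment ℝ
      (berksonPorta τ (β + ε * b) (perturbedMeasure ν h ε))
      (berksonPorta τ (β + -ε * b) (perturbedMeasure ν h (-ε))) := by
    refine ⟨1 / 2, 1 / 2, by norm_num, by norm_num, by norm_num, funext fun z => ?_⟩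
    simp only [Pi.add_apply, Pi.smul_apply, Complex.real_smul,
      berksonPorta_perturbedMeasure hm hC hε, berksonPorta_perturbedMeasure hm hC hε']
    push_cast
    ring
  have heq := ((mem_extremePoints.1 hext).2 _ hmem _ hmem' hmid).1
  have := isFiniteMeasure_perturbedMeasure (ν := ν) hm hC ε
  exact ae_eq_zero_of_perturbedMeasure_eq hm (ne_of_gt hpos) (measure_eq_of_berksonPorta_eq hτ heq)

/-- The combination of the indicator functions of the sets `A j` with coefficients `c j`, a
direction of perturbation for a Herglotz measure. -/
noncomputable def stepFunction {X ι : Type*} [Fintype ι] (A : ι → Set X) (c : ι → ℝ) (x : X) : ℝ :=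
  ∑ j, (A j).indicator (fun _ => c j) x

section StepFunction

variable {X ι : Type*} [Fintype ι] {A : ι → Set X} (c : ι → ℝ)

lemma abs_stepFunction_le (x : X) : |stepFunction A c x| ≤ ∑ j, |c j| :=
  (Finset.abs_sum_le_sum_abs _ _).trans (Finset.sum_le_sum fun j _ => by
    by_cases hx : x ∈ A j <;> simp [hx])

lemma stepFunction_of_mem (hd : Pairwise (Function.onFun Disjoint A)) {j : ι} {x : X}
    (hx : x ∈ A j) : stepFunction A c x = c j := by
  rw [stepFunction, Fintype.sum_eq_single j, Set.indicator_of_mem hx]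
  exact fun i hij => Set.indicator_of_notMem (Set.disjoint_right.1 (hd hij) hx) _

lemma stepFunction_smul {E : Type*} [AddCommGroup E] [Module ℝ E] (f : X → E) (x : X) :
    stepFunction A c x • f x = ∑ j, c j • (A j).indicator f x := by
  rw [stepFunction, Finset.sum_smul]
  exact Finset.sum_congr rfl fun j _ => by by_cases hx : x ∈ A j <;> simp [hx]

variable [MeasurableSpace X] (hA : ∀ j, MeasurableSet (A j))
include hA

lemma measurable_stepFunction : Measurable (stepFunction A c) :=
  Finset.measurable_fun_sum _ fun j _ => measurable_const.indicator (hA j)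

lemma integral_stepFunction_smul {E : Type*} [NormedAddCommGroup E] [NormedSpace ℝ E]
    {ν : Measure X} {f : X → E} (hf : Integrable f ν) :
    ∫ x, stepFunction A c x • f x ∂ν = ∑ j, c j • ∫ x in A j, f x ∂ν := by
  simp only [stepFunction_smul]
  rw [integral_finsetSum Finset.univ (f := fun j x => c j • (A j).indicator f x)
    fun j _ => (hf.indicator (hA j)).smul (c j)]
  simp only [integral_smul, integral_indicator (hA _)]

end StepFunction

lemma exists_ne_zero_sum_mul_eq_zero {ι κ : Type*} [Fintype ι] [Nonempty ι] [Fintype κ]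
    (J : Finset ι) (hκ : Fintype.card κ = Fintype.card ι + J.card) (B W : ι → κ → ℝ) :
    ∃ c : κ → ℝ, c ≠ 0 ∧ ∃ b : ℝ, (∀ k, b + ∑ j, c j * B k j = 0) ∧
      ∀ k ∈ J, ∑ j, c j * W k j = 0 := by
  let Φ : ((κ → ℝ) × ℝ) →ₗ[ℝ] (ι → ℝ) × (J → ℝ) :=
    { toFun x := (fun k => x.2 + ∑ j, x.1 j * B k j, fun k => ∑ j, x.1 j * W k j)
      map_add' x y := by
        ext k <;> simp only [Prod.fst_add, Prod.snd_add, Pi.add_apply, add_mul,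
          Finset.sum_add_distrib]
        ring
      map_smul' a x := by
        ext k <;> simp [Finset.mul_sum, mul_assoc, mul_add] }
  have hker : LinearMap.ker Φ ≠ ⊥ := LinearMap.ker_ne_bot_of_finrank_lt (by simp [hκ])
  obtain ⟨⟨c, b⟩, hΦ, hne⟩ := (Submodule.ne_bot_iff _).1 hker
  rw [LinearMap.mem_ker] at hΦ
  have hB : ∀ k, b + ∑ j, c j * B k j = 0 := congrFun (congrArg Prod.fst hΦ)
  refine ⟨c, ?_, b, hB, fun k hk => congrFun (congrArg Prod.snd hΦ) ⟨k, hk⟩⟩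
  rintro rfl
  have hb : b = 0 := by simpa using hB (Classical.arbitrary ι)
  exact hne (by rw [hb]; rfl)

lemma re_setIntegral_cayley_coe_coe {ν : Measure UnitCircle} [IsFiniteMeasure ν] {σ : UnitCircle}
    (h : Integrable (fun κ : UnitCircle => (‖(κ : ℂ) - σ‖ ^ 2)⁻¹) ν) (A : Set UnitCircle) :
    (∫ κ in A, cayley (κ : ℂ) σ ∂ν).re = 0 := by
  have hre := integral_re (integrable_cayley_coe_coe h).restrict (μ := ν.restrict A)
  simp only [RCLike.re_to_complex, re_cayley_coe_coe, integral_zero] at hre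
  exact hre.symm

/-- With `m` disjoint sets of positive measure, the perturbations `stepFunction A c` compensated
by a shift `b` of `β` have `m + 1` real parameters, subject to one equation for each null point and
one for each active slope bound. -/
theorem exists_finset_of_mem_extremePoints {τ : ℂ} (hτ : ‖τ‖ ≤ 1) {n : ℕ} [NeZero n]
    {σ : Fin n → UnitCircle} {Λ : Fin n → ℝ} (hσ : ∀ k, τ ≠ σ k) {β : ℝ} {ν : Measure UnitCircle}
    [IsFiniteMeasure ν] (hext : berksonPorta τ β ν ∈ (GenClass τ σ Λ).extremePoints ℝ)
    (hnull : ∀ k, IsRegularNullPoint β ν (σ k) ∧ angularSlope ν (σ k) ≤ -Λ k / ‖τ - σ k‖ ^ 2)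
    {J : Finset (Fin n)} (hJ : ∀ k, angularSlope ν (σ k) = -Λ k / ‖τ - σ k‖ ^ 2 → k ∈ J) :
    ∃ S : Finset UnitCircle, S.card < n + J.card ∧ ν (S : Set UnitCircle)ᶜ = 0 ∧
      ∀ κ ∈ S, ν {κ} ≠ 0 := by
  refine exists_finset_of_disjoint_null ν fun A hA hd => ?_
  obtain ⟨c, hc, b, hb, hslope⟩ := exists_ne_zero_sum_mul_eq_zero J (by simp)
    (fun k j => (∫ κ in A j, cayley (κ : ℂ) (σ k) ∂ν).im)
    (fun k j => ∫ κ in A j, (‖(κ : ℂ) - σ k‖ ^ 2)⁻¹ ∂ν)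
  obtain ⟨j, hj⟩ := Function.ne_iff.1 hc
  have hae : stepFunction A c =ᵐ[ν] 0 := by
    refine ae_eq_zero_of_mem_extremePoints hτ hσ hext hnull (measurable_stepFunction c hA)
      (abs_stepFunction_le c) (b := b) (fun k => ?_) (fun k hk => ?_)
    · rw [integral_stepFunction_smul c hA (integrable_cayley_coe_coe (hnull k).1.integrable)]
      apply Complex.ext
      · simp [re_setIntegral_cayley_coe_coe (hnull k).1.integrable]
      · simpa using hb k
    · rw [integral_stepFunction_smul c hA (hnull k).1.integrable]
      exact hslope k (hJ k hk)
  refine ⟨j, measure_mono_null (fun κ hκ => ?_) (ae_iff.1 hae)⟩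
  simpa [stepFunction_of_mem c hd hκ] using hj

/-! ### Reciprocals of finite Herglotz sums -/

section HerglotzSum

open Polynomial Lagrange

lemma eval_div_eval_nodal {K ι : Type*} [Field K] {Z : Finset ι} {v : ι → K}
    (hv : Set.InjOn v Z) {Q : K[X]} (hQ : Q.Monic) (hdeg : Q.natDegree = Z.card) {z : K}
    (hz : ∀ s ∈ Z, z ≠ v s) :
    Q.eval z / (nodal Z v).eval z
      = 1 + ∑ s ∈ Z, Q.eval (v s) / (derivative (nodal Z v)).eval (v s) * (z - v s)⁻¹ := by
  classical
  have hlt : (Q - nodal Z v).degree < Z.card := by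
    rw [← hdeg, ← degree_eq_natDegree hQ.ne_zero]
    refine degree_sub_lt_left ?_ hQ.ne_zero ?_
    · rw [degree_nodal, degree_eq_natDegree hQ.ne_zero, hdeg]
    · rw [hQ.leadingCoeff, nodal_monic.leadingCoeff]
  have heval := congrArg (eval z) (eq_interpolate hv hlt)
  rw [eval_sub, eval_interpolate_not_at_node _ hz] at heval
  have hne : (nodal Z v).eval z ≠ 0 := eval_nodal_not_at_node hz
  rw [sub_eq_iff_eq_add'.1 heval, add_div, div_self hne, mul_div_cancel_left₀ _ hne]
  congr 1
  refine Finset.sum_congr rfl fun s hs => ?_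
  rw [nodalWeight_eq_eval_derivative_nodal hs, eval_sub, eval_nodal_at_node hs, sub_zero]
  ring

lemma exists_finset_eq_C_mul_nodal {K : Type*} [Field K] [IsAlgClosed K] {A : Set K} {P : K[X]}
    (hA : ∀ z, P.IsRoot z → z ∈ A) (hsimple : ∀ z, P.IsRoot z → P.derivative.eval z ≠ 0) :
    ∃ Z : Finset A, P = C P.leadingCoeff * nodal Z (↑) := by
  classical
  have hnodup : P.roots.Nodup := Multiset.nodup_iff_count_le_one.2 fun z => by
    by_contra! hlt
    rw [count_roots] at hlt
    have hP : P ≠ 0 := by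
      rintro rfl
      simp at hlt
    obtain ⟨hz, hz'⟩ := (one_lt_rootMultiplicity_iff_isRoot hP).1 hlt
    exact hsimple z hz hz'
  refine ⟨P.roots.toFinset.subtype (· ∈ A), ?_⟩
  have hmap : (P.roots.toFinset.subtype (· ∈ A)).map (.subtype _) = P.roots.toFinset :=
    Finset.subtype_map_of_mem fun z hz => hA z (isRoot_of_mem_roots (Multiset.mem_toFinset.1 hz))
  have hprod := Finset.prod_map (P.roots.toFinset.subtype (· ∈ A)) (.subtype _) fun x => X - C x
  rw [hmap, Finset.prod_eq_multiset_prod, Multiset.toFinset_val, hnodup.dedup] at hprod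
  conv_lhs => rw [(IsAlgClosed.splits P).eq_prod_roots, hprod]
  rfl

/-- The Herglotz integral of the measure with mass `m κ` at each point `κ` of the finite set `S`. -/
noncomputable def herglotzSum (β : ℝ) (m : UnitCircle → ℝ) (S : Finset UnitCircle) (z : ℂ) : ℂ :=
  Complex.I * β + ∑ κ ∈ S, (m κ : ℂ) * cayley κ z

/-- The mass at `s` in the Herglotz representation of the reciprocal of `herglotzSum β m S`, for a
zero `s` of the latter. -/
noncomputable def dualMass (m : UnitCircle → ℝ) (S : Finset UnitCircle) (s : UnitCircle) : ℝ :=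
  (4 * ∑ κ ∈ S, m κ / ‖(κ : ℂ) - s‖ ^ 2)⁻¹

/-- The numerator of `herglotzSum β m S` over the common denominator `∏ κ ∈ S, (X - κ)`. -/
noncomputable def herglotzNumerator (β : ℝ) (m : UnitCircle → ℝ) (S : Finset UnitCircle) : ℂ[X] :=
  C (Complex.I * β - ∑ κ ∈ S, (m κ : ℂ)) * nodal S Subtype.val -
    interpolate S Subtype.val fun κ => 2 * (κ : ℂ) * m κ / nodalWeight S Subtype.val κ

lemma cayley_eq_neg_one_sub {κ z : ℂ} (h : z ≠ κ) : cayley κ z = -1 - 2 * κ * (z - κ)⁻¹ := by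
  have hzκ : z - κ ≠ 0 := sub_ne_zero.2 h
  rw [cayley, ← neg_sub z κ]
  field_simp
  ring

variable {β : ℝ} {m : UnitCircle → ℝ} {S Z : Finset UnitCircle}

lemma re_herglotzSum (z : ℂ) :
    (herglotzSum β m S z).re = (1 - ‖z‖ ^ 2) * ∑ κ ∈ S, m κ / ‖(κ : ℂ) - z‖ ^ 2 := by
  rw [herglotzSum, Complex.add_re, Complex.I_mul_re, Complex.ofReal_im, neg_zero, zero_add,
    Complex.re_sum, Finset.mul_sum]
  refine Finset.sum_congr rfl fun κ _ => ?_
  rw [Complex.re_ofReal_mul, re_cayley_coe]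
  ring

lemma sum_div_norm_sq_pos (hm : ∀ κ ∈ S, 0 < m κ) (hS : S.Nonempty) {z : ℂ}
    (hz : ∀ κ ∈ S, z ≠ κ) : 0 < ∑ κ ∈ S, m κ / ‖(κ : ℂ) - z‖ ^ 2 :=
  Finset.sum_pos (fun κ hκ => div_pos (hm κ hκ)
    (pow_pos (norm_pos_iff.2 (sub_ne_zero.2 (hz κ hκ).symm)) 2)) hS

lemma norm_eq_one_of_herglotzSum_eq_zero (hm : ∀ κ ∈ S, 0 < m κ) (hS : S.Nonempty) {z : ℂ}
    (hz : ∀ κ ∈ S, z ≠ κ) (h0 : herglotzSum β m S z = 0) : ‖z‖ = 1 := by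
  have hre := congrArg Complex.re h0
  rw [re_herglotzSum, Complex.zero_re, mul_eq_zero,
    or_iff_left (sum_div_norm_sq_pos hm hS hz).ne', sub_eq_zero] at hre
  exact (pow_eq_one_iff_of_nonneg (norm_nonneg z) two_ne_zero).1 hre.symm

lemma hasDerivAt_herglotzSum {s : UnitCircle} (hs : s ∉ S) :
    HasDerivAt (herglotzSum β m S) (-(2 * (s : ℂ) * dualMass m S s)⁻¹) s := by
  have hne : ∀ κ ∈ S, (κ : ℂ) - s ≠ 0 := fun κ hκ =>
    UnitCircle.coe_sub_coe_ne_zero (ne_of_mem_of_not_mem hκ hs)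
  refine ((HasDerivAt.fun_sum fun κ hκ =>
    (hasDerivAt_cayley (hne κ hκ)).const_mul (m κ : ℂ)).const_add _).congr_deriv ?_
  rw [dualMass, Complex.ofReal_inv, mul_inv, inv_inv, Complex.ofReal_mul, Complex.ofReal_sum,
    Finset.mul_sum, Finset.mul_sum, ← Finset.sum_neg_distrib]
  refine Finset.sum_congr rfl fun κ hκ => ?_
  have hκs := hne κ hκ
  have hκ := κ.coe_ne_zero
  have hs := s.coe_ne_zero
  rw [Complex.ofReal_div, UnitCircle.ofReal_norm_coe_sub_coe_sq]
  push_cast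
  field_simp
  ring

lemma eval_herglotzNumerator {z : ℂ} (hz : ∀ κ ∈ S, z ≠ κ) :
    (herglotzNumerator β m S).eval z = herglotzSum β m S z * (nodal S Subtype.val).eval z := by
  have hterm : ∀ κ ∈ S, nodalWeight S Subtype.val κ * (z - κ)⁻¹ *
      (2 * (κ : ℂ) * m κ / nodalWeight S Subtype.val κ) = -((m κ : ℂ) * cayley κ z) - m κ :=
    fun κ hκ => by
      have hw := nodalWeight_ne_zero (v := Subtype.val) Subtype.val_injective.injOn hκ
      rw [cayley_eq_neg_one_sub (hz κ hκ)]
      field_simp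
      ring
  rw [herglotzNumerator, eval_sub, eval_C_mul, eval_interpolate_not_at_node _ hz,
    Finset.sum_congr rfl hterm, Finset.sum_sub_distrib, Finset.sum_neg_distrib, herglotzSum]
  ring

lemma eval_herglotzNumerator_ne_zero (hm : ∀ κ ∈ S, 0 < m κ) {κ : UnitCircle} (hκ : κ ∈ S) :
    (herglotzNumerator β m S).eval (κ : ℂ) ≠ 0 := by
  have hinj : Set.InjOn (Subtype.val : UnitCircle → ℂ) S := Subtype.val_injective.injOn
  rw [herglotzNumerator, eval_sub, eval_C_mul, eval_nodal_at_node hκ,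
    eval_interpolate_at_node _ hinj hκ, mul_zero, zero_sub, neg_ne_zero]
  exact div_ne_zero (mul_ne_zero (mul_ne_zero two_ne_zero κ.coe_ne_zero)
    (Complex.ofReal_ne_zero.2 (hm κ hκ).ne')) (nodalWeight_ne_zero hinj hκ)

lemma degree_herglotzNumerator (hm : ∀ κ ∈ S, 0 < m κ) (hS : S.Nonempty) :
    (herglotzNumerator β m S).degree = S.card := by
  have hne : Complex.I * β - ∑ κ ∈ S, (m κ : ℂ) ≠ 0 := fun h => by
    have hre := congrArg Complex.re h
    simp only [Complex.sub_re, Complex.I_mul_re, Complex.ofReal_im, Complex.re_sum,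
      Complex.ofReal_re, Complex.zero_re] at hre
    linarith [Finset.sum_pos hm hS]
  have hdeg : (C (Complex.I * β - ∑ κ ∈ S, (m κ : ℂ)) * nodal S Subtype.val).degree = S.card := by
    rw [degree_C_mul hne, degree_nodal]
  rw [herglotzNumerator, degree_sub_eq_left_of_degree_lt, hdeg]
  rw [hdeg]
  exact degree_interpolate_lt _ Subtype.val_injective.injOn

lemma isRoot_herglotzNumerator_iff (hm : ∀ κ ∈ S, 0 < m κ) {z : ℂ} :
    (herglotzNumerator β m S).IsRoot z ↔ (∀ κ ∈ S, z ≠ κ) ∧ herglotzSum β m S z = 0 := by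
  by_cases hz : ∀ κ ∈ S, z ≠ κ
  · rw [IsRoot.def, eval_herglotzNumerator hz, mul_eq_zero,
      or_iff_left (eval_nodal_not_at_node hz), and_iff_right hz]
  · refine iff_of_false ?_ fun h => hz h.1
    push Not at hz
    obtain ⟨κ, hκ, rfl⟩ := hz
    exact eval_herglotzNumerator_ne_zero hm hκ

lemma eval_derivative_herglotzNumerator {s : UnitCircle} (hs : s ∉ S)
    (h0 : herglotzSum β m S s = 0) :
    (herglotzNumerator β m S).derivative.eval (s : ℂ)
      = -(2 * (s : ℂ) * dualMass m S s)⁻¹ * (nodal S Subtype.val).eval (s : ℂ) := by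
  have hev : ∀ᶠ z : ℂ in 𝓝 s, ∀ κ ∈ S, z ≠ κ :=
    S.eventually_all.2 fun κ hκ => eventually_ne_nhds fun h => hs (Subtype.ext h ▸ hκ)
  have hprod := (hasDerivAt_herglotzSum (β := β) (m := m) hs).mul
    ((nodal S Subtype.val).hasDerivAt (s : ℂ))
  rw [h0, zero_mul, add_zero] at hprod
  refine ((herglotzNumerator β m S).hasDerivAt _).unique (hprod.congr_of_eventuallyEq ?_)
  filter_upwards [hev] with z hz using eval_herglotzNumerator hz

lemma dualMass_pos (hm : ∀ κ ∈ S, 0 < m κ) (hS : S.Nonempty) {s : UnitCircle} (hs : s ∉ S) :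
    0 < dualMass m S s :=
  inv_pos.2 (mul_pos four_pos (sum_div_norm_sq_pos hm hS fun _ hκ h => hs (Subtype.ext h ▸ hκ)))

lemma exists_herglotzNumerator_eq (hm : ∀ κ ∈ S, 0 < m κ) (hS : S.Nonempty) :
    ∃ (Z : Finset UnitCircle) (c : ℂ), c ≠ 0 ∧ Z.card = S.card ∧
      herglotzNumerator β m S = C c * nodal Z Subtype.val := by
  have hroots : ∀ z, (herglotzNumerator β m S).IsRoot z → z ∈ Metric.sphere 0 1 := fun z hz => by
    obtain ⟨hzS, h0⟩ := (isRoot_herglotzNumerator_iff hm).1 hz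
    exact mem_sphere_zero_iff_norm.2 (norm_eq_one_of_herglotzSum_eq_zero hm hS hzS h0)
  obtain ⟨Z, hZ⟩ := exists_finset_eq_C_mul_nodal hroots fun z hz => by
    obtain ⟨hzS, h0⟩ := (isRoot_herglotzNumerator_iff hm).1 hz
    lift z to UnitCircle using hroots z hz
    have hs : z ∉ S := fun h => hzS z h rfl
    have ha : (dualMass m S z : ℂ) ≠ 0 := Complex.ofReal_ne_zero.2 (dualMass_pos hm hS hs).ne'
    rw [eval_derivative_herglotzNumerator hs h0]
    exact mul_ne_zero (neg_ne_zero.2 (inv_ne_zero (mul_ne_zero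
      (mul_ne_zero two_ne_zero (UnitCircle.coe_ne_zero z)) ha))) (eval_nodal_not_at_node hzS)
  have hdeg := degree_herglotzNumerator (β := β) hm hS
  have hc : (herglotzNumerator β m S).leadingCoeff ≠ 0 := by
    rw [leadingCoeff_ne_zero, ← degree_ne_bot, hdeg]
    exact WithBot.coe_ne_bot
  refine ⟨Z, _, hc, ?_, hZ⟩
  rw [hZ, degree_C_mul hc, degree_nodal] at hdeg
  exact_mod_cast hdeg

lemma inv_herglotzSum_eq (hm : ∀ κ ∈ S, 0 < m κ) {c : ℂ} (hZ : Z.card = S.card)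
    (hP : herglotzNumerator β m S = C c * nodal Z Subtype.val) {z : ℂ} (hzS : ∀ κ ∈ S, z ≠ κ)
    (hzZ : ∀ s ∈ Z, z ≠ s) :
    (herglotzSum β m S z)⁻¹ = c⁻¹ + ∑ s ∈ Z, (dualMass m S s : ℂ)
      + ∑ s ∈ Z, (dualMass m S s : ℂ) * cayley s z := by
  have hquot : (herglotzSum β m S z)⁻¹
      = c⁻¹ * ((nodal S Subtype.val).eval z / (nodal Z Subtype.val).eval z) := by
    have heval := eval_herglotzNumerator (β := β) (m := m) hzS
    rw [hP, eval_C_mul] at heval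
    rw [eq_div_of_mul_eq (eval_nodal_not_at_node hzS) heval.symm, inv_div, div_mul_eq_div_div_swap,
      div_eq_inv_mul]
  rw [hquot, eval_div_eval_nodal Subtype.val_injective.injOn nodal_monic
    (natDegree_nodal.trans hZ.symm) hzZ, mul_add, mul_one, add_assoc, ← Finset.sum_add_distrib,
    Finset.mul_sum]
  congr 1
  refine Finset.sum_congr rfl fun s hs => ?_
  have hroot : (herglotzNumerator β m S).IsRoot s := by
    rw [IsRoot.def, hP, eval_C_mul, eval_nodal_at_node (v := Subtype.val) hs, mul_zero]
  obtain ⟨hsS, h0⟩ := (isRoot_herglotzNumerator_iff hm).1 hroot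
  have hder := eval_derivative_herglotzNumerator (fun h => hsS s h rfl) h0
  rw [hP, derivative_C_mul, eval_C_mul] at hder
  have hne : (nodal S Subtype.val).eval (s : ℂ) ≠ 0 := eval_nodal_not_at_node hsS
  have hmass : c⁻¹ * ((nodal S Subtype.val).eval (s : ℂ) /
      (derivative (nodal Z Subtype.val)).eval (s : ℂ)) = -(2 * (s : ℂ) * dualMass m S s) := by
    rw [← div_eq_inv_mul, div_div, mul_comm _ c, hder, div_mul_cancel_right₀ hne, inv_neg, inv_inv]
  rw [cayley_eq_neg_one_sub (hzZ s hs), ← mul_assoc, hmass]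
  ring

instance : Infinite UnitCircle :=
  Set.infinite_coe_iff.2 ((isPreconnected_sphere (by simp) (0 : ℂ) 1).infinite_of_nontrivial
    ⟨1, by simp, -1, by simp, by norm_num⟩)

theorem exists_inv_herglotzSum (hm : ∀ κ ∈ S, 0 < m κ) (hS : S.Nonempty) :
    ∃ (Z : Finset UnitCircle) (b : ℝ), Z.card = S.card ∧
      (∀ s ∉ S, herglotzSum β m S s = 0 → s ∈ Z) ∧
      ∀ z, ‖z‖ < 1 → (herglotzSum β m S z)⁻¹ = herglotzSum b (dualMass m S) Z z := by
  obtain ⟨Z, c, hc, hcard, hP⟩ := exists_herglotzNumerator_eq (β := β) hm hS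
  have hinv := fun z => inv_herglotzSum_eq (z := z) hm hcard hP
  set d := c⁻¹ + ∑ s ∈ Z, (dualMass m S s : ℂ)
  have hd : d.re = 0 := by
    obtain ⟨κ, hκ⟩ := Infinite.exists_notMem_finset (S ∪ Z)
    rw [Finset.notMem_union] at hκ
    have hκinv := congrArg Complex.re (hinv κ (fun _ h h' => hκ.1 (Subtype.ext h' ▸ h))
      fun _ h h' => hκ.2 (Subtype.ext h' ▸ h))
    have hre : (herglotzSum β m S κ).re = 0 := by simp [re_herglotzSum]
    have hre' : (herglotzSum 0 (dualMass m S) Z κ).re = 0 := by simp [re_herglotzSum]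
    rw [herglotzSum, Complex.ofReal_zero, mul_zero, zero_add] at hre'
    rw [Complex.inv_re, hre, zero_div, Complex.add_re, hre', add_zero] at hκinv
    exact hκinv.symm
  refine ⟨Z, d.im, hcard, fun s hs h0 => ?_, fun z hz => ?_⟩
  · have hroot : (herglotzNumerator β m S).IsRoot s :=
      (isRoot_herglotzNumerator_iff hm).2 ⟨fun κ hκ h => hs (Subtype.ext h ▸ hκ), h0⟩
    by_contra hsZ
    rw [IsRoot.def, hP, eval_C_mul] at hroot
    exact mul_ne_zero hc (eval_nodal_not_at_node (v := Subtype.val) fun x hx h =>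
      hsZ ((Subtype.ext h : s = x) ▸ hx)) hroot
  · rw [hinv z (fun κ _ => (sub_ne_zero.1 (κ.coe_sub_ne_zero hz)).symm) fun κ _ =>
      (sub_ne_zero.1 (κ.coe_sub_ne_zero hz)).symm, herglotzSum]
    congr 1
    exact Complex.ext (by simp [hd]) (by simp)

end HerglotzSum

/-! ### The rational form of extreme points -/

lemma integral_eq_sum_of_measure_compl_finset {X E : Type*} [MeasurableSpace X]
    [MeasurableSingletonClass X] [NormedAddCommGroup E] [NormedSpace ℝ E] [CompleteSpace E]
    {ν : Measure X} [IsFiniteMeasure ν] {S : Finset X} (hS : ν (S : Set X)ᶜ = 0) (f : X → E) :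
    ∫ x, f x ∂ν = ∑ x ∈ S, ν.real {x} • f x := by
  rw [← setIntegral_finset S IntegrableOn.finset, Measure.restrict_eq_self_of_ae_mem]
  exact hS

section FiniteSupport

variable {β : ℝ} {ν : Measure UnitCircle} [IsFiniteMeasure ν] {S : Finset UnitCircle}

lemma herglotz_eq_herglotzSum (hS : ν (S : Set UnitCircle)ᶜ = 0) (z : ℂ) :
    herglotz β ν z = herglotzSum β (fun κ => ν.real {κ}) S z := by
  simp only [herglotz, herglotzSum, integral_eq_sum_of_measure_compl_finset hS, Complex.real_smul]

lemma dualMass_eq_inv_angularSlope (hS : ν (S : Set UnitCircle)ᶜ = 0) (s : UnitCircle) :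
    dualMass (fun κ => ν.real {κ}) S s = (2 * angularSlope ν s)⁻¹ := by
  simp only [dualMass, angularSlope, integral_eq_sum_of_measure_compl_finset hS, smul_eq_mul,
    div_eq_mul_inv]
  ring

lemma exists_inv_herglotz (hS : ν (S : Set UnitCircle)ᶜ = 0) (hpos : ∀ κ ∈ S, ν {κ} ≠ 0)
    (hν : ν ≠ 0) :
    ∃ (Z : Finset UnitCircle) (b : ℝ), Z.card = S.card ∧
      (∀ s, IsRegularNullPoint β ν s → s ∈ Z ∧ 0 < angularSlope ν s) ∧
      ∀ z, ‖z‖ < 1 →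
        (herglotz β ν z)⁻¹ = herglotzSum b (fun s => (2 * angularSlope ν s)⁻¹) Z z := by
  have hm : ∀ κ ∈ S, 0 < ν.real {κ} := fun κ hκ =>
    ENNReal.toReal_pos (hpos κ hκ) (measure_ne_top _ _)
  have hne : S.Nonempty := by
    rw [Finset.nonempty_iff_ne_empty]
    rintro rfl
    exact hν (by simpa using hS)
  obtain ⟨Z, b, hcard, hZ, hinv⟩ := exists_inv_herglotzSum (β := β) hm hne
  refine ⟨Z, b, hcard, fun s hs => ?_, fun z hz => ?_⟩
  · have hsS : s ∉ S := fun h => hpos s h hs.measure_singleton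
    have hslope := dualMass_pos hm hne hsS
    rw [dualMass_eq_inv_angularSlope hS, inv_pos] at hslope
    exact ⟨hZ s hsS (herglotz_eq_herglotzSum hS s ▸ hs.eq_zero), by linarith⟩
  · simp only [← dualMass_eq_inv_angularSlope hS, herglotz_eq_herglotzSum hS, hinv z hz]

end FiniteSupport

lemma exists_fin_sum_eq_sum {X Y : Type*} [Nonempty X] {T : Finset Y} {M : ℕ} (hT : T.card ≤ M)
    {a : Y → ℝ} (ha : ∀ y ∈ T, 0 ≤ a y) (p : Y → X) :
    ∃ (w : Fin M → ℝ) (s : Fin M → X), (∀ j, 0 ≤ w j) ∧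
      ∀ F : X → ℂ, ∑ j, (w j : ℂ) * F (s j) = ∑ y ∈ T, (a y : ℂ) * F (p y) := by
  obtain ⟨r, rfl⟩ := Nat.exists_eq_add_of_le hT
  let e := T.equivFin.symm
  refine ⟨Fin.append (fun i => a (e i)) fun _ => 0,
    Fin.append (fun i => p (e i)) fun _ => Classical.arbitrary X, fun j => ?_, fun F => ?_⟩
  · refine Fin.addCases (fun i => ?_) (fun i => ?_) j
    · simpa using ha _ (e i).2
    · simp
  · rw [Fin.sum_univ_add]
    simp only [Fin.append_left, Fin.append_right, Complex.ofReal_zero, zero_mul,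
      Finset.sum_const_zero, add_zero]
    rw [Equiv.sum_comp e fun y : T => (a y : ℂ) * F (p y),
      Finset.sum_coe_sort T fun y => (a y : ℂ) * F (p y)]

lemma exists_fin_sum_add_sum_eq_sum {ι X : Type*} [Fintype ι] [Nonempty X] {σ : ι → X}
    (hσ : Function.Injective σ) {Z : Finset X} (hσZ : ∀ k, σ k ∈ Z) {a : X → ℝ}
    (ha : ∀ x ∈ Z, 0 ≤ a x) {α : ι → ℝ} (hα : ∀ k, α k ≤ a (σ k)) {J : Finset ι}
    (hJ : ∀ k ∈ J, α k = a (σ k)) {M : ℕ} (hZ : Z.card ≤ M + J.card) :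
    ∃ (w : Fin M → ℝ) (s : Fin M → X), (∀ j, 0 ≤ w j) ∧ ∀ F : X → ℂ,
      ∑ j, (w j : ℂ) * F (s j) + ∑ k, (α k : ℂ) * F (σ k) = ∑ x ∈ Z, (a x : ℂ) * F x := by
  classical
  have himage : Finset.univ.image σ ⊆ Z := Finset.image_subset_iff.2 fun k _ => hσZ k
  have hcard : ((Z \ Finset.univ.image σ).disjSum Jᶜ).card ≤ M := by
    rw [Finset.card_disjSum, Finset.card_sdiff_of_subset himage,
      Finset.card_image_of_injective _ hσ, Finset.card_univ, Finset.card_compl]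
    have := Finset.card_le_card himage
    rw [Finset.card_image_of_injective _ hσ, Finset.card_univ] at this
    have := J.card_le_univ
    omega
  obtain ⟨w, s, hw, hsum⟩ := exists_fin_sum_eq_sum hcard
    (a := Sum.elim a fun k => a (σ k) - α k) (by
      rintro (x | k) hy
      · exact ha x (Finset.mem_sdiff.1 (Finset.inl_mem_disjSum.1 hy)).1
      · exact sub_nonneg.2 (hα k)) (Sum.elim id σ)
  refine ⟨w, s, hw, fun F => ?_⟩
  have hcompl : ∑ k ∈ Jᶜ, ((a (σ k) - α k : ℝ) : ℂ) * F (σ k) =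
      ∑ k, ((a (σ k) - α k : ℝ) : ℂ) * F (σ k) :=
    Finset.sum_subset (Finset.subset_univ _) fun k _ hk => by
      simp [hJ k (by simpa using hk)]
  rw [hsum, Finset.sum_disjSum]
  simp only [Sum.elim_inl, Sum.elim_inr, id_eq]
  rw [hcompl, add_assoc, ← Finset.sum_add_distrib, ← Finset.sum_sdiff himage,
    Finset.sum_image fun _ _ _ _ h => hσ h]
  congr 1
  refine Finset.sum_congr rfl fun k _ => ?_
  push_cast
  ring

lemma angularSlope_nonneg (ν : Measure UnitCircle) (σ : UnitCircle) : 0 ≤ angularSlope ν σ :=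
  mul_nonneg zero_le_two (integral_nonneg fun _ => by positivity)

lemma berksonPorta_eq_zero_of_isRegularNullPoint {τ : ℂ} {β : ℝ} {σ : UnitCircle}
    (hσ : IsRegularNullPoint β 0 σ) : berksonPorta τ β 0 = 0 := by
  have hβ : Complex.I * β = 0 := by simpa [herglotz] using hσ.eq_zero
  funext z
  simp [berksonPorta, herglotz, hβ]

lemma pZero_weight_eq_inv {τ : ℂ} {σ : UnitCircle} {lam : ℝ} (hlam : 0 ≤ -lam) :
    ‖τ - σ‖ ^ 2 / (2 * |lam|) = (2 * (-lam / ‖τ - σ‖ ^ 2))⁻¹ := by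
  rw [abs_of_nonpos (by linarith), ← mul_div_assoc, inv_div]

theorem exists_rational_form_of_mem_extremePoints {τ : ℂ} (hτ : ‖τ‖ ≤ 1) {n : ℕ} [NeZero n]
    {σ : Fin n → UnitCircle} (hσi : Function.Injective σ) (hσ : ∀ k, τ ≠ σ k) {Λ : Fin n → ℝ}
    {G : 𝔻 → ℂ} (hG : G ∈ (GenClass τ σ Λ).extremePoints ℝ) (hG0 : G ≠ 0) :
    ∃ (b : ℝ) (a : Fin (n - 1) → ℝ) (s : Fin (n - 1) → UnitCircle), (∀ j, 0 ≤ a j) ∧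
      ∀ z : 𝔻, G z = dwFactor τ z /
        (Complex.I * b + ∑ j, (a j : ℂ) * cayley (s j) z + pZero τ σ Λ z) := by
  obtain ⟨β, ν, hfin, rfl, hnull⟩ := (mem_genClass_iff hτ hσ).1 hG.1
  have hν : ν ≠ 0 := by
    rintro rfl
    exact hG0 (berksonPorta_eq_zero_of_isRegularNullPoint (hnull 0).1)
  let J := Finset.univ.filter fun k => angularSlope ν (σ k) = -Λ k / ‖τ - σ k‖ ^ 2
  obtain ⟨S, hcard, hS, hpos⟩ := exists_finset_of_mem_extremePoints hτ hσ hG hnull (J := J)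
    fun k hk => by simpa [J] using hk
  obtain ⟨Z, b, hZcard, hZ, hinv⟩ := exists_inv_herglotz (β := β) hS hpos hν
  have hslope (k) : 0 < angularSlope ν (σ k) := (hZ _ (hnull k).1).2
  have hweight (k) : ‖τ - σ k‖ ^ 2 / (2 * |Λ k|) = (2 * (-Λ k / ‖τ - σ k‖ ^ 2))⁻¹ := by
    have hdist : 0 < ‖τ - σ k‖ ^ 2 := pow_pos (norm_pos_iff.2 (sub_ne_zero.2 (hσ k))) 2
    exact pZero_weight_eq_inv
      ((div_pos_iff_of_pos_right hdist).1 ((hslope k).trans_le (hnull k).2)).le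
  have hle (k) : ‖τ - σ k‖ ^ 2 / (2 * |Λ k|) ≤ (2 * angularSlope ν (σ k))⁻¹ := by
    rw [hweight]
    have := hslope k
    gcongr
    exact (hnull k).2
  have heq : ∀ k ∈ J, ‖τ - σ k‖ ^ 2 / (2 * |Λ k|) = (2 * angularSlope ν (σ k))⁻¹ := fun k hk => by
    rw [hweight, (Finset.mem_filter.1 hk).2]
  have hn := NeZero.pos n
  obtain ⟨a, s, ha, hsum⟩ := exists_fin_sum_add_sum_eq_sum (M := n - 1) hσi
    (fun k => (hZ _ (hnull k).1).1)
    (fun x _ => inv_nonneg.2 (mul_nonneg zero_le_two (angularSlope_nonneg ν x))) hle heq (by omega)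
  refine ⟨b, a, s, ha, fun z => ?_⟩
  have hz := hinv z z.norm_lt_one
  rw [berksonPorta, ← inv_inv (herglotz β ν z), hz, herglotzSum, ← hsum, div_eq_mul_inv,
    ← add_assoc]
  rfl

theorem mainTheorem8 (τ : ℂ) (hτ : ‖τ‖ ≤ 1) :
    (∀ (n : ℕ) (_ : 1 ≤ n) (σ : Fin n → UnitCircle) (_ : Function.Injective σ)
      (_ : ∀ k, τ ≠ (σ k : ℂ)) (Λ : Fin n → ℝ) (_ : ∀ k, Λ k < 0) (G : 𝔻 → ℂ),
      G ∈ (GenClass τ σ Λ).extremePoints ℝ → G ≠ 0 →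
        ∃ (b : ℝ) (a : Fin (n - 1) → ℝ) (s : Fin (n - 1) → UnitCircle), (∀ j, 0 ≤ a j) ∧
          ∀ z : 𝔻, G z = ((τ - (z : ℂ)) * (1 - conj τ * (z : ℂ))) /
            (Complex.I * (b : ℂ)
              + ∑ j, (a j : ℂ) * (((s j : ℂ) + (z : ℂ)) / ((s j : ℂ) - (z : ℂ)))
              + pZero τ σ Λ (z : ℂ))) ∧
    (∀ (σ : UnitCircle) (_ : τ ≠ (σ : ℂ)) (lam : ℝ) (_ : lam < 0) (G : 𝔻 → ℂ),
      G ∈ GenClass τ (fun _ : Fin 1 => σ) (fun _ : Fin 1 => lam) ↔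
        ∃ μ : Measure UnitCircle, IsProbabilityMeasure μ ∧
          ∀ z : 𝔻, G z = ((|lam| / ‖(σ : ℂ) - τ‖ ^ 2 : ℝ) : ℂ) * (τ - (z : ℂ)) *
            (1 - conj τ * (z : ℂ)) * (1 - conj (σ : ℂ) * (z : ℂ)) *
              ∫ κ : UnitCircle, (1 - (κ : ℂ)) / (1 - (κ : ℂ) * conj (σ : ℂ) * (z : ℂ)) ∂μ) :=
  ⟨fun n hn σ hσi hσ Λ _ G hG hG0 =>
    haveI : NeZero n := ⟨by omega⟩
    exists_rational_form_of_mem_extremePoints hτ hσi hσ hG hG0,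
  fun σ hσ lam hlam G => mem_genClass_single_iff σ hτ hσ hlam⟩
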